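/- **Setting.** Let $q\in\mathbb C$, $q\neq 0$, be generic, i.e. $q^N\neq 1$ for every integer $N\ge 1$. Put $q^x=e^{x\log q}$ (principal logarithm), $[x]=(q^x-q^{-x})/(q-q^{-1})$ for $x\in\mathbb C$, and let $[x]^{1/2}$ be the principal square root of $[x]$; a square root of a product or quotient of such brackets means the product or quotient of these roots. $U_q[gl(2/1)]$ is the associative unital $\mathbb C$-algebra generated by $K_i^{\pm1}=q^{\pm E_{ii}}$ ($i=1,2,3$), $E_{12},E_{21},E_{23},E_{32}$ with the relations $$K_iK_i^{-1}=K_i^{-1}K_i=1,\quad K_iK_j=K_jK_i,\quad K_iE_{j,j+1}K_i^{-1}=q^{\delta_{ij}-\delta_{i,j+1}}E_{j,j+1},\quad K_iE_{j+1,j}K_i^{-1}=q^{\delta_{i,j+1}-\delta_{ij}}E_{j+1,j},$$ $$[E_{12},E_{32}]=[E_{21},E_{23}]=0,\quad [E_{12},E_{21}]=\frac{q^{h_1}-q^{-h_1}}{q-q^{-1}},\quad \{E_{23},E_{32}\}=\frac{q^{h_2}-q^{-h_2}}{q-q^{-1}},\quad E_{23}^2=E_{32}^2=0,$$ $$E_{12}E_{13}=qE_{13}E_{12},\quad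 E_{21}E_{31}=qE_{31}E_{21},$$ where $q^{h_1}=K_1K_2^{-1}$, $q^{h_2}=K_2K_3$, $E_{13}=E_{12}E_{23}-q^{-1}E_{23}E_{12}$, $E_{31}=-(E_{21}E_{32}-q^{-1}E_{32}E_{21})$. $U_q[sl(2/1)]$ is generated by $q^{\pm h_1},q^{\pm h_2},E_{12},E_{21},E_{23},E_{32}$ with the corresponding relations: $q^{\pm h_1},q^{\pm h_2}$ commute and are inverse to each other in pairs, $q^{h_i}E_{j,j+1}q^{-h_i}=q^{a_{ij}}E_{j,j+1}$ and $q^{h_i}E_{j+1,j}q^{-h_i}=q^{-a_{ij}}E_{j+1,j}$ with $(a_{ij})=\begin{pmatrix}2&-1\\-1&0\end{pmatrix}$, and the last two displayed lines. A representation is a homomorphism of $\mathbb C$-algebras into $\mathrm{End}(V)$; it is irreducible if $V\ne0$ and $V$ has no invariant subspace other than $0$ and $V$. It is *of type 1* if every eigenvalue of $q^{h_1}$ is an integral power of $q$ (i.e. $h_1$ has integral eigenvalues). The *sign automorphism* is $q^{h_1}\mapsto-q^{h_1}$ (for $gl$: $K_1\mapsto -K_1$), $E_{21}\mapsto -E_{21}$,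 all other $K_i$, respectively $q^{h_2}$, and $E_{12},E_{23},E_{32}$ being fixed. **The family.** Let $[m]=[m_{13},m_{23},m_{33}]\in\mathbb C^3$ with $2l:=m_{13}-m_{23}\in\mathbb Z_{\ge0}$, and let $a_1,a_2,a_3$ be nonzero numbers, which may depend on $[m]$ (and $q$). Put $l_{13}=m_{13}-1$, $l_{23}=m_{23}-2$, $l_{33}=m_{33}-1$. For $k=0,1,2,3$ let $[m_{12},m_{22},m_{32}]$ be, respectively, $[m_{13},m_{23},m_{33}]$, $[m_{13},m_{23}-1,m_{33}+1]$, $[m_{13}-1,m_{23},m_{33}+1]$, $[m_{13}-1,m_{23}-1,m_{33}+2]$, and let $V_k$ have a basis of vectors $(m)_k$ labelled by the numbers $m_{11}$ with $m_{12}-m_{11},\,m_{11}-m_{22}\in\mathbb Z_{\ge0}$; put $l_{12}=m_{12}-1$, $l_{22}=m_{22}-2$, $l_{11}=m_{11}-1$, and write $(m)=(m)_0$. (Vectors with inadmissible $m_{11}$ are $0$; vectors in one formula have the same $m_{11}$, and $(m)_k^{\pm11}$ has $m_{11}\pm1$ instead.) On $W^q([m])=V_0\oplus V_1\oplus V_2\oplus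 V_3$ let $K_1,K_2,K_3$ act on $(m)_k$ by $q^{m_{11}}$, $q^{m_{12}+m_{22}-m_{11}}$, $q^{m_{32}}$, and $$E_{12}(m)_k=([l_{12}-l_{11}][l_{11}-l_{22}])^{1/2}(m)_k^{+11},\qquad E_{21}(m)_k=([l_{12}-l_{11}+1][l_{11}-l_{22}-1])^{1/2}(m)_k^{-11},$$ $$E_{23}(m)=0,\qquad E_{23}(m)_1=a_1\Big(\tfrac{[l_{11}-l_{23}]}{[2l+1]}\Big)^{1/2}[l_{23}+l_{33}+3](m),\qquad E_{23}(m)_2=a_2\Big(\tfrac{[l_{13}-l_{11}]}{[2l]}\Big)^{1/2}[l_{13}+l_{33}+3](m),$$ $$E_{23}(m)_3=a_3\Big\{\tfrac1{a_1q}\Big(\tfrac{[l_{13}-l_{11}]}{[2l+1]}\Big)^{1/2}[l_{13}+l_{33}+3](m)_1-\tfrac1{a_2q}([l_{11}-l_{23}][2l])^{1/2}\tfrac{[l_{23}+l_{33}+3]}{[2l+1]}(m)_2\Big\},$$ $$E_{32}(m)=\tfrac1{a_1}\Big(\tfrac{[l_{11}-l_{23}]}{[2l+1]}\Big)^{1/2}(m)_1+\tfrac1{a_2}\tfrac{([l_{13}-l_{11}][2l])^{1/2}}{[2l+1]}(m)_2,$$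 $$E_{32}(m)_1=\tfrac{a_1}{a_3}q\Big(\tfrac{[l_{13}-l_{11}]}{[2l+1]}\Big)^{1/2}(m)_3,\qquad E_{32}(m)_2=-\tfrac{a_2}{a_3}q\Big(\tfrac{[l_{11}-l_{23}]}{[2l]}\Big)^{1/2}(m)_3,\qquad E_{32}(m)_3=0.$$ The family consists of * the typical modules $W^q([m])$, where $[l_{13}+l_{33}+3][l_{23}+l_{33}+3]\ne0$; * the nontypical modules of class 1, $W^q([m])/(V_3\oplus V_2)$, where $[l_{13}+l_{33}+3]=0$, $[l_{23}+l_{33}+3]\neq0$; * the nontypical modules of class 2, $W^q([m])/(V_3\oplus V_1)$, where $[l_{13}+l_{33}+3]\ne0$, $[l_{23}+l_{33}+3]=0$ (the nontypical ones are given by the same formulas with the basis vectors of the omitted $V_k$ replaced by $0$). For $U_q[sl(2/1)]$ the family consists of the same spaces with the same action of the $E_{ij}$, while $q^{h_1}$, $q^{h_2}$ act on $(m)_k$ by $q^{E_{11}-E_{22}}$, $q^{E_{22}+E_{33}}$, with $E_{11}=m_{11}$, $E_{22}=m_{12}+m_{22}-m_{11}$, $E_{33}=m_{32}$. **Lemma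 5.9.** For every choice of the nonzero constants $a_1,a_2,a_3$, the family contains, up to isomorphism, all finite-dimensional irreducible representations of type 1 of $U_q[gl(2/1)]$ and of $U_q[sl(2/1)]$. Moreover, for an arbitrary finite-dimensional irreducible representation $\rho$ of one of these algebras, $\rho$ itself or its composition with the sign automorphism is isomorphic to a member of the family. -/

import Mathlib

noncomputable section

namespace QuantumGL21

/-! ## The quantum superalgebras as associative algebras given by generators and relations -/

/-- The generators of `U_q[gl(2/1)]`: `K i` and `Kinv i` stand for `q ^ (± E_{i+1,i+1})`
(the index set `Fin 3` counts from `0`), and `E12, E21, E23, E32` for the Chevalley generators. -/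
inductive GLGen : Type
  | K (i : Fin 3)
  | Kinv (i : Fin 3)
  | E12
  | E21
  | E23
  | E32

/-- The generators of `U_q[sl(2/1)]`: `T i` and `Tinv i` stand for `q ^ (± h_{i+1})`, where
`h₁ = E₁₁ - E₂₂` and `h₂ = E₂₂ + E₃₃`. -/
inductive SLGen : Type
  | T (i : Fin 2)
  | Tinv (i : Fin 2)
  | E12
  | E21
  | E23
  | E32

/-- The relations among the Chevalley generators that do not change between `gl` and `sl`, in an
arbitrary algebra; `H₁, H₁', H₂, H₂'` are the elements `q^{h₁}, q^{-h₁}, q^{h₂}, q^{-h₂}`.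
`ChevalleyRel q … x y` says that `x = y` is one of these relations. -/
inductive ChevalleyRel {A : Type*} [Ring A] [Algebra ℂ A] (q : ℂ)
    (H₁ H₁' H₂ H₂' e12 e21 e23 e32 : A) : A → A → Prop
  | e12_e32 : ChevalleyRel q H₁ H₁' H₂ H₂' e12 e21 e23 e32 (e12 * e32) (e32 * e12)
  | e21_e23 : ChevalleyRel q H₁ H₁' H₂ H₂' e12 e21 e23 e32 (e21 * e23) (e23 * e21)
  | e12_e21 : ChevalleyRel q H₁ H₁' H₂ H₂' e12 e21 e23 e32
      (e12 * e21 - e21 * e12) ((q - q⁻¹)⁻¹ • (H₁ - H₁'))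
  | e23_e32 : ChevalleyRel q H₁ H₁' H₂ H₂' e12 e21 e23 e32
      (e23 * e32 + e32 * e23) ((q - q⁻¹)⁻¹ • (H₂ - H₂'))
  | e23_sq : ChevalleyRel q H₁ H₁' H₂ H₂' e12 e21 e23 e32 (e23 * e23) 0
  | e32_sq : ChevalleyRel q H₁ H₁' H₂ H₂' e12 e21 e23 e32 (e32 * e32) 0
  /-- `[E₁₂, E₁₃]_q = 0` with `E₁₃ = E₁₂ E₂₃ - q⁻¹ E₂₃ E₁₂`. -/
  | serre_e : ChevalleyRel q H₁ H₁' H₂ H₂' e12 e21 e23 e32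
      (e12 * (e12 * e23 - q⁻¹ • (e23 * e12))) (q • ((e12 * e23 - q⁻¹ • (e23 * e12)) * e12))
  /-- `[E₂₁, E₃₁]_q = 0` with `E₃₁ = -(E₂₁ E₃₂ - q⁻¹ E₃₂ E₂₁)`. -/
  | serre_f : ChevalleyRel q H₁ H₁' H₂ H₂' e12 e21 e23 e32
      (e21 * -(e21 * e32 - q⁻¹ • (e32 * e21))) (q • (-(e21 * e32 - q⁻¹ • (e32 * e21)) * e21))

/-- A generator of `U_q[gl(2/1)]` inside the free algebra. -/
abbrev gx (s : GLGen) : FreeAlgebra ℂ GLGen := FreeAlgebra.ι ℂ s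

/-- A generator of `U_q[sl(2/1)]` inside the free algebra. -/
abbrev sx (s : SLGen) : FreeAlgebra ℂ SLGen := FreeAlgebra.ι ℂ s

/-- `E_{ii}`-weight of `E₁₂`: `[E_{ii}, E₁₂] = (δ_{i1} - δ_{i2}) E₁₂`. -/
def glWt12 : Fin 3 → ℤ := ![1, -1, 0]

/-- `E_{ii}`-weight of `E₂₃`: `[E_{ii}, E₂₃] = (δ_{i2} - δ_{i3}) E₂₃`. -/
def glWt23 : Fin 3 → ℤ := ![0, 1, -1]

/-- `h_i`-weight of `E₁₂` (first column of the Cartan matrix of `sl(2/1)`). -/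
def slWt12 : Fin 2 → ℤ := ![2, -1]

/-- `h_i`-weight of `E₂₃` (second column of the Cartan matrix of `sl(2/1)`). -/
def slWt23 : Fin 2 → ℤ := ![-1, 0]

/-- The defining relations of `U_q[gl(2/1)]`. -/
inductive GLRel (q : ℂ) : FreeAlgebra ℂ GLGen → FreeAlgebra ℂ GLGen → Prop
  | K_Kinv (i : Fin 3) : GLRel q (gx (.K i) * gx (.Kinv i)) 1
  | Kinv_K (i : Fin 3) : GLRel q (gx (.Kinv i) * gx (.K i)) 1
  | K_K (i j : Fin 3) : GLRel q (gx (.K i) * gx (.K j)) (gx (.K j) * gx (.K i))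
  | K_E12 (i : Fin 3) : GLRel q (gx (.K i) * gx .E12 * gx (.Kinv i)) (q ^ glWt12 i • gx .E12)
  | K_E21 (i : Fin 3) : GLRel q (gx (.K i) * gx .E21 * gx (.Kinv i)) (q ^ (-glWt12 i) • gx .E21)
  | K_E23 (i : Fin 3) : GLRel q (gx (.K i) * gx .E23 * gx (.Kinv i)) (q ^ glWt23 i • gx .E23)
  | K_E32 (i : Fin 3) : GLRel q (gx (.K i) * gx .E32 * gx (.Kinv i)) (q ^ (-glWt23 i) • gx .E32)
  /-- Here `q^{h₁} = K₁ K₂⁻¹` and `q^{h₂} = K₂ K₃`, as `h₁ = E₁₁ - E₂₂`, `h₂ = E₂₂ + E₃₃`. -/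
  | chevalley {x y : FreeAlgebra ℂ GLGen}
      (h : ChevalleyRel q (gx (.K 0) * gx (.Kinv 1)) (gx (.Kinv 0) * gx (.K 1))
        (gx (.K 1) * gx (.K 2)) (gx (.Kinv 1) * gx (.Kinv 2))
        (gx .E12) (gx .E21) (gx .E23) (gx .E32) x y) : GLRel q x y

/-- The defining relations of `U_q[sl(2/1)]`. -/
inductive SLRel (q : ℂ) : FreeAlgebra ℂ SLGen → FreeAlgebra ℂ SLGen → Prop
  | T_Tinv (i : Fin 2) : SLRel q (sx (.T i) * sx (.Tinv i)) 1
  | Tinv_T (i : Fin 2) : SLRel q (sx (.Tinv i) * sx (.T i)) 1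
  | T_T (i j : Fin 2) : SLRel q (sx (.T i) * sx (.T j)) (sx (.T j) * sx (.T i))
  | T_E12 (i : Fin 2) : SLRel q (sx (.T i) * sx .E12 * sx (.Tinv i)) (q ^ slWt12 i • sx .E12)
  | T_E21 (i : Fin 2) : SLRel q (sx (.T i) * sx .E21 * sx (.Tinv i)) (q ^ (-slWt12 i) • sx .E21)
  | T_E23 (i : Fin 2) : SLRel q (sx (.T i) * sx .E23 * sx (.Tinv i)) (q ^ slWt23 i • sx .E23)
  | T_E32 (i : Fin 2) : SLRel q (sx (.T i) * sx .E32 * sx (.Tinv i)) (q ^ (-slWt23 i) • sx .E32)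
  | chevalley {x y : FreeAlgebra ℂ SLGen}
      (h : ChevalleyRel q (sx (.T 0)) (sx (.Tinv 0)) (sx (.T 1)) (sx (.Tinv 1))
        (sx .E12) (sx .E21) (sx .E23) (sx .E32) x y) : SLRel q x y

/-- The quantum superalgebra `U_q[gl(2/1)]`. -/
def UqGL (q : ℂ) : Type := RingQuot (GLRel q)

instance (q : ℂ) : Ring (UqGL q) := inferInstanceAs (Ring (RingQuot (GLRel q)))

instance (q : ℂ) : Algebra ℂ (UqGL q) := inferInstanceAs (Algebra ℂ (RingQuot (GLRel q)))

/-- The canonical map from the free algebra. -/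
def UqGL.mk (q : ℂ) : FreeAlgebra ℂ GLGen →ₐ[ℂ] UqGL q := RingQuot.mkAlgHom ℂ (GLRel q)

/-- The quantum superalgebra `U_q[sl(2/1)]`. -/
def UqSL (q : ℂ) : Type := RingQuot (SLRel q)

instance (q : ℂ) : Ring (UqSL q) := inferInstanceAs (Ring (RingQuot (SLRel q)))

instance (q : ℂ) : Algebra ℂ (UqSL q) := inferInstanceAs (Algebra ℂ (RingQuot (SLRel q)))

/-- The canonical map from the free algebra. -/
def UqSL.mk (q : ℂ) : FreeAlgebra ℂ SLGen →ₐ[ℂ] UqSL q := RingQuot.mkAlgHom ℂ (SLRel q)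

/-- A generator of `U_q[gl(2/1)]`. -/
def UqGL.gen (q : ℂ) (s : GLGen) : UqGL q := UqGL.mk q (gx s)

/-- A generator of `U_q[sl(2/1)]`. -/
def UqSL.gen (q : ℂ) (s : SLGen) : UqSL q := UqSL.mk q (sx s)

/-! ## The sign automorphisms

`q^{h₁}` may be replaced by `-q^{h₁}` if `E₂₁` is replaced by `-E₂₁`: this respects all relations. -/

/-- The images of the generators of `U_q[gl(2/1)]` under the sign automorphism
`K₁ ↦ -K₁`, `E₂₁ ↦ -E₂₁`. -/
def glSign (q : ℂ) : GLGen → UqGL q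
  | .K i => if i = 0 then -UqGL.gen q (.K i) else UqGL.gen q (.K i)
  | .Kinv i => if i = 0 then -UqGL.gen q (.Kinv i) else UqGL.gen q (.Kinv i)
  | .E21 => -UqGL.gen q .E21
  | s => UqGL.gen q s

/-- The images of the generators of `U_q[sl(2/1)]` under the sign automorphism
`q^{h₁} ↦ -q^{h₁}`, `E₂₁ ↦ -E₂₁`. -/
def slSign (q : ℂ) : SLGen → UqSL q
  | .T i => if i = 0 then -UqSL.gen q (.T i) else UqSL.gen q (.T i)
  | .Tinv i => if i = 0 then -UqSL.gen q (.Tinv i) else UqSL.gen q (.Tinv i)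
  | .E21 => -UqSL.gen q .E21
  | s => UqSL.gen q s

theorem UqGL.rel (q : ℂ) {x y : FreeAlgebra ℂ GLGen} (h : GLRel q x y) :
    FreeAlgebra.lift ℂ (UqGL.gen q) x = FreeAlgebra.lift ℂ (UqGL.gen q) y := by
  have e : FreeAlgebra.lift ℂ (UqGL.gen q) = UqGL.mk q := by
    ext s; simp [UqGL.gen]
  rw [e]
  exact RingQuot.mkAlgHom_rel ℂ h

theorem UqSL.rel (q : ℂ) {x y : FreeAlgebra ℂ SLGen} (h : SLRel q x y) :
    FreeAlgebra.lift ℂ (UqSL.gen q) x = FreeAlgebra.lift ℂ (UqSL.gen q) y := by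
  have e : FreeAlgebra.lift ℂ (UqSL.gen q) = UqSL.mk q := by
    ext s; simp [UqSL.gen]
  rw [e]
  exact RingQuot.mkAlgHom_rel ℂ h

theorem glSign_rel (q : ℂ) {x y : FreeAlgebra ℂ GLGen} (h : GLRel q x y) :
    FreeAlgebra.lift ℂ (glSign q) x = FreeAlgebra.lift ℂ (glSign q) y := by
  have r := UqGL.rel q h
  cases h with
  | K_Kinv i => fin_cases i <;> simpa [glSign] using r
  | Kinv_K i => fin_cases i <;> simpa [glSign] using r
  | K_K i j => fin_cases i <;> fin_cases j <;> first | rfl | simpa [glSign] using r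
  | K_E12 i => fin_cases i <;> simpa [glSign] using r
  | K_E21 i => fin_cases i <;> simpa [glSign] using r
  | K_E23 i => fin_cases i <;> simpa [glSign] using r
  | K_E32 i => fin_cases i <;> simpa [glSign] using r
  | chevalley h =>
    cases h with
    | e12_e21 =>
      simp only [map_sub, map_mul, map_smul, FreeAlgebra.lift_ι_apply, glSign] at r ⊢
      simp only [one_ne_zero, if_false, if_true, mul_neg, neg_mul]
      rw [sub_neg_eq_add, neg_add_eq_sub, sub_neg_eq_add, neg_add_eq_sub, ← neg_sub, r,
        ← smul_neg, neg_sub]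
    | serre_f =>
      simp only [map_neg, map_sub, map_mul, map_smul, FreeAlgebra.lift_ι_apply, glSign] at r ⊢
      simp only [mul_neg, neg_mul, smul_neg] at r
      simp only [mul_neg, neg_mul, smul_neg, sub_neg_eq_add, neg_add_eq_sub, neg_sub]
      exact r
    | _ => simpa [glSign] using r

theorem slSign_rel (q : ℂ) {x y : FreeAlgebra ℂ SLGen} (h : SLRel q x y) :
    FreeAlgebra.lift ℂ (slSign q) x = FreeAlgebra.lift ℂ (slSign q) y := by
  have r := UqSL.rel q h
  cases h with
  | T_Tinv i => fin_cases i <;> simpa [slSign] using r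
  | Tinv_T i => fin_cases i <;> simpa [slSign] using r
  | T_T i j => fin_cases i <;> fin_cases j <;> first | rfl | simpa [slSign] using r
  | T_E12 i => fin_cases i <;> simpa [slSign] using r
  | T_E21 i => fin_cases i <;> simpa [slSign] using r
  | T_E23 i => fin_cases i <;> simpa [slSign] using r
  | T_E32 i => fin_cases i <;> simpa [slSign] using r
  | chevalley h =>
    cases h with
    | e12_e21 =>
      simp only [map_sub, map_mul, map_smul, FreeAlgebra.lift_ι_apply, slSign] at r ⊢
      simp only [if_true, mul_neg, neg_mul]
      rw [sub_neg_eq_add, neg_add_eq_sub, sub_neg_eq_add, neg_add_eq_sub, ← neg_sub, r,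
        ← smul_neg, neg_sub]
    | serre_f =>
      simp only [map_neg, map_sub, map_mul, map_smul, FreeAlgebra.lift_ι_apply, slSign] at r ⊢
      simp only [mul_neg, neg_mul, smul_neg] at r
      simp only [mul_neg, neg_mul, smul_neg, sub_neg_eq_add, neg_add_eq_sub, neg_sub]
      exact r
    | _ => simpa [slSign] using r

/-- The sign automorphism of `U_q[gl(2/1)]`: `K₁ ↦ -K₁`, `E₂₁ ↦ -E₂₁`, while `K₂`, `K₃`, `E₁₂`,
`E₂₃`, `E₃₂` are fixed. -/
def glTwist (q : ℂ) : UqGL q →ₐ[ℂ] UqGL q :=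
  RingQuot.liftAlgHom ℂ ⟨FreeAlgebra.lift ℂ (glSign q), fun _ _ h => glSign_rel q h⟩

/-- The sign automorphism of `U_q[sl(2/1)]`: `q^{h₁} ↦ -q^{h₁}`, `E₂₁ ↦ -E₂₁`, while `q^{h₂}`,
`E₁₂`, `E₂₃`, `E₃₂` are fixed. -/
def slTwist (q : ℂ) : UqSL q →ₐ[ℂ] UqSL q :=
  RingQuot.liftAlgHom ℂ ⟨FreeAlgebra.lift ℂ (slSign q), fun _ _ h => slSign_rel q h⟩

/-! ## Representations -/

section Representations

variable {V : Type*} [AddCommGroup V] [Module ℂ V]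

/-- A representation of an algebra is irreducible if the space is nonzero and has no invariant
subspaces except `0` and the whole space. -/
def IsIrreducibleRep {A : Type*} [Ring A] [Algebra ℂ A] (ρ : A →ₐ[ℂ] Module.End ℂ V) : Prop :=
  Nontrivial V ∧
    ∀ p : Submodule ℂ V, (∀ x : A, ∀ v ∈ p, ρ x v ∈ p) → p = ⊥ ∨ p = ⊤

/-- All eigenvalues of the operator are integral powers of `q`. Applied to the operator `q^{h₁}`
this is the usual "type 1" condition: `h₁` has integral eigenvalues. -/
def HasIntegralWeights (q : ℂ) (H : Module.End ℂ V) : Prop :=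
  ∀ μ : ℂ, H.HasEigenvalue μ → ∃ z : ℤ, μ = q ^ z

end Representations

/-! ## The family of representations in the reduced Gel'fand-Zetlin basis -/

/-- The `q`-number `[x] = (q^x - q^{-x}) / (q - q⁻¹)`. -/
def qNum (q x : ℂ) : ℂ := (q ^ x - q ^ (-x)) / (q - q⁻¹)

/-- The square root `[x]^{1/2}`. A root of a product or quotient of `q`-numbers is read as the
product or quotient of these roots. -/
def qRoot (q x : ℂ) : ℂ := qNum q x ^ (1 / 2 : ℂ)

/-- The signature `[m₁₃, m₂₃, m₃₃]` of a module: complex numbers with `m₁₃ - m₂₃ = 2l` a natural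
number. -/
structure Signature where
  /-- the entry `m₂₃` -/
  m23 : ℂ
  /-- the entry `m₃₃` -/
  m33 : ℂ
  /-- the difference `2l = m₁₃ - m₂₃` -/
  twoL : ℕ

namespace Signature

variable (Λ : Signature)

def m13 : ℂ := Λ.m23 + Λ.twoL

def l13 : ℂ := Λ.m13 - 1

def l23 : ℂ := Λ.m23 - 2

def l33 : ℂ := Λ.m33 - 1

/-- The second rows of the patterns of `V_k`, `k = 0, 1, 2, 3`, are
`[m₁₃, m₂₃, m₃₃]`, `[m₁₃, m₂₃ - 1, m₃₃ + 1]`, `[m₁₃ - 1, m₂₃, m₃₃ + 1]`,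
`[m₁₃ - 1, m₂₃ - 1, m₃₃ + 2]`; these are the amounts by which the entries are shifted. -/
def shift1 : Fin 4 → ℤ := ![0, 0, 1, 1]

/-- The amount by which the second entry is lowered in `V_k`. -/
def shift2 : Fin 4 → ℤ := ![0, 1, 0, 1]

/-- The amount by which the third entry is raised in `V_k`. -/
def shift3 : Fin 4 → ℤ := ![0, 1, 1, 2]

def l12 (k : Fin 4) : ℂ := Λ.m13 - shift1 k - 1

def l22 (k : Fin 4) : ℂ := Λ.m23 - shift2 k - 2

def l31 (k : Fin 4) : ℂ := Λ.m33 + shift3 k - 1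

/-- The bottom entry `m₁₁` of a pattern is given by the integer `j = m₁₃ - m₁₁`, and
`l₁₁ = m₁₁ - 1`. Raising `m₁₁` by one means lowering `j` by one. -/
def l11 (j : ℤ) : ℂ := Λ.m13 - j - 1

/-- The betweenness conditions `m₁₂ - m₁₁ ∈ ℤ₊`, `m₁₁ - m₂₂ ∈ ℤ₊` for the pattern of `V_k` with
`m₁₁ = m₁₃ - j`. -/
def IsPattern (k : Fin 4) (j : ℤ) : Prop :=
  0 ≤ j - shift1 k ∧ 0 ≤ (Λ.twoL : ℤ) - j + shift2 k

/-- The patterns of the subspaces `V_k`, `k ∈ S`. -/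
abbrev Pattern (S : Finset (Fin 4)) : Type :=
  {p : Fin 4 × ℤ // p.1 ∈ S ∧ Λ.IsPattern p.1 p.2}

/-- The eigenvalue of `E₁₁` on a pattern. -/
def wt11 (j : ℤ) : ℂ := Λ.l11 j + 1

/-- The eigenvalue of `E₂₂` on a pattern. -/
def wt22 (k : Fin 4) (j : ℤ) : ℂ := Λ.l12 k + Λ.l22 k - Λ.l11 j + 2

/-- The eigenvalue of `E₃₃` on a pattern. -/
def wt33 (k : Fin 4) : ℂ := Λ.l31 k + 1

end Signature

section Family

variable {V : Type*} [AddCommGroup V] [Module ℂ V]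

open Classical in
/-- The vector `(m)_k` with bottom entry `m₁₁ = m₁₃ - j`; it is `0` if there is no such pattern
in the given module (in particular if `V_k` was factored out). -/
def gzVec {Λ : Signature} {S : Finset (Fin 4)} (b : Λ.Pattern S → V) (k : Fin 4) (j : ℤ) : V :=
  if h : k ∈ S ∧ Λ.IsPattern k j then b ⟨(k, j), h⟩ else 0

/-- The action of the Chevalley generators in the reduced basis `b` of the module with signature
`Λ` made of the subspaces `V_k`, `k ∈ S`, with the free parameters `a₁, a₂, a₃`. All basis
vectors of the subspaces `V_k`, `k ∉ S`, are replaced by `0`. -/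
structure ChevalleyAction (q a₁ a₂ a₃ : ℂ) (Λ : Signature) (S : Finset (Fin 4))
    (b : Λ.Pattern S → V) (e12 e21 e23 e32 : Module.End ℂ V) : Prop where
  e12_apply : ∀ k ∈ S, ∀ j, Λ.IsPattern k j → e12 (gzVec b k j) =
    (qRoot q (Λ.l12 k - Λ.l11 j) * qRoot q (Λ.l11 j - Λ.l22 k)) • gzVec b k (j - 1)
  e21_apply : ∀ k ∈ S, ∀ j, Λ.IsPattern k j → e21 (gzVec b k j) =
    (qRoot q (Λ.l12 k - Λ.l11 j + 1) * qRoot q (Λ.l11 j - Λ.l22 k - 1)) • gzVec b k (j + 1)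
  e23_zero : 0 ∈ S → ∀ j, Λ.IsPattern 0 j → e23 (gzVec b 0 j) = 0
  e23_one : 1 ∈ S → ∀ j, Λ.IsPattern 1 j → e23 (gzVec b 1 j) =
    (a₁ * (qRoot q (Λ.l11 j - Λ.l23) / qRoot q (Λ.twoL + 1)) *
      qNum q (Λ.l23 + Λ.l33 + 3)) • gzVec b 0 j
  e23_two : 2 ∈ S → ∀ j, Λ.IsPattern 2 j → e23 (gzVec b 2 j) =
    (a₂ * (qRoot q (Λ.l13 - Λ.l11 j) / qRoot q Λ.twoL) *
      qNum q (Λ.l13 + Λ.l33 + 3)) • gzVec b 0 j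
  e23_three : 3 ∈ S → ∀ j, Λ.IsPattern 3 j → e23 (gzVec b 3 j) =
    a₃ • ((1 / (a₁ * q) * (qRoot q (Λ.l13 - Λ.l11 j) / qRoot q (Λ.twoL + 1)) *
        qNum q (Λ.l13 + Λ.l33 + 3)) • gzVec b 1 j
      - (1 / (a₂ * q) * (qRoot q (Λ.l11 j - Λ.l23) * qRoot q Λ.twoL) *
        (qNum q (Λ.l23 + Λ.l33 + 3) / qNum q (Λ.twoL + 1))) • gzVec b 2 j)
  e32_zero : 0 ∈ S → ∀ j, Λ.IsPattern 0 j → e32 (gzVec b 0 j) =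
    (1 / a₁ * (qRoot q (Λ.l11 j - Λ.l23) / qRoot q (Λ.twoL + 1))) • gzVec b 1 j
      + (1 / a₂ * (qRoot q (Λ.l13 - Λ.l11 j) * qRoot q Λ.twoL / qNum q (Λ.twoL + 1))) •
        gzVec b 2 j
  e32_one : 1 ∈ S → ∀ j, Λ.IsPattern 1 j → e32 (gzVec b 1 j) =
    (a₁ / a₃ * q * (qRoot q (Λ.l13 - Λ.l11 j) / qRoot q (Λ.twoL + 1))) • gzVec b 3 j
  e32_two : 2 ∈ S → ∀ j, Λ.IsPattern 2 j → e32 (gzVec b 2 j) =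
    (-(a₂ / a₃) * q * (qRoot q (Λ.l11 j - Λ.l23) / qRoot q Λ.twoL)) • gzVec b 3 j
  e32_three : 3 ∈ S → ∀ j, Λ.IsPattern 3 j → e32 (gzVec b 3 j) = 0

/-- The three kinds of modules of the family and the subspaces `V_k` they are made of:
* typical: `[l₁₃ + l₃₃ + 3] [l₂₃ + l₃₃ + 3] ≠ 0`, and the module is `V₀ ⊕ V₁ ⊕ V₂ ⊕ V₃`;
* nontypical of class 1: `[l₁₃ + l₃₃ + 3] = 0`, `[l₂₃ + l₃₃ + 3] ≠ 0`, and the module is the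
  quotient by `V₃ ⊕ V₂`;
* nontypical of class 2: `[l₁₃ + l₃₃ + 3] ≠ 0`, `[l₂₃ + l₃₃ + 3] = 0`, and the module is the
  quotient by `V₃ ⊕ V₁`. -/
inductive IsClass (q : ℂ) (Λ : Signature) : Finset (Fin 4) → Prop
  | typical (h : qNum q (Λ.l13 + Λ.l33 + 3) * qNum q (Λ.l23 + Λ.l33 + 3) ≠ 0) :
      IsClass q Λ {0, 1, 2, 3}
  | class1 (h₁ : qNum q (Λ.l13 + Λ.l33 + 3) = 0) (h₂ : qNum q (Λ.l23 + Λ.l33 + 3) ≠ 0) :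
      IsClass q Λ {0, 1}
  | class2 (h₁ : qNum q (Λ.l13 + Λ.l33 + 3) ≠ 0) (h₂ : qNum q (Λ.l23 + Λ.l33 + 3) = 0) :
      IsClass q Λ {0, 2}

/-- A representation of `U_q[gl(2/1)]` belongs to the family (with the normalization constants
`a₁, a₂, a₃`, which may depend on the signature) if its space has a basis of patterns in which
the generators act by the explicit formulas of a typical or nontypical module. -/
def InFamilyGL (q : ℂ) (a₁ a₂ a₃ : Signature → ℂ) (ρ : UqGL q →ₐ[ℂ] Module.End ℂ V) : Prop :=
  ∃ (Λ : Signature) (S : Finset (Fin 4)) (b : Module.Basis (Λ.Pattern S) ℂ V),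
    IsClass q Λ S ∧
    ChevalleyAction q (a₁ Λ) (a₂ Λ) (a₃ Λ) Λ S b
      (ρ (UqGL.gen q .E12)) (ρ (UqGL.gen q .E21)) (ρ (UqGL.gen q .E23)) (ρ (UqGL.gen q .E32)) ∧
    ∀ k ∈ S, ∀ j, Λ.IsPattern k j →
      ρ (UqGL.gen q (.K 0)) (gzVec b k j) = q ^ Λ.wt11 j • gzVec b k j ∧
      ρ (UqGL.gen q (.K 1)) (gzVec b k j) = q ^ Λ.wt22 k j • gzVec b k j ∧
      ρ (UqGL.gen q (.K 2)) (gzVec b k j) = q ^ Λ.wt33 k • gzVec b k j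

/-- The same family for `U_q[sl(2/1)]`: the Chevalley generators act by the same formulas, and
`q^{h₁}`, `q^{h₂}` according to `h₁ = E₁₁ - E₂₂`, `h₂ = E₂₂ + E₃₃`. -/
def InFamilySL (q : ℂ) (a₁ a₂ a₃ : Signature → ℂ) (ρ : UqSL q →ₐ[ℂ] Module.End ℂ V) : Prop :=
  ∃ (Λ : Signature) (S : Finset (Fin 4)) (b : Module.Basis (Λ.Pattern S) ℂ V),
    IsClass q Λ S ∧
    ChevalleyAction q (a₁ Λ) (a₂ Λ) (a₃ Λ) Λ S b
      (ρ (UqSL.gen q .E12)) (ρ (UqSL.gen q .E21)) (ρ (UqSL.gen q .E23)) (ρ (UqSL.gen q .E32)) ∧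
    ∀ k ∈ S, ∀ j, Λ.IsPattern k j →
      ρ (UqSL.gen q (.T 0)) (gzVec b k j) = q ^ (Λ.wt11 j - Λ.wt22 k j) • gzVec b k j ∧
      ρ (UqSL.gen q (.T 1)) (gzVec b k j) = q ^ (Λ.wt22 k j + Λ.wt33 k) • gzVec b k j

end Family

end QuantumGL21

end

noncomputable section

namespace QuantumGL21

/-! ## Identities for `q`-numbers -/

section QNumbers

variable {q : ℂ}

/-! The whole module is read off from one highest weight vector `v`. A Cartan operator that picks up
a factor `q` when it passes through either of `E₁₂`, `E₂₃` has only finitely many eigenvalues, so it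
has an eigenvalue `μ` for which `qμ` is not one. Both raising operators kill the eigenspace of `μ`,
and a joint Cartan eigenvector in it is the desired `v` (`exists_highest_vector`). Quantum `sl(2)`
theory in finite dimension makes `q^{h₁}` act on `v` by `± q^n` with `n` natural (`exists_weight`).
The minus sign contradicts type 1 and is removed by the sign automorphism. Let `q^M` be the
eigenvalue of `q^{h₂}` on `v`.

The vectors `E₂₁^i v`, `E₂₁^i E₃₂ v`, `E₃₂ E₂₁^i v`, `E₃₂ E₂₁^i E₃₂ v` span a submodule: `E₃₂² = 0`,
and the iterated Serre relation `serre_pow` moves `E₂₁` past `E₃₂`. Correcting the third kind by a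
multiple of the second and rescaling gives the vectors `gzFun` of `V₀, …, V₃`. They satisfy the
formulas of the family in every finite-dimensional module with such a `v`, all coefficients being
matched by the single bracket identity `qNum_mul_sub`.

Irreducibility decides which `V_k` survive. The arrows `V₁ → V₀`, `V₃ → V₂` of `E₂₃` carry the
factor `[M]`, the arrows `V₂ → V₀`, `V₃ → V₁` the factor `[M+n+1]`; the two factors never vanish
together. If one vanishes, `V₁ + V₃` or `V₂ + V₃` is invariant. It is proper, because `q^{h₁+2h₂}`
separates it from `v` (`gzSpan_ne_top`), so it is zero. Vectors not lost in this way are led back by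
`E₂₃` and `E₁₂` to nonzero vectors. Finally `q^{h₁}`, `q^{h₂}` and `E₂₁E₁₂` have distinct joint
eigenvalues on them (`linearIndependent_gzFun`), so they form a basis (`exists_basis`). -/

theorem zpow_ne_one (hq : ∀ N : ℕ, 0 < N → q ^ N ≠ 1) {z : ℤ} (hz : z ≠ 0) :
    q ^ z ≠ 1 := by
  rcases Int.natAbs_eq z with h | h
  · rw [h, zpow_natCast]
    exact hq _ (Int.natAbs_pos.2 hz)
  · rw [h, zpow_neg, zpow_natCast]
    exact fun h' => hq _ (Int.natAbs_pos.2 hz) (inv_eq_one.1 h')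

theorem zpow_injective_of_generic (hq0 : q ≠ 0) (hq : ∀ N : ℕ, 0 < N → q ^ N ≠ 1) :
    Function.Injective fun z : ℤ => q ^ z := by
  intro a b h
  by_contra hab
  refine zpow_ne_one hq (sub_ne_zero.2 hab) ?_
  rw [zpow_sub₀ hq0]
  exact (div_eq_one_iff_eq (zpow_ne_zero _ hq0)).2 h

theorem sub_inv_ne_zero (hq0 : q ≠ 0) (hq : ∀ N : ℕ, 0 < N → q ^ N ≠ 1) : q - q⁻¹ ≠ 0 := by
  intro h
  refine hq 2 two_pos ?_
  have : q = q⁻¹ := sub_eq_zero.1 h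
  rw [pow_two]
  nth_rewrite 2 [this]
  exact mul_inv_cancel₀ hq0

theorem qNum_zero : qNum q 0 = 0 := by simp [qNum]

theorem qNum_one (hq0 : q ≠ 0) (hq : ∀ N : ℕ, 0 < N → q ^ N ≠ 1) : qNum q 1 = 1 := by
  rw [qNum, Complex.cpow_neg, Complex.cpow_one]
  exact div_self (sub_inv_ne_zero hq0 hq)

theorem qNum_intCast_ne_zero (hq0 : q ≠ 0) (hq : ∀ N : ℕ, 0 < N → q ^ N ≠ 1) {z : ℤ}
    (hz : z ≠ 0) : qNum q z ≠ 0 := by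
  rw [qNum]
  refine div_ne_zero (fun h => ?_) (sub_inv_ne_zero hq0 hq)
  rw [← Int.cast_neg, Complex.cpow_intCast, Complex.cpow_intCast, sub_eq_zero] at h
  have := zpow_injective_of_generic hq0 hq h
  omega

theorem qNum_eq_zero_iff (hq0 : q ≠ 0) (hq : ∀ N : ℕ, 0 < N → q ^ N ≠ 1) {x : ℂ} :
    qNum q x = 0 ↔ (q ^ x) ^ 2 = 1 := by
  have hx : q ^ x ≠ 0 := by simp [Complex.cpow_eq_zero_iff, hq0]
  rw [qNum, div_eq_zero_iff, or_iff_left (sub_inv_ne_zero hq0 hq), Complex.cpow_neg, sub_eq_zero,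
    pow_two, ← mul_eq_one_iff_eq_inv₀ hx]

/-- The one bracket identity behind all structure constants: it closes the `sl(2)` induction, gives
the action of `E₂₁` on `V₂`, produces the factor `[M+n+1]` in `E₂₃`, separates `V₁` from `V₂`, and
keeps the two atypicality factors from vanishing together. -/
theorem qNum_mul_sub (hq0 : q ≠ 0) (x y z : ℂ) :
    qNum q (x + y) * qNum q z - qNum q (z - y) * qNum q x = qNum q y * qNum q (x + z) := by
  have hx : q ^ x ≠ 0 := by simp [Complex.cpow_eq_zero_iff, hq0]
  have hy : q ^ y ≠ 0 := by simp [Complex.cpow_eq_zero_iff, hq0]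
  have hz : q ^ z ≠ 0 := by simp [Complex.cpow_eq_zero_iff, hq0]
  simp only [qNum, Complex.cpow_neg, Complex.cpow_add _ _ hq0, Complex.cpow_sub _ _ hq0]
  field_simp
  ring

theorem qNum_add_one (hq0 : q ≠ 0) (hq : ∀ N : ℕ, 0 < N → q ^ N ≠ 1) (x : ℂ) :
    qNum q (x + 1) = q * qNum q x + q ^ (-x) := by
  have hx : q ^ x ≠ 0 := by simp [Complex.cpow_eq_zero_iff, hq0]
  have h := sub_inv_ne_zero hq0 hq
  rw [← sub_ne_zero] at h
  simp only [qNum, Complex.cpow_neg, Complex.cpow_add _ _ hq0, Complex.cpow_one]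
  rw [div_eq_iff (by simpa using h), add_mul, mul_assoc, div_mul_cancel₀ _ (by simpa using h)]
  field_simp
  ring

theorem qNum_neg (x : ℂ) : qNum q (-x) = -qNum q x := by
  simp only [qNum, neg_neg]
  ring

/-- Apart from its consequences, such as nonvanishing and `[0]^{1/2} = 0`, nothing else about the
roots matters; the branch plays no role. -/
theorem qRoot_mul_self (x : ℂ) : qRoot q x * qRoot q x = qNum q x := by
  have := Complex.cpow_nat_inv_pow (qNum q x) two_ne_zero
  rw [pow_two] at this
  simpa [qRoot] using this

theorem qRoot_zero : qRoot q 0 = 0 := by simp [qRoot, qNum_zero]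

theorem qRoot_intCast_ne_zero (hq0 : q ≠ 0) (hq : ∀ N : ℕ, 0 < N → q ^ N ≠ 1) {z : ℤ}
    (hz : z ≠ 0) : qRoot q z ≠ 0 := fun h =>
  qNum_intCast_ne_zero hq0 hq hz (by rw [← qRoot_mul_self, h, zero_mul])

theorem log_ne_zero_of_generic (hq0 : q ≠ 0) (hq : ∀ N : ℕ, 0 < N → q ^ N ≠ 1) :
    Complex.log q ≠ 0 := by
  intro h
  refine hq 1 one_pos ?_
  rw [pow_one, ← Complex.exp_log hq0, h, Complex.exp_zero]

/-- Since `log q ≠ 0`, the map `x ↦ q^x` is onto the nonzero numbers. This is what turns arbitrary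
Cartan eigenvalues into complex entries of a signature. -/
theorem exists_cpow_eq (hq0 : q ≠ 0) (hq : ∀ N : ℕ, 0 < N → q ^ N ≠ 1) {κ : ℂ} (hκ : κ ≠ 0) :
    ∃ x : ℂ, q ^ x = κ := by
  refine ⟨Complex.log κ / Complex.log q, ?_⟩
  rw [Complex.cpow_def_of_ne_zero hq0, mul_div_cancel₀ _ (log_ne_zero_of_generic hq0 hq),
    Complex.exp_log hκ]

/-- The norming factor of the vectors of an irreducible `sl(2)`-module of highest weight `N`. -/
def nrm (q N : ℂ) (i : ℕ) : ℂ := ∏ t ∈ Finset.range i, (qRoot q (t + 1) * qRoot q (N - t))⁻¹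

theorem nrm_zero (N : ℂ) : nrm q N 0 = 1 := rfl

theorem nrm_succ (N : ℂ) (i : ℕ) :
    nrm q N (i + 1) = nrm q N i * (qRoot q (i + 1) * qRoot q (N - i))⁻¹ :=
  Finset.prod_range_succ _ _

theorem qRoot_natCast_add_one_ne_zero (hq0 : q ≠ 0) (hq : ∀ N : ℕ, 0 < N → q ^ N ≠ 1) (i : ℕ) :
    qRoot q (i + 1) ≠ 0 := by
  have := qRoot_intCast_ne_zero hq0 hq (z := (i : ℤ) + 1) (by omega)
  simpa using this

theorem qRoot_natCast_sub_ne_zero (hq0 : q ≠ 0) (hq : ∀ N : ℕ, 0 < N → q ^ N ≠ 1) {n i : ℕ}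
    (h : i ≠ n) : qRoot q (n - i) ≠ 0 := by
  have := qRoot_intCast_ne_zero hq0 hq (z := (n : ℤ) - i) (by omega)
  simpa using this

theorem nrm_succ_mul (hq0 : q ≠ 0) (hq : ∀ N : ℕ, 0 < N → q ^ N ≠ 1) {n i : ℕ} (h : i < n) :
    nrm q n i = nrm q n (i + 1) * (qRoot q (i + 1) * qRoot q (n - i)) := by
  rw [nrm_succ, inv_mul_cancel_right₀]
  exact mul_ne_zero (qRoot_natCast_add_one_ne_zero hq0 hq i)
    (qRoot_natCast_sub_ne_zero hq0 hq h.ne)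

/-- The quotient of the two norming factors telescopes. It converts between the normalizations of
`V₀` (highest weight `n`) and `V₁` (highest weight `n + 1`), which are linked by `E₃₂` and `E₂₃`. -/
theorem nrm_add_one_mul (hq0 : q ≠ 0) (hq : ∀ N : ℕ, 0 < N → q ^ N ≠ 1) {n i : ℕ} (h : i ≤ n) :
    nrm q (n + 1) i * qRoot q (n + 1) = nrm q n i * qRoot q (n + 1 - i) := by
  induction i with
  | zero => simp [nrm_zero]
  | succ i ih =>
    have h1 := qRoot_natCast_add_one_ne_zero hq0 hq i
    have h2 := qRoot_natCast_sub_ne_zero hq0 hq (n := n) (i := i) (by omega)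
    have h3 := qRoot_natCast_sub_ne_zero hq0 hq (n := n + 1) (i := i) (by omega)
    push_cast at h3
    have e : (n : ℂ) + 1 - (i + 1 : ℕ) = n - i := by push_cast; ring
    rw [nrm_succ, nrm_succ, mul_right_comm, ih (by omega), e]
    field_simp

end QNumbers

/-! ## Highest weight modules -/

section HighestWeight

variable {V : Type*} [AddCommGroup V] [Module ℂ V]

/-- The relations of `U_q[sl(2/1)]`, as far as they are used, for operators on a vector space. -/
structure IsChevalleyModule (q : ℂ) (H₁ H₁' H₂ H₂' e12 e21 e23 e32 : Module.End ℂ V) :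
    Prop where
  ne_zero : q ≠ 0
  generic : ∀ N : ℕ, 0 < N → q ^ N ≠ 1
  inv₁ : ∀ x, H₁' (H₁ x) = x
  inv₂ : ∀ x, H₂' (H₂ x) = x
  H₁_e21 : ∀ x, H₁ (e21 x) = q ^ (-2 : ℤ) • e21 (H₁ x)
  H₁_e32 : ∀ x, H₁ (e32 x) = q • e32 (H₁ x)
  H₂_e21 : ∀ x, H₂ (e21 x) = q • e21 (H₂ x)
  H₂_e32 : ∀ x, H₂ (e32 x) = e32 (H₂ x)
  e12_e32 : ∀ x, e12 (e32 x) = e32 (e12 x)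
  e23_e21 : ∀ x, e23 (e21 x) = e21 (e23 x)
  e12_e21 : ∀ x, e12 (e21 x) = e21 (e12 x) + (q - q⁻¹)⁻¹ • (H₁ x - H₁' x)
  e23_e32 : ∀ x, e23 (e32 x) = -e32 (e23 x) + (q - q⁻¹)⁻¹ • (H₂ x - H₂' x)
  e32_e32 : ∀ x, e32 (e32 x) = 0
  serre : ∀ x, (q + q⁻¹) • e21 (e32 (e21 x)) = e32 (e21 (e21 x)) + e21 (e21 (e32 x))

variable {q : ℂ} {H₁ H₁' H₂ H₂' e12 e21 e23 e32 : Module.End ℂ V}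

namespace IsChevalleyModule

theorem bracket_apply (hq0 : q ≠ 0) {H H' : Module.End ℂ V} (inv : ∀ x, H' (H x) = x) {x : V}
    {N : ℂ} (h : H x = q ^ N • x) : (q - q⁻¹)⁻¹ • (H x - H' x) = qNum q N • x := by
  have hN : q ^ N ≠ 0 := by simp [Complex.cpow_eq_zero_iff, hq0]
  have h' : H' x = q ^ (-N) • x := by
    have := inv x
    rw [h, map_smul] at this
    rw [Complex.cpow_neg]
    exact (inv_smul_eq_iff₀ hN).2 this.symm |>.symm
  rw [h, h', ← sub_smul, smul_smul, qNum, div_eq_inv_mul]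

theorem H₁_pow (C : IsChevalleyModule q H₁ H₁' H₂ H₂' e12 e21 e23 e32) {u : V} {N : ℂ}
    (h : H₁ u = q ^ N • u) (i : ℕ) : H₁ ((e21 ^ i) u) = q ^ (N - 2 * i) • (e21 ^ i) u := by
  induction i with
  | zero => simpa using h
  | succ i ih =>
    rw [pow_succ', Module.End.mul_apply, C.H₁_e21, ih, map_smul, smul_smul]
    congr 1
    rw [← Complex.cpow_intCast, ← Complex.cpow_add _ _ C.ne_zero]
    congr 1
    push_cast
    ring

theorem H₂_pow (C : IsChevalleyModule q H₁ H₁' H₂ H₂' e12 e21 e23 e32) {u : V} {N : ℂ}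
    (h : H₂ u = q ^ N • u) (i : ℕ) : H₂ ((e21 ^ i) u) = q ^ (N + i) • (e21 ^ i) u := by
  induction i with
  | zero => simpa using h
  | succ i ih =>
    rw [pow_succ', Module.End.mul_apply, C.H₂_e21, ih, map_smul, smul_smul]
    congr 1
    nth_rewrite 1 [← Complex.cpow_one q]
    rw [← Complex.cpow_add _ _ C.ne_zero]
    congr 1
    push_cast
    ring

/-- The usual `sl(2)` computation: `E₁₂` is commuted through the powers of `E₂₁`, and each step
contributes the bracket of the current weight. -/
theorem e12_pow_succ (C : IsChevalleyModule q H₁ H₁' H₂ H₂' e12 e21 e23 e32) {u : V} {N : ℂ}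
    (h : H₁ u = q ^ N • u) (hu : e12 u = 0) (i : ℕ) :
    e12 ((e21 ^ (i + 1)) u) = (qNum q (i + 1) * qNum q (N - i)) • (e21 ^ i) u := by
  induction i with
  | zero =>
    simp [C.e12_e21, hu, bracket_apply C.ne_zero C.inv₁ h, qNum_one C.ne_zero C.generic]
  | succ i ih =>
    rw [pow_succ', Module.End.mul_apply, C.e12_e21, ih, map_smul,
      bracket_apply C.ne_zero C.inv₁ (C.H₁_pow h (i + 1)), ← Module.End.mul_apply, ← pow_succ',
      ← add_smul]
    congr 1
    -- Up to sign this says `[i+2][N-i-1] - [i+1][N-i] = [N-2(i+1)]`, the increment needed in the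
    -- induction.
    have := qNum_mul_sub C.ne_zero (-((i : ℂ) + 1)) (-1) (N - (i + 1))
    rw [show -((i : ℂ) + 1) + -1 = -(i + 1 + 1) by ring, qNum_neg, qNum_neg, qNum_neg,
      qNum_one C.ne_zero C.generic, show N - ((i : ℂ) + 1) - -1 = N - i by ring,
      show -((i : ℂ) + 1) + (N - (i + 1)) = N - 2 * (i + 1) by ring] at this
    push_cast
    linear_combination this

/-- Otherwise the vectors `E₂₁^i u` would be infinitely many eigenvectors of `H₁` with pairwise
distinct eigenvalues. -/
theorem exists_pow_eq_zero [FiniteDimensional ℂ V]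
    (C : IsChevalleyModule q H₁ H₁' H₂ H₂' e12 e21 e23 e32) {u : V} {N : ℂ}
    (h : H₁ u = q ^ N • u) : ∃ i, (e21 ^ i) u = 0 := by
  by_contra! hne
  have hN : q ^ N ≠ 0 := by simp [Complex.cpow_eq_zero_iff, C.ne_zero]
  have hinj : Function.Injective fun i : ℕ => q ^ (N - 2 * i) := by
    intro i j hij
    have h2 : ∀ i : ℕ, q ^ (N - 2 * i) = q ^ N * q ^ (-2 * i : ℤ) := fun i => by
      rw [← Complex.cpow_intCast, ← Complex.cpow_add _ _ C.ne_zero]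
      congr 1
      push_cast
      ring
    simp only [h2] at hij
    have := zpow_injective_of_generic C.ne_zero C.generic (mul_left_cancel₀ hN hij)
    omega
  have := Module.End.eigenvectors_linearIndependent' H₁ _ hinj _
    fun i => Module.End.hasEigenvector_iff.2
      ⟨Module.End.mem_eigenspace_iff.2 (C.H₁_pow h i), hne i⟩
  exact not_finite_iff_infinite.2 inferInstance (this.finite_of_isNoetherian)

/-- Let `E₂₁^n u` be the last nonzero vector of the string. Applying `E₁₂` to the next one, which is
zero, gives `[n+1][N-n] = 0`. Only the square of `q^{N-n}` is determined, and this is the source of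
the sign ambiguity. -/
theorem exists_weight [FiniteDimensional ℂ V]
    (C : IsChevalleyModule q H₁ H₁' H₂ H₂' e12 e21 e23 e32) {u : V} {N : ℂ}
    (h : H₁ u = q ^ N • u) (hu : e12 u = 0) (hne : u ≠ 0) :
    ∃ n : ℕ, (e21 ^ (n + 1)) u = 0 ∧ (q ^ (N - n)) ^ 2 = 1 := by
  classical
  have hex := C.exists_pow_eq_zero h
  obtain ⟨n, hn⟩ : ∃ n, Nat.find hex = n + 1 :=
    Nat.exists_eq_succ_of_ne_zero fun h0 => hne (by simpa [h0] using Nat.find_spec hex)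
  have h0 : (e21 ^ (n + 1)) u = 0 := hn ▸ Nat.find_spec hex
  refine ⟨n, h0, ?_⟩
  have h1 : (e21 ^ n) u ≠ 0 := Nat.find_min hex (by omega)
  have := C.e12_pow_succ h hu n
  rw [h0, map_zero, eq_comm, smul_eq_zero_iff_left h1, mul_eq_zero] at this
  refine (qNum_eq_zero_iff C.ne_zero C.generic).1 (this.resolve_left ?_)
  simpa using qNum_intCast_ne_zero C.ne_zero C.generic (z := (n : ℤ) + 1) (by omega)

theorem pow_eq_zero [FiniteDimensional ℂ V]
    (C : IsChevalleyModule q H₁ H₁' H₂ H₂' e12 e21 e23 e32) {u : V} {n : ℕ}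
    (h : H₁ u = q ^ (n : ℂ) • u) (hu : e12 u = 0) : (e21 ^ (n + 1)) u = 0 := by
  by_cases hne : u = 0
  · simp [hne]
  obtain ⟨m, hm, hm'⟩ := C.exists_weight h hu hne
  have : q ^ ((n : ℤ) - m) * q ^ ((n : ℤ) - m) = q ^ (0 : ℤ) := by
    rw [← pow_two, ← Complex.cpow_intCast]
    simpa using hm'
  rw [← zpow_add₀ C.ne_zero] at this
  have := zpow_injective_of_generic C.ne_zero C.generic this
  obtain rfl : n = m := by omega
  exact hm

theorem pow_eq_zero_of_lt [FiniteDimensional ℂ V]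
    (C : IsChevalleyModule q H₁ H₁' H₂ H₂' e12 e21 e23 e32) {u : V} {n : ℕ}
    (h : H₁ u = q ^ (n : ℂ) • u) (hu : e12 u = 0) {i : ℕ} (hi : n < i) : (e21 ^ i) u = 0 := by
  obtain ⟨k, rfl⟩ := Nat.exists_eq_add_of_le' (show n + 1 ≤ i from hi)
  rw [pow_add, Module.End.mul_apply, C.pow_eq_zero h hu, map_zero]

theorem e23_pow (C : IsChevalleyModule q H₁ H₁' H₂ H₂' e12 e21 e23 e32) (u : V) (i : ℕ) :
    e23 ((e21 ^ i) u) = (e21 ^ i) (e23 u) := by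
  induction i with
  | zero => rfl
  | succ i ih => simp only [pow_succ', Module.End.mul_apply, C.e23_e21, ih]

/-- The Serre relation iterated, by means of `[i+2] = (q + q⁻¹)[i+1] - [i]`. It describes how `E₂₁`
moves along the strings `E₃₂ E₂₁^i u` from which `V₂` and `V₃` are made. -/
theorem serre_pow (C : IsChevalleyModule q H₁ H₁' H₂ H₂' e12 e21 e23 e32) (u : V) (i : ℕ) :
    qNum q (i + 1) • e21 (e32 ((e21 ^ i) u)) =
      qNum q i • e32 ((e21 ^ (i + 1)) u) + (e21 ^ (i + 1)) (e32 u) := by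
  induction i with
  | zero => simp [qNum_one C.ne_zero C.generic, qNum_zero]
  | succ i ih =>
    have hs := C.serre ((e21 ^ i) u)
    have ih' := congrArg e21 ih
    simp only [map_smul, map_add, ← Module.End.mul_apply, ← pow_succ'] at hs ih' ⊢
    simp only [Module.End.mul_apply] at hs ih' ⊢
    have h1 : qNum q (i + 1 + 1) = (q + q⁻¹) * qNum q (i + 1) - qNum q i := by
      rw [qNum_add_one C.ne_zero C.generic, qNum_add_one C.ne_zero C.generic (i : ℂ), neg_add,
        Complex.cpow_add _ _ C.ne_zero, Complex.cpow_neg_one]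
      have := C.ne_zero
      field_simp
      ring
    push_cast
    rw [h1, sub_smul, mul_comm, mul_smul, hs, smul_add, ih',
      pow_succ' e21 (i + 1), Module.End.mul_apply, Module.End.mul_apply]
    abel

end IsChevalleyModule
end HighestWeight

/-! ### The vectors of the reduced basis and the generators acting on them -/

section GelfandZetlin

variable {V : Type*} [AddCommGroup V] [Module ℂ V]

/-- A vector of highest weight `(h₁, h₂) = (n, M)`. -/
structure IsHighestWeight (q : ℂ) (n : ℕ) (M : ℂ) (H₁ H₂ e12 e23 : Module.End ℂ V) (v : V) :
    Prop where
  H₁_apply : H₁ v = q ^ (n : ℂ) • v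
  H₂_apply : H₂ v = q ^ M • v
  e12_apply : e12 v = 0
  e23_apply : e23 v = 0

/-- The vectors `(m)_k` with `m₁₁ = m₁₃ - i` obtained from a highest weight vector `v`. -/
def gzFun (q a₁ a₂ a₃ : ℂ) (n : ℕ) (e21 e32 : Module.End ℂ V) (v : V) (k : Fin 4) (i : ℕ) : V :=
  match k with
  | 0 => nrm q n i • (e21 ^ i) v
  | 1 => (a₁ * nrm q (n + 1) i) • (e21 ^ i) (e32 v)
  | 2 => (a₂ * qNum q (n + 1) / (qRoot q i * qRoot q n) * nrm q n i) •
      (e32 ((e21 ^ i) v) - (qNum q (n + 1 - i) / qNum q (n + 1)) • (e21 ^ i) (e32 v))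
  | 3 => (a₃ / q * (qRoot q (n + 1) / qRoot q i) * nrm q (n + 1) i) • e32 ((e21 ^ i) (e32 v))

variable {q : ℂ} {n : ℕ} {M : ℂ} {H₁ H₁' H₂ H₂' e12 e21 e23 e32 : Module.End ℂ V} {v : V}
  {a₁ a₂ a₃ : ℂ}

namespace IsChevalleyModule

theorem qRoot_succ_ne_zero (C : IsChevalleyModule q H₁ H₁' H₂ H₂' e12 e21 e23 e32) (i : ℕ) :
    qRoot q (i + 1) ≠ 0 := qRoot_natCast_add_one_ne_zero C.ne_zero C.generic i

theorem qNum_succ_ne_zero (C : IsChevalleyModule q H₁ H₁' H₂ H₂' e12 e21 e23 e32) (i : ℕ) :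
    qNum q (i + 1) ≠ 0 := by
  rw [← qRoot_mul_self]
  exact mul_ne_zero (C.qRoot_succ_ne_zero i) (C.qRoot_succ_ne_zero i)

theorem qRoot_nat_ne_zero (C : IsChevalleyModule q H₁ H₁' H₂ H₂' e12 e21 e23 e32) {i : ℕ}
    (hi : i ≠ 0) : qRoot q i ≠ 0 := by
  obtain ⟨k, rfl⟩ := Nat.exists_eq_succ_of_ne_zero hi
  simpa using C.qRoot_succ_ne_zero k

theorem H₁_e32_highest (C : IsChevalleyModule q H₁ H₁' H₂ H₂' e12 e21 e23 e32)
    (hv : IsHighestWeight q n M H₁ H₂ e12 e23 v) :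
    H₁ (e32 v) = q ^ ((n : ℂ) + 1) • e32 v := by
  rw [C.H₁_e32, hv.H₁_apply, map_smul, smul_smul, Complex.cpow_add _ _ C.ne_zero,
    Complex.cpow_one, mul_comm]

theorem H₂_e32_highest (C : IsChevalleyModule q H₁ H₁' H₂ H₂' e12 e21 e23 e32)
    (hv : IsHighestWeight q n M H₁ H₂ e12 e23 v) : H₂ (e32 v) = q ^ M • e32 v := by
  rw [C.H₂_e32, hv.H₂_apply, map_smul]

/-- As `E₁₂` commutes with `E₃₂`, the vector `E₃₂ v` starts a second `sl(2)` string, now of highest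
weight `n + 1`; this string is `V₁`. -/
theorem e12_e32_highest (C : IsChevalleyModule q H₁ H₁' H₂ H₂' e12 e21 e23 e32)
    (hv : IsHighestWeight q n M H₁ H₂ e12 e23 v) : e12 (e32 v) = 0 := by
  rw [C.e12_e32, hv.e12_apply, map_zero]

theorem pow_e32_eq_zero [FiniteDimensional ℂ V]
    (C : IsChevalleyModule q H₁ H₁' H₂ H₂' e12 e21 e23 e32)
    (hv : IsHighestWeight q n M H₁ H₂ e12 e23 v) {i : ℕ} (hi : n + 1 < i) :
    (e21 ^ i) (e32 v) = 0 :=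
  C.pow_eq_zero_of_lt (n := n + 1) (by simpa using C.H₁_e32_highest hv) (C.e12_e32_highest hv) hi

theorem pow_highest_eq_zero [FiniteDimensional ℂ V]
    (C : IsChevalleyModule q H₁ H₁' H₂ H₂' e12 e21 e23 e32)
    (hv : IsHighestWeight q n M H₁ H₂ e12 e23 v) {i : ℕ} (hi : n < i) : (e21 ^ i) v = 0 :=
  C.pow_eq_zero_of_lt hv.H₁_apply hv.e12_apply hi

/-! ### The action of `E₁₂` -/

theorem e12_gzFun_zero_succ (C : IsChevalleyModule q H₁ H₁' H₂ H₂' e12 e21 e23 e32)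
    (hv : IsHighestWeight q n M H₁ H₂ e12 e23 v) {i : ℕ} (hi : i < n) :
    e12 (gzFun q a₁ a₂ a₃ n e21 e32 v 0 (i + 1)) =
      (qRoot q (i + 1) * qRoot q (n - i)) • gzFun q a₁ a₂ a₃ n e21 e32 v 0 i := by
  simp only [gzFun]
  rw [map_smul, C.e12_pow_succ hv.H₁_apply hv.e12_apply, smul_smul, smul_smul,
    nrm_succ_mul C.ne_zero C.generic hi, ← qRoot_mul_self, ← qRoot_mul_self]
  congr 1
  ring

theorem e12_gzFun_one_succ (C : IsChevalleyModule q H₁ H₁' H₂ H₂' e12 e21 e23 e32)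
    (hv : IsHighestWeight q n M H₁ H₂ e12 e23 v) {i : ℕ} (hi : i < n + 1) :
    e12 (gzFun q a₁ a₂ a₃ n e21 e32 v 1 (i + 1)) =
      (qRoot q (i + 1) * qRoot q (n + 1 - i)) • gzFun q a₁ a₂ a₃ n e21 e32 v 1 i := by
  have h := nrm_succ_mul C.ne_zero C.generic hi
  push_cast at h
  simp only [gzFun]
  rw [map_smul, C.e12_pow_succ (C.H₁_e32_highest hv) (C.e12_e32_highest hv), smul_smul,
    smul_smul, h, ← qRoot_mul_self, ← qRoot_mul_self]
  congr 1
  ring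

/-- `E₃₂` maps `V₀` to `V₁ ⊕ V₂`. -/
theorem e32_gzFun_zero (C : IsChevalleyModule q H₁ H₁' H₂ H₂' e12 e21 e23 e32)
    (ha₁ : a₁ ≠ 0) (ha₂ : a₂ ≠ 0) {i : ℕ} (hi : i ≤ n) :
    e32 (gzFun q a₁ a₂ a₃ n e21 e32 v 0 i) =
      (1 / a₁ * (qRoot q (n + 1 - i) / qRoot q (n + 1))) • gzFun q a₁ a₂ a₃ n e21 e32 v 1 i +
      (1 / a₂ * (qRoot q i * qRoot q n / qNum q (n + 1))) •
        gzFun q a₁ a₂ a₃ n e21 e32 v 2 i := by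
  have hn := C.qRoot_succ_ne_zero n
  have hN := C.qNum_succ_ne_zero n
  have h1 : 1 / a₁ * (qRoot q (n + 1 - i) / qRoot q (n + 1)) * (a₁ * nrm q (n + 1) i) =
      nrm q n i * (qNum q (n + 1 - i) / qNum q (n + 1)) := by
    have := nrm_add_one_mul C.ne_zero C.generic hi
    rw [← qRoot_mul_self, ← qRoot_mul_self]
    field_simp
    linear_combination qRoot q (n + 1 - i) * this
  simp only [gzFun]
  rw [smul_smul, h1, map_smul]
  rcases Nat.eq_zero_or_pos i with rfl | hi0
  -- At `i = 0` there is no `V₂` component: its coefficient contains `[0]^{1/2} = 0`, while the `V₁`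
  -- coefficient is `[n+1]/[n+1] = 1` after norming.
  · simp [hN, nrm_zero, qRoot_zero]
  · have h2 := C.qRoot_nat_ne_zero hi0.ne'
    have h3 := C.qRoot_nat_ne_zero (hi0.trans_le hi).ne'
    rw [smul_smul, show 1 / a₂ * (qRoot q i * qRoot q n / qNum q (n + 1)) *
      (a₂ * qNum q (n + 1) / (qRoot q i * qRoot q n) * nrm q n i) = nrm q n i by field_simp,
      smul_sub, smul_smul]
    abel

/-- The vectors of `V₂` in terms of those of `V₀` and `V₁`. -/
theorem gzFun_two (C : IsChevalleyModule q H₁ H₁' H₂ H₂' e12 e21 e23 e32)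
    (ha₁ : a₁ ≠ 0) (ha₂ : a₂ ≠ 0) {i : ℕ} (hi : i ≤ n) (hi0 : i ≠ 0) :
    gzFun q a₁ a₂ a₃ n e21 e32 v 2 i = (a₂ * qNum q (n + 1) / (qRoot q i * qRoot q n)) •
      (e32 (gzFun q a₁ a₂ a₃ n e21 e32 v 0 i) -
        (1 / a₁ * (qRoot q (n + 1 - i) / qRoot q (n + 1))) •
          gzFun q a₁ a₂ a₃ n e21 e32 v 1 i) := by
  have hN := C.qNum_succ_ne_zero n
  have h2 := C.qRoot_nat_ne_zero hi0
  have h3 := C.qRoot_nat_ne_zero (i := n) (by omega)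
  rw [C.e32_gzFun_zero ha₁ ha₂ hi, add_sub_cancel_left, smul_smul]
  rw [show a₂ * qNum q (n + 1) / (qRoot q i * qRoot q n) *
    (1 / a₂ * (qRoot q i * qRoot q n / qNum q (n + 1))) = 1 by field_simp, one_smul]

/-- `E₃₂` maps `V₁` to `V₃`. -/
theorem e32_gzFun_one (C : IsChevalleyModule q H₁ H₁' H₂ H₂' e12 e21 e23 e32) (ha₃ : a₃ ≠ 0)
    (i : ℕ) : e32 (gzFun q a₁ a₂ a₃ n e21 e32 v 1 i) =
      (a₁ / a₃ * q * (qRoot q i / qRoot q (n + 1))) • gzFun q a₁ a₂ a₃ n e21 e32 v 3 i := by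
  have hn := C.qRoot_succ_ne_zero n
  have hq := C.ne_zero
  simp only [gzFun]
  rcases Nat.eq_zero_or_pos i with rfl | hi0
  · simp [C.e32_e32]
  · have h2 := C.qRoot_nat_ne_zero hi0.ne'
    rw [map_smul, smul_smul]
    congr 1
    field_simp

theorem gzFun_three (C : IsChevalleyModule q H₁ H₁' H₂ H₂' e12 e21 e23 e32) (ha₁ : a₁ ≠ 0)
    (ha₃ : a₃ ≠ 0) {i : ℕ} (hi0 : i ≠ 0) :
    gzFun q a₁ a₂ a₃ n e21 e32 v 3 i = (a₃ / (a₁ * q) * (qRoot q (n + 1) / qRoot q i)) •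
      e32 (gzFun q a₁ a₂ a₃ n e21 e32 v 1 i) := by
  have hn := C.qRoot_succ_ne_zero n
  have hq := C.ne_zero
  have h2 := C.qRoot_nat_ne_zero hi0
  rw [C.e32_gzFun_one ha₃, smul_smul]
  rw [show a₃ / (a₁ * q) * (qRoot q (n + 1) / qRoot q i) *
    (a₁ / a₃ * q * (qRoot q i / qRoot q (n + 1))) = 1 by field_simp, one_smul]

/-- Through `gzFun_two` and the commutation of `E₁₂` with `E₃₂`, the formula follows from those on
`V₀` and `V₁`. The correction term in the `V₂` vectors is chosen so that the `V₁` parts cancel; in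
particular the vector with `i = 1` is annihilated. -/
theorem e12_gzFun_two_succ (C : IsChevalleyModule q H₁ H₁' H₂ H₂' e12 e21 e23 e32)
    (hv : IsHighestWeight q n M H₁ H₂ e12 e23 v) (ha₁ : a₁ ≠ 0) (ha₂ : a₂ ≠ 0) {i : ℕ}
    (hi : i < n) : e12 (gzFun q a₁ a₂ a₃ n e21 e32 v 2 (i + 1)) =
      (qRoot q i * qRoot q (n - i)) • gzFun q a₁ a₂ a₃ n e21 e32 v 2 i := by
  have h1 := C.qRoot_succ_ne_zero i
  have hn := C.qRoot_succ_ne_zero n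
  have hN := C.qNum_succ_ne_zero n
  have h3 := C.qRoot_nat_ne_zero (i := n) (by omega)
  rw [C.gzFun_two ha₁ ha₂ hi (by omega), map_smul, map_sub, map_smul, C.e12_e32,
    C.e12_gzFun_zero_succ hv hi, C.e12_gzFun_one_succ hv (by omega), map_smul,
    C.e32_gzFun_zero ha₁ ha₂ hi.le,
    show (n : ℂ) + 1 - (i + 1 : ℕ) = n - i by push_cast; ring]
  generalize gzFun q a₁ a₂ a₃ n e21 e32 v 1 i = x
  generalize gzFun q a₁ a₂ a₃ n e21 e32 v 2 i = y
  push_cast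
  match_scalars <;> field_simp
  ring

theorem e12_gzFun_three_succ (C : IsChevalleyModule q H₁ H₁' H₂ H₂' e12 e21 e23 e32)
    (hv : IsHighestWeight q n M H₁ H₂ e12 e23 v) (ha₁ : a₁ ≠ 0) (ha₃ : a₃ ≠ 0) {i : ℕ}
    (hi : i < n + 1) : e12 (gzFun q a₁ a₂ a₃ n e21 e32 v 3 (i + 1)) =
      (qRoot q i * qRoot q (n + 1 - i)) • gzFun q a₁ a₂ a₃ n e21 e32 v 3 i := by
  have h1 := C.qRoot_succ_ne_zero i
  have hn := C.qRoot_succ_ne_zero n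
  have hq := C.ne_zero
  rw [C.gzFun_three ha₁ ha₃ i.succ_ne_zero, map_smul, C.e12_e32,
    C.e12_gzFun_one_succ hv hi, map_smul, C.e32_gzFun_one ha₃, smul_smul, smul_smul]
  congr 1
  push_cast
  field_simp

end IsChevalleyModule
end GelfandZetlin

section GelfandZetlin

variable {V : Type*} [AddCommGroup V] [Module ℂ V]
variable {q : ℂ} {n : ℕ} {M : ℂ} {H₁ H₁' H₂ H₂' e12 e21 e23 e32 : Module.End ℂ V} {v : V}
  {a₁ a₂ a₃ : ℂ}

namespace IsChevalleyModule

/-! ### Vanishing outside of the patterns -/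

theorem gzFun_zero_eq_zero [FiniteDimensional ℂ V]
    (C : IsChevalleyModule q H₁ H₁' H₂ H₂' e12 e21 e23 e32)
    (hv : IsHighestWeight q n M H₁ H₂ e12 e23 v) {i : ℕ} (hi : n < i) :
    gzFun q a₁ a₂ a₃ n e21 e32 v 0 i = 0 := by
  simp only [gzFun]
  rw [C.pow_highest_eq_zero hv hi, smul_zero]

theorem gzFun_one_eq_zero [FiniteDimensional ℂ V]
    (C : IsChevalleyModule q H₁ H₁' H₂ H₂' e12 e21 e23 e32)
    (hv : IsHighestWeight q n M H₁ H₂ e12 e23 v) {i : ℕ} (hi : n + 1 < i) :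
    gzFun q a₁ a₂ a₃ n e21 e32 v 1 i = 0 := by
  simp only [gzFun]
  rw [C.pow_e32_eq_zero hv hi, smul_zero]

theorem gzFun_two_eq_zero [FiniteDimensional ℂ V]
    (C : IsChevalleyModule q H₁ H₁' H₂ H₂' e12 e21 e23 e32)
    (hv : IsHighestWeight q n M H₁ H₂ e12 e23 v) {i : ℕ} (hi : n < i) :
    gzFun q a₁ a₂ a₃ n e21 e32 v 2 i = 0 := by
  simp only [gzFun]
  rw [C.pow_highest_eq_zero hv hi]
  rcases (Nat.succ_le_of_lt hi).eq_or_lt with rfl | hi'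
  -- For `i = n + 1` the vector `E₂₁^i E₃₂ v` may be nonzero, but its coefficient contains `[n+1-i]
  -- = [0]`.
  · simp [qNum_zero]
  · rw [C.pow_e32_eq_zero hv hi', map_zero, smul_zero, sub_zero, smul_zero]

theorem gzFun_three_eq_zero [FiniteDimensional ℂ V]
    (C : IsChevalleyModule q H₁ H₁' H₂ H₂' e12 e21 e23 e32)
    (hv : IsHighestWeight q n M H₁ H₂ e12 e23 v) {i : ℕ} (hi : n + 1 < i) :
    gzFun q a₁ a₂ a₃ n e21 e32 v 3 i = 0 := by
  simp only [gzFun]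
  rw [C.pow_e32_eq_zero hv hi, map_zero, smul_zero]

/-- No pattern of `V₂` has `i = 0`. The vector is zero because the norming factor divides by
`[0]^{1/2} = 0`, and division by zero gives zero; `V₃` behaves in the same way. -/
theorem gzFun_two_zero : gzFun q a₁ a₂ a₃ n e21 e32 v 2 0 = 0 := by
  simp [gzFun, qRoot_zero]

theorem gzFun_three_zero : gzFun q a₁ a₂ a₃ n e21 e32 v 3 0 = 0 := by
  simp [gzFun, qRoot_zero]

theorem e12_gzFun_zero_zero (hv : IsHighestWeight q n M H₁ H₂ e12 e23 v) :
    e12 (gzFun q a₁ a₂ a₃ n e21 e32 v 0 0) = 0 := by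
  simp [gzFun, hv.e12_apply]

theorem e12_gzFun_one_zero (C : IsChevalleyModule q H₁ H₁' H₂ H₂' e12 e21 e23 e32)
    (hv : IsHighestWeight q n M H₁ H₂ e12 e23 v) :
    e12 (gzFun q a₁ a₂ a₃ n e21 e32 v 1 0) = 0 := by
  simp [gzFun, C.e12_e32, hv.e12_apply]

/-! ### The action of `E₂₁` -/

theorem e21_gzFun_zero [FiniteDimensional ℂ V]
    (C : IsChevalleyModule q H₁ H₁' H₂ H₂' e12 e21 e23 e32)
    (hv : IsHighestWeight q n M H₁ H₂ e12 e23 v) {i : ℕ} (hi : i ≤ n) :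
    e21 (gzFun q a₁ a₂ a₃ n e21 e32 v 0 i) =
      (qRoot q (i + 1) * qRoot q (n - i)) • gzFun q a₁ a₂ a₃ n e21 e32 v 0 (i + 1) := by
  simp only [gzFun]
  rw [map_smul, ← Module.End.mul_apply, ← pow_succ']
  rcases hi.lt_or_eq with hi | rfl
  · rw [smul_smul, nrm_succ_mul C.ne_zero C.generic hi, mul_comm]
  · rw [C.pow_highest_eq_zero hv (Nat.lt_succ_self i)]
    simp

theorem e21_gzFun_one [FiniteDimensional ℂ V]
    (C : IsChevalleyModule q H₁ H₁' H₂ H₂' e12 e21 e23 e32)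
    (hv : IsHighestWeight q n M H₁ H₂ e12 e23 v) {i : ℕ} (hi : i ≤ n + 1) :
    e21 (gzFun q a₁ a₂ a₃ n e21 e32 v 1 i) =
      (qRoot q (i + 1) * qRoot q (n + 1 - i)) • gzFun q a₁ a₂ a₃ n e21 e32 v 1 (i + 1) := by
  simp only [gzFun]
  rw [map_smul, ← Module.End.mul_apply, ← pow_succ']
  rcases hi.lt_or_eq with hi | rfl
  · have h := nrm_succ_mul C.ne_zero C.generic hi
    push_cast at h
    rw [smul_smul, h]
    congr 1
    ring
  · rw [C.pow_e32_eq_zero hv (Nat.lt_succ_self _)]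
    simp

theorem e21_gzFun_two [FiniteDimensional ℂ V]
    (C : IsChevalleyModule q H₁ H₁' H₂ H₂' e12 e21 e23 e32)
    (hv : IsHighestWeight q n M H₁ H₂ e12 e23 v) {i : ℕ} (hi : i ≤ n) (hi0 : i ≠ 0) :
    e21 (gzFun q a₁ a₂ a₃ n e21 e32 v 2 i) =
      (qRoot q i * qRoot q (n - i)) • gzFun q a₁ a₂ a₃ n e21 e32 v 2 (i + 1) := by
  have h1 := C.qRoot_succ_ne_zero i
  have h2 := C.qRoot_nat_ne_zero hi0
  have h3 := C.qRoot_nat_ne_zero (i := n) (by omega)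
  have hN := C.qNum_succ_ne_zero n
  have hI := C.qNum_succ_ne_zero i
  -- `serre_pow` replaces `E₂₁ E₃₂ E₂₁^i v` by the next vector and an `E₂₁^{i+1} E₃₂ v` term. The
  -- latter combines with the correction term because `[i+1][n+1-i] - [i][n-i] = [n+1]`.
  have key : e21 (e32 ((e21 ^ i) v) - (qNum q (n + 1 - i) / qNum q (n + 1)) • (e21 ^ i) (e32 v)) =
      (qNum q i / qNum q (i + 1)) • (e32 ((e21 ^ (i + 1)) v) -
        (qNum q (n - i) / qNum q (n + 1)) • (e21 ^ (i + 1)) (e32 v)) := by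
    have hs := C.serre_pow v i
    rw [← eq_inv_smul_iff₀ hI] at hs
    have hb := qNum_mul_sub C.ne_zero (i : ℂ) 1 (n + 1 - i)
    rw [show (n : ℂ) + 1 - i - 1 = n - i by ring, show (i : ℂ) + (n + 1 - i) = n + 1 by ring,
      qNum_one C.ne_zero C.generic] at hb
    rw [map_sub, hs, map_smul, ← Module.End.mul_apply e21 (e21 ^ i), ← pow_succ']
    match_scalars
    · field_simp
    · field_simp
      linear_combination (-1 : ℂ) * hb
  simp only [gzFun]
  rw [map_smul, key, show (n : ℂ) + 1 - (i + 1 : ℕ) = n - i by push_cast; ring]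
  rcases hi.lt_or_eq with hi | rfl
  · rw [smul_smul, smul_smul, nrm_succ_mul C.ne_zero C.generic hi, ← qRoot_mul_self (i : ℂ),
      ← qRoot_mul_self ((i : ℂ) + 1)]
    congr 1
    push_cast
    field_simp
  · rw [C.pow_highest_eq_zero hv (Nat.lt_succ_self i)]
    simp [qNum_zero]

theorem e21_gzFun_three [FiniteDimensional ℂ V]
    (C : IsChevalleyModule q H₁ H₁' H₂ H₂' e12 e21 e23 e32)
    (hv : IsHighestWeight q n M H₁ H₂ e12 e23 v) {i : ℕ} (hi : i ≤ n + 1) (hi0 : i ≠ 0) :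
    e21 (gzFun q a₁ a₂ a₃ n e21 e32 v 3 i) =
      (qRoot q i * qRoot q (n + 1 - i)) • gzFun q a₁ a₂ a₃ n e21 e32 v 3 (i + 1) := by
  have h1 := C.qRoot_succ_ne_zero i
  have h2 := C.qRoot_nat_ne_zero hi0
  have hI := C.qNum_succ_ne_zero i
  have hq := C.ne_zero
  have hs := C.serre_pow (e32 v) i
  -- For the string starting at `E₃₂ v` the second term of the Serre formula contains `E₃₂²`, so no
  -- correction is needed in `V₃`.
  rw [C.e32_e32, map_zero, add_zero, ← eq_inv_smul_iff₀ hI] at hs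
  simp only [gzFun]
  rw [map_smul, hs]
  rcases hi.lt_or_eq with hi | rfl
  · have h := nrm_succ_mul C.ne_zero C.generic hi
    push_cast at h
    rw [smul_smul, smul_smul, smul_smul, h, ← qRoot_mul_self (i : ℂ),
      ← qRoot_mul_self ((i : ℂ) + 1)]
    congr 1
    push_cast
    field_simp
  · rw [C.pow_e32_eq_zero hv (Nat.lt_succ_self _)]
    simp

/-! ### The action of the odd generators -/

theorem e32_gzFun_two (C : IsChevalleyModule q H₁ H₁' H₂ H₂' e12 e21 e23 e32)
    (ha₁ : a₁ ≠ 0) (ha₂ : a₂ ≠ 0) (ha₃ : a₃ ≠ 0) {i : ℕ} (hi : i ≤ n) (hi0 : i ≠ 0) :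
    e32 (gzFun q a₁ a₂ a₃ n e21 e32 v 2 i) =
      (-(a₂ / a₃) * q * (qRoot q (n + 1 - i) / qRoot q n)) •
        gzFun q a₁ a₂ a₃ n e21 e32 v 3 i := by
  have hq := C.ne_zero
  have h1 := C.qRoot_nat_ne_zero hi0
  have h2 := C.qRoot_nat_ne_zero (i := n) (by omega)
  have hn := C.qRoot_succ_ne_zero n
  rw [C.gzFun_two ha₁ ha₂ hi hi0, map_smul, map_sub, map_smul, C.e32_e32, zero_sub,
    C.e32_gzFun_one ha₃, ← qRoot_mul_self ((n : ℂ) + 1)]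
  match_scalars
  field_simp

theorem e32_gzFun_three (C : IsChevalleyModule q H₁ H₁' H₂ H₂' e12 e21 e23 e32) (i : ℕ) :
    e32 (gzFun q a₁ a₂ a₃ n e21 e32 v 3 i) = 0 := by
  simp only [gzFun]
  rw [map_smul, C.e32_e32, smul_zero]

theorem e23_gzFun_zero (C : IsChevalleyModule q H₁ H₁' H₂ H₂' e12 e21 e23 e32)
    (hv : IsHighestWeight q n M H₁ H₂ e12 e23 v) (i : ℕ) :
    e23 (gzFun q a₁ a₂ a₃ n e21 e32 v 0 i) = 0 := by
  simp only [gzFun]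
  rw [map_smul, C.e23_pow, hv.e23_apply, map_zero, smul_zero]

theorem e23_gzFun_one [FiniteDimensional ℂ V]
    (C : IsChevalleyModule q H₁ H₁' H₂ H₂' e12 e21 e23 e32)
    (hv : IsHighestWeight q n M H₁ H₂ e12 e23 v) {i : ℕ} (hi : i ≤ n + 1) :
    e23 (gzFun q a₁ a₂ a₃ n e21 e32 v 1 i) =
      (a₁ * (qRoot q (n + 1 - i) / qRoot q (n + 1)) * qNum q M) •
        gzFun q a₁ a₂ a₃ n e21 e32 v 0 i := by
  have hn := C.qRoot_succ_ne_zero n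
  simp only [gzFun]
  rw [map_smul, C.e23_pow, C.e23_e32, hv.e23_apply, map_zero, neg_zero, zero_add,
    bracket_apply C.ne_zero C.inv₂ hv.H₂_apply, map_smul, smul_smul, smul_smul]
  rcases Nat.lt_or_eq_of_le hi with hi | rfl
  · have h := nrm_add_one_mul C.ne_zero C.generic (Nat.le_of_lt_succ hi)
    congr 1
    field_simp
    linear_combination a₁ * qNum q M * h
  -- The string of `V₁` is longer by one than that of `V₀`; its last vector is sent to zero.
  · rw [C.pow_highest_eq_zero hv (Nat.lt_succ_self n), smul_zero, smul_zero]

theorem H₂_gzFun_zero (C : IsChevalleyModule q H₁ H₁' H₂ H₂' e12 e21 e23 e32)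
    (hv : IsHighestWeight q n M H₁ H₂ e12 e23 v) (i : ℕ) :
    H₂ (gzFun q a₁ a₂ a₃ n e21 e32 v 0 i) =
      q ^ (M + i) • gzFun q a₁ a₂ a₃ n e21 e32 v 0 i := by
  simp only [gzFun]
  rw [map_smul, C.H₂_pow hv.H₂_apply, smul_comm]

theorem H₂_gzFun_one (C : IsChevalleyModule q H₁ H₁' H₂ H₂' e12 e21 e23 e32)
    (hv : IsHighestWeight q n M H₁ H₂ e12 e23 v) (i : ℕ) :
    H₂ (gzFun q a₁ a₂ a₃ n e21 e32 v 1 i) =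
      q ^ (M + i) • gzFun q a₁ a₂ a₃ n e21 e32 v 1 i := by
  simp only [gzFun]
  rw [map_smul, C.H₂_pow (C.H₂_e32_highest hv), smul_comm]

theorem e23_gzFun_two [FiniteDimensional ℂ V]
    (C : IsChevalleyModule q H₁ H₁' H₂ H₂' e12 e21 e23 e32)
    (hv : IsHighestWeight q n M H₁ H₂ e12 e23 v) (ha₁ : a₁ ≠ 0) (ha₂ : a₂ ≠ 0) {i : ℕ}
    (hi : i ≤ n) (hi0 : i ≠ 0) :
    e23 (gzFun q a₁ a₂ a₃ n e21 e32 v 2 i) =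
      (a₂ * (qRoot q i / qRoot q n) * qNum q (M + (n + 1))) •
        gzFun q a₁ a₂ a₃ n e21 e32 v 0 i := by
  have h1 := C.qRoot_nat_ne_zero hi0
  have h2 := C.qRoot_nat_ne_zero (i := n) (by omega)
  have hn := C.qRoot_succ_ne_zero n
  -- `E₃₂ E₂₁^i v` contributes `[M+i]`, the correction term contributes `[M]`, and `[M+i][n+1] -
  -- [n+1-i][M] = [i][M+n+1]`. This creates the second atypicality factor.
  have hb := qNum_mul_sub C.ne_zero M i (n + 1)
  rw [← qRoot_mul_self (i : ℂ), ← qRoot_mul_self ((n : ℂ) + 1),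
    ← qRoot_mul_self ((n : ℂ) + 1 - i)] at hb
  rw [C.gzFun_two ha₁ ha₂ hi hi0, map_smul, map_sub, map_smul, C.e23_e32,
    C.e23_gzFun_zero hv, map_zero, neg_zero, zero_add,
    bracket_apply C.ne_zero C.inv₂ (C.H₂_gzFun_zero hv i), C.e23_gzFun_one hv (by omega),
    ← qRoot_mul_self ((n : ℂ) + 1)]
  match_scalars
  field_simp
  linear_combination hb

theorem e23_gzFun_three [FiniteDimensional ℂ V]
    (C : IsChevalleyModule q H₁ H₁' H₂ H₂' e12 e21 e23 e32)
    (hv : IsHighestWeight q n M H₁ H₂ e12 e23 v) (ha₁ : a₁ ≠ 0) (ha₂ : a₂ ≠ 0) (ha₃ : a₃ ≠ 0)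
    {i : ℕ} (hi : i ≤ n + 1) (hi0 : i ≠ 0) :
    e23 (gzFun q a₁ a₂ a₃ n e21 e32 v 3 i) =
      a₃ • ((1 / (a₁ * q) * (qRoot q i / qRoot q (n + 1)) * qNum q (M + (n + 1))) •
          gzFun q a₁ a₂ a₃ n e21 e32 v 1 i -
        (1 / (a₂ * q) * (qRoot q (n + 1 - i) * qRoot q n) * (qNum q M / qNum q (n + 1))) •
          gzFun q a₁ a₂ a₃ n e21 e32 v 2 i) := by
  have hq := C.ne_zero
  have h1 := C.qRoot_nat_ne_zero hi0
  have hn := C.qRoot_succ_ne_zero n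
  have hb := qNum_mul_sub C.ne_zero M i (n + 1)
  rw [← qRoot_mul_self (i : ℂ), ← qRoot_mul_self ((n : ℂ) + 1),
    ← qRoot_mul_self ((n : ℂ) + 1 - i)] at hb
  rw [C.gzFun_three ha₁ ha₃ hi0, map_smul, C.e23_e32, C.e23_gzFun_one hv hi, map_smul,
    bracket_apply C.ne_zero C.inv₂ (C.H₂_gzFun_one hv i), ← qRoot_mul_self ((n : ℂ) + 1)]
  rcases Nat.lt_or_eq_of_le hi with hi | rfl
  · rw [C.e32_gzFun_zero ha₁ ha₂ (Nat.le_of_lt_succ hi), ← qRoot_mul_self ((n : ℂ) + 1)]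
    generalize gzFun q a₁ a₂ a₃ n e21 e32 v 1 i = x
    generalize gzFun q a₁ a₂ a₃ n e21 e32 v 2 i = y
    match_scalars
    · field_simp
      linear_combination hb
    · field_simp
  · rw [C.gzFun_zero_eq_zero hv (Nat.lt_succ_self n), C.gzFun_two_eq_zero hv (Nat.lt_succ_self n)]
    generalize gzFun q a₁ a₂ a₃ n e21 e32 v 1 (n + 1) = x
    push_cast at hb ⊢
    rw [sub_self, qRoot_zero] at hb
    rw [map_zero, smul_zero, smul_zero, neg_zero, zero_add, sub_zero]
    match_scalars
    field_simp

end IsChevalleyModule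
end GelfandZetlin

/-! ### Linear independence of joint eigenvectors -/

section JointEigenvectors

variable {V : Type*} [AddCommGroup V] [Module ℂ V]

/-- `A` is a product of factors `f a - μ a j`, one for each `j ∈ s`, with `a` chosen to separate `j`
from `i₀`. The operators `f a` need not commute, since each acts on every `w i` by a scalar. -/
theorem exists_annihilator {ι κ : Type*} [DecidableEq ι] (f : κ → Module.End ℂ V) (μ : κ → ι → ℂ)
    (w : ι → V) (h : ∀ a i, f a (w i) = μ a i • w i)
    (sep : ∀ i j, i ≠ j → ∃ a, μ a i ≠ μ a j) (i₀ : ι) (s : Finset ι) (hs : i₀ ∉ s) :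
    ∃ (A : Module.End ℂ V) (α : ι → ℂ), (∀ i, A (w i) = α i • w i) ∧ α i₀ ≠ 0 ∧
      ∀ j ∈ s, α j = 0 := by
  induction s using Finset.induction_on with
  | empty => exact ⟨1, 1, by simp, by simp, by simp⟩
  | insert j s hj ih =>
    rw [Finset.mem_insert, not_or] at hs
    obtain ⟨A, α, hA, h0, hα⟩ := ih hs.2
    obtain ⟨a, ha⟩ := sep i₀ j hs.1
    refine ⟨A * (f a - algebraMap ℂ _ (μ a j)), fun i => α i * (μ a i - μ a j), fun i => ?_,
      mul_ne_zero h0 (sub_ne_zero.2 ha), fun i hi => ?_⟩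
    · rw [Module.End.mul_apply, LinearMap.sub_apply, h, Module.algebraMap_end_apply, ← sub_smul,
        map_smul, hA, smul_smul, mul_comm]
    · rcases Finset.mem_insert.1 hi with rfl | hi
      · simp
      · simp [hα i hi]

/-- Joint eigenvectors with distinct tuples of eigenvalues are linearly independent. -/
theorem linearIndependent_of_joint_eigenvectors {ι κ : Type*} (f : κ → Module.End ℂ V)
    (μ : κ → ι → ℂ) (w : ι → V) (h : ∀ a i, f a (w i) = μ a i • w i) (hw : ∀ i, w i ≠ 0)
    (sep : ∀ i j, i ≠ j → ∃ a, μ a i ≠ μ a j) : LinearIndependent ℂ w := by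
  classical
  rw [linearIndependent_iff']
  intro s c hc i hi
  obtain ⟨A, α, hA, h0, hα⟩ := exists_annihilator f μ w h sep i (s.erase i) (by simp)
  have := congrArg A hc
  rw [map_sum, map_zero, Finset.sum_eq_single_of_mem i hi, map_smul, hA, smul_smul,
    smul_eq_zero_iff_left (hw i), mul_eq_zero] at this
  · exact this.resolve_right h0
  · intro j hj hji
    rw [map_smul, hA, hα j (Finset.mem_erase.2 ⟨hji, hj⟩), zero_smul, smul_zero]

end JointEigenvectors

/-! ### Sums of subspaces `V_k` and their invariance -/

section GelfandZetlin

variable {V : Type*} [AddCommGroup V] [Module ℂ V]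
variable {q : ℂ} {n : ℕ} {M : ℂ} {H₁ H₁' H₂ H₂' e12 e21 e23 e32 : Module.End ℂ V} {v : V}
  {a₁ a₂ a₃ : ℂ}

/-- The weights of the vectors of the Gel'fand-Zetlin basis. -/
theorem apply_gzFun {K : Module.End ℂ V} {κ f x : ℂ} (hf : ∀ y, K (e21 y) = f • e21 (K y))
    (hx : ∀ y, K (e32 y) = x • e32 (K y)) (hκ : K v = κ • v) (k : Fin 4) (i : ℕ) :
    K (gzFun q a₁ a₂ a₃ n e21 e32 v k i) =
      (κ * f ^ i * x ^ (Signature.shift3 k)) • gzFun q a₁ a₂ a₃ n e21 e32 v k i := by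
  have hp : ∀ {u : V} {κ' : ℂ}, K u = κ' • u → K ((e21 ^ i) u) = (κ' * f ^ i) • (e21 ^ i) u := by
    intro u κ' hu
    clear hκ
    induction i with
    | zero => simpa using hu
    | succ i ih =>
      rw [pow_succ', Module.End.mul_apply, hf, ih, map_smul, smul_smul]
      congr 1
      ring
  have he : ∀ {u : V} {κ' : ℂ}, K u = κ' • u → K (e32 u) = (κ' * x) • e32 u := by
    intro u κ' hu
    rw [hx, hu, map_smul, smul_smul, mul_comm]
  have h1 := hp (he hκ)
  have h2 := he (hp hκ)
  have h3 := he h1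
  have h0 := hp hκ
  fin_cases k
  · simp only [gzFun, map_smul, h0, Signature.shift3]
    match_scalars
    simp
    ring
  · simp only [gzFun, map_smul, h1, Signature.shift3]
    match_scalars
    simp
    ring
  · simp only [gzFun, map_smul, map_sub, h1, h2, Signature.shift3]
    match_scalars
    · simp
      ring
    · simp
      ring
  · simp only [gzFun, map_smul, h3, Signature.shift3]
    match_scalars
    simp
    ring

/-- The span of the vectors `(m)_k`, `k ∈ s`. -/
def gzSpan (q a₁ a₂ a₃ : ℂ) (n : ℕ) (e21 e32 : Module.End ℂ V) (v : V) (s : Set (Fin 4)) :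
    Submodule ℂ V :=
  Submodule.span ℂ {x | ∃ k ∈ s, ∃ i, gzFun q a₁ a₂ a₃ n e21 e32 v k i = x}

theorem gzFun_mem_gzSpan {s : Set (Fin 4)} {k : Fin 4} (hk : k ∈ s) (i : ℕ) :
    gzFun q a₁ a₂ a₃ n e21 e32 v k i ∈ gzSpan q a₁ a₂ a₃ n e21 e32 v s :=
  Submodule.subset_span ⟨k, hk, i, rfl⟩

theorem apply_mem_gzSpan {A : Module.End ℂ V} {s : Set (Fin 4)}
    (h : ∀ k ∈ s, ∀ i, A (gzFun q a₁ a₂ a₃ n e21 e32 v k i) ∈ gzSpan q a₁ a₂ a₃ n e21 e32 v s)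
    {x : V} (hx : x ∈ gzSpan q a₁ a₂ a₃ n e21 e32 v s) :
    A x ∈ gzSpan q a₁ a₂ a₃ n e21 e32 v s := by
  have : gzSpan q a₁ a₂ a₃ n e21 e32 v s ≤ (gzSpan q a₁ a₂ a₃ n e21 e32 v s).comap A := by
    rw [gzSpan, Submodule.span_le]
    rintro _ ⟨k, hk, i, rfl⟩
    exact h k hk i
  exact this hx

theorem diagonal_mem_gzSpan {K : Module.End ℂ V} {κ f x : ℂ}
    (hf : ∀ y, K (e21 y) = f • e21 (K y)) (hx : ∀ y, K (e32 y) = x • e32 (K y))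
    (hκ : K v = κ • v) {s : Set (Fin 4)} {y : V} (hy : y ∈ gzSpan q a₁ a₂ a₃ n e21 e32 v s) :
    K y ∈ gzSpan q a₁ a₂ a₃ n e21 e32 v s := by
  refine apply_mem_gzSpan (fun k hk i => ?_) hy
  rw [apply_gzFun hf hx hκ]
  exact Submodule.smul_mem _ _ (gzFun_mem_gzSpan hk i)

namespace IsChevalleyModule

theorem e12_gzFun_mem [FiniteDimensional ℂ V]
    (C : IsChevalleyModule q H₁ H₁' H₂ H₂' e12 e21 e23 e32)
    (hv : IsHighestWeight q n M H₁ H₂ e12 e23 v) (ha₁ : a₁ ≠ 0) (ha₂ : a₂ ≠ 0) (ha₃ : a₃ ≠ 0)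
    {s : Set (Fin 4)} (k : Fin 4) (hk : k ∈ s) (i : ℕ) :
    e12 (gzFun q a₁ a₂ a₃ n e21 e32 v k i) ∈ gzSpan q a₁ a₂ a₃ n e21 e32 v s := by
  have hm : ∀ c j, c • gzFun q a₁ a₂ a₃ n e21 e32 v k j ∈ gzSpan q a₁ a₂ a₃ n e21 e32 v s :=
    fun c j => Submodule.smul_mem _ _ (gzFun_mem_gzSpan hk j)
  match k, i with
  | 0, 0 => rw [e12_gzFun_zero_zero hv]; exact zero_mem _
  | 1, 0 => rw [C.e12_gzFun_one_zero hv]; exact zero_mem _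
  | 2, 0 => rw [gzFun_two_zero, map_zero]; exact zero_mem _
  | 3, 0 => rw [gzFun_three_zero, map_zero]; exact zero_mem _
  | 0, i + 1 =>
    rcases lt_or_ge i n with h | h
    · rw [C.e12_gzFun_zero_succ hv h]; exact hm _ _
    · rw [C.gzFun_zero_eq_zero hv (by omega), map_zero]; exact zero_mem _
  | 1, i + 1 =>
    rcases lt_or_ge i (n + 1) with h | h
    · rw [C.e12_gzFun_one_succ hv h]; exact hm _ _
    · rw [C.gzFun_one_eq_zero hv (by omega), map_zero]; exact zero_mem _
  | 2, i + 1 =>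
    rcases lt_or_ge i n with h | h
    · rw [C.e12_gzFun_two_succ hv ha₁ ha₂ h]; exact hm _ _
    · rw [C.gzFun_two_eq_zero hv (by omega), map_zero]; exact zero_mem _
  | 3, i + 1 =>
    rcases lt_or_ge i (n + 1) with h | h
    · rw [C.e12_gzFun_three_succ hv ha₁ ha₃ h]; exact hm _ _
    · rw [C.gzFun_three_eq_zero hv (by omega), map_zero]; exact zero_mem _

theorem e21_gzFun_mem [FiniteDimensional ℂ V]
    (C : IsChevalleyModule q H₁ H₁' H₂ H₂' e12 e21 e23 e32)
    (hv : IsHighestWeight q n M H₁ H₂ e12 e23 v)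
    {s : Set (Fin 4)} (k : Fin 4) (hk : k ∈ s) (i : ℕ) :
    e21 (gzFun q a₁ a₂ a₃ n e21 e32 v k i) ∈ gzSpan q a₁ a₂ a₃ n e21 e32 v s := by
  have hm : ∀ c j, c • gzFun q a₁ a₂ a₃ n e21 e32 v k j ∈ gzSpan q a₁ a₂ a₃ n e21 e32 v s :=
    fun c j => Submodule.smul_mem _ _ (gzFun_mem_gzSpan hk j)
  match k with
  | 0 =>
    rcases le_or_gt i n with h | h
    · rw [C.e21_gzFun_zero hv h]; exact hm _ _
    · rw [C.gzFun_zero_eq_zero hv h, map_zero]; exact zero_mem _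
  | 1 =>
    rcases le_or_gt i (n + 1) with h | h
    · rw [C.e21_gzFun_one hv h]; exact hm _ _
    · rw [C.gzFun_one_eq_zero hv h, map_zero]; exact zero_mem _
  | 2 =>
    rcases eq_or_ne i 0 with rfl | h0
    · rw [gzFun_two_zero, map_zero]; exact zero_mem _
    rcases le_or_gt i n with h | h
    · rw [C.e21_gzFun_two hv h h0]; exact hm _ _
    · rw [C.gzFun_two_eq_zero hv h, map_zero]; exact zero_mem _
  | 3 =>
    rcases eq_or_ne i 0 with rfl | h0
    · rw [gzFun_three_zero, map_zero]; exact zero_mem _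
    rcases le_or_gt i (n + 1) with h | h
    · rw [C.e21_gzFun_three hv h h0]; exact hm _ _
    · rw [C.gzFun_three_eq_zero hv h, map_zero]; exact zero_mem _

/-- The arrows of `E₃₂` are `V₀ → V₁`, `V₀ → V₂`, `V₁ → V₃`, `V₂ → V₃`. The hypotheses say that none
of them leaves `s`; the sets needed later all contain `3`. -/
theorem e32_gzFun_mem [FiniteDimensional ℂ V]
    (C : IsChevalleyModule q H₁ H₁' H₂ H₂' e12 e21 e23 e32)
    (hv : IsHighestWeight q n M H₁ H₂ e12 e23 v) (ha₁ : a₁ ≠ 0) (ha₂ : a₂ ≠ 0) (ha₃ : a₃ ≠ 0)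
    {s : Set (Fin 4)} (hs₀ : 0 ∈ s → 1 ∈ s ∧ 2 ∈ s) (hs : 3 ∈ s) (k : Fin 4) (hk : k ∈ s)
    (i : ℕ) : e32 (gzFun q a₁ a₂ a₃ n e21 e32 v k i) ∈ gzSpan q a₁ a₂ a₃ n e21 e32 v s := by
  have hm : ∀ c k j, k ∈ s →
      c • gzFun q a₁ a₂ a₃ n e21 e32 v k j ∈ gzSpan q a₁ a₂ a₃ n e21 e32 v s :=
    fun c k j hk => Submodule.smul_mem _ _ (gzFun_mem_gzSpan hk j)
  match k with
  | 0 =>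
    rcases le_or_gt i n with h | h
    · rw [C.e32_gzFun_zero ha₁ ha₂ h]
      exact add_mem (hm _ _ _ (hs₀ hk).1) (hm _ _ _ (hs₀ hk).2)
    · rw [C.gzFun_zero_eq_zero hv h, map_zero]; exact zero_mem _
  | 1 => rw [C.e32_gzFun_one ha₃]; exact hm _ _ _ hs
  | 2 =>
    rcases eq_or_ne i 0 with rfl | h0
    · rw [gzFun_two_zero, map_zero]; exact zero_mem _
    rcases le_or_gt i n with h | h
    · rw [C.e32_gzFun_two ha₁ ha₂ ha₃ h h0]; exact hm _ _ _ hs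
    · rw [C.gzFun_two_eq_zero hv h, map_zero]; exact zero_mem _
  | 3 => rw [C.e32_gzFun_three]; exact zero_mem _

/-- `E₂₃` reverses the arrows of `E₃₂`. An arrow may leave `s` only if its coefficient vanishes:
`[M]` governs `1 → 0` and `3 → 2`, while `[M+n+1]` governs `2 → 0` and `3 → 1`. -/
theorem e23_gzFun_mem [FiniteDimensional ℂ V]
    (C : IsChevalleyModule q H₁ H₁' H₂ H₂' e12 e21 e23 e32)
    (hv : IsHighestWeight q n M H₁ H₂ e12 e23 v) (ha₁ : a₁ ≠ 0) (ha₂ : a₂ ≠ 0) (ha₃ : a₃ ≠ 0)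
    {s : Set (Fin 4)} (hs₁ : 1 ∈ s → 0 ∈ s ∨ qNum q M = 0)
    (hs₂ : 2 ∈ s → 0 ∈ s ∨ qNum q (M + (n + 1)) = 0)
    (hs₃ : 3 ∈ s → (1 ∈ s ∨ qNum q (M + (n + 1)) = 0) ∧ (2 ∈ s ∨ qNum q M = 0))
    (k : Fin 4) (hk : k ∈ s) (i : ℕ) :
    e23 (gzFun q a₁ a₂ a₃ n e21 e32 v k i) ∈ gzSpan q a₁ a₂ a₃ n e21 e32 v s := by
  have hm : ∀ (c : ℂ) (k : Fin 4) (j : ℕ), k ∈ s ∨ c = 0 →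
      c • gzFun q a₁ a₂ a₃ n e21 e32 v k j ∈ gzSpan q a₁ a₂ a₃ n e21 e32 v s := by
    rintro c k j (hk | rfl)
    · exact Submodule.smul_mem _ _ (gzFun_mem_gzSpan hk j)
    · rw [zero_smul]; exact zero_mem _
  match k with
  | 0 => rw [C.e23_gzFun_zero hv]; exact zero_mem _
  | 1 =>
    rcases le_or_gt i (n + 1) with h | h
    · rw [C.e23_gzFun_one hv h]
      exact hm _ _ _ ((hs₁ hk).imp id fun h => by rw [h, mul_zero])
    · rw [C.gzFun_one_eq_zero hv h, map_zero]; exact zero_mem _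
  | 2 =>
    rcases eq_or_ne i 0 with rfl | h0
    · rw [gzFun_two_zero, map_zero]; exact zero_mem _
    rcases le_or_gt i n with h | h
    · rw [C.e23_gzFun_two hv ha₁ ha₂ h h0]
      exact hm _ _ _ ((hs₂ hk).imp id fun h => by rw [h, mul_zero])
    · rw [C.gzFun_two_eq_zero hv h, map_zero]; exact zero_mem _
  | 3 =>
    rcases eq_or_ne i 0 with rfl | h0
    · rw [gzFun_three_zero, map_zero]; exact zero_mem _
    rcases le_or_gt i (n + 1) with h | h
    · rw [C.e23_gzFun_three hv ha₁ ha₂ ha₃ h h0]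
      exact Submodule.smul_mem _ _ (sub_mem
        (hm _ _ _ ((hs₃ hk).1.imp id fun h => by rw [h, mul_zero]))
        (hm _ _ _ ((hs₃ hk).2.imp id fun h => by rw [h, zero_div, mul_zero])))
    · rw [C.gzFun_three_eq_zero hv h, map_zero]; exact zero_mem _

theorem H₁_gzFun (C : IsChevalleyModule q H₁ H₁' H₂ H₂' e12 e21 e23 e32)
    (hv : IsHighestWeight q n M H₁ H₂ e12 e23 v) (k : Fin 4) (i : ℕ) :
    H₁ (gzFun q a₁ a₂ a₃ n e21 e32 v k i) =
      q ^ ((n : ℤ) - 2 * i + Signature.shift3 k) • gzFun q a₁ a₂ a₃ n e21 e32 v k i := by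
  rw [apply_gzFun C.H₁_e21 C.H₁_e32 hv.H₁_apply, zpow_add₀ C.ne_zero, zpow_sub₀ C.ne_zero,
    zpow_mul, zpow_neg, Complex.cpow_natCast, zpow_natCast, zpow_natCast, inv_pow, div_eq_mul_inv]

theorem H₂_gzFun (C : IsChevalleyModule q H₁ H₁' H₂ H₂' e12 e21 e23 e32)
    (hv : IsHighestWeight q n M H₁ H₂ e12 e23 v) (k : Fin 4) (i : ℕ) :
    H₂ (gzFun q a₁ a₂ a₃ n e21 e32 v k i) =
      (q ^ M * q ^ (i : ℤ)) • gzFun q a₁ a₂ a₃ n e21 e32 v k i := by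
  rw [apply_gzFun C.H₂_e21 (x := 1) (fun y => by rw [C.H₂_e32, one_smul]) hv.H₂_apply, one_zpow,
    mul_one, zpow_natCast]

/-- `D = q^{h₁+2h₂}` commutes with `E₂₁` and gains a factor `q` when it passes `E₃₂`, so its
eigenvalue on `V_k` records the number of factors `E₃₂`. Without `V₀` only `δq` and `δq²` occur; the
operator `B` kills both eigenspaces but not `v`, whose eigenvalue is `δ`. -/
theorem gzSpan_ne_top (C : IsChevalleyModule q H₁ H₁' H₂ H₂' e12 e21 e23 e32)
    (hv : IsHighestWeight q n M H₁ H₂ e12 e23 v) (hv0 : v ≠ 0) {s : Set (Fin 4)} (hs : 0 ∉ s) :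
    gzSpan q a₁ a₂ a₃ n e21 e32 v s ≠ ⊤ := by
  intro htop
  have hM : q ^ M ≠ 0 := by simp [Complex.cpow_eq_zero_iff, C.ne_zero]
  set D : Module.End ℂ V := H₁ * H₂ * H₂ with hD
  set δ : ℂ := q ^ (n : ℤ) * (q ^ M) ^ 2 with hδ
  have hδ0 : δ ≠ 0 := mul_ne_zero (zpow_ne_zero _ C.ne_zero) (pow_ne_zero _ hM)
  have hg : ∀ k i, D (gzFun q a₁ a₂ a₃ n e21 e32 v k i) =
      (δ * q ^ Signature.shift3 k) • gzFun q a₁ a₂ a₃ n e21 e32 v k i := by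
    intro k i
    have hq := C.ne_zero
    rw [hD, Module.End.mul_apply, Module.End.mul_apply, C.H₂_gzFun hv, map_smul, map_smul,
      C.H₂_gzFun hv, map_smul, C.H₁_gzFun hv, smul_smul, smul_smul, zpow_add₀ hq, zpow_sub₀ hq,
      zpow_mul' q 2, zpow_ofNat, hδ]
    congr 1
    have : q ^ (i : ℤ) ≠ 0 := zpow_ne_zero _ hq
    field_simp
  have hv' : D v = δ • v := by
    simpa [gzFun, nrm_zero, Signature.shift3] using hg 0 0
  set B : Module.End ℂ V :=
    (D - algebraMap ℂ _ (δ * q)) * (D - algebraMap ℂ _ (δ * q ^ 2)) with hB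
  have hBe : ∀ {x : V} {c : ℂ}, D x = c • x → B x = ((c - δ * q) * (c - δ * q ^ 2)) • x := by
    intro x c hx
    simp only [hB, Module.End.mul_apply, LinearMap.sub_apply, Module.algebraMap_end_apply, hx,
      map_sub, map_smul]
    module
  have hker : gzSpan q a₁ a₂ a₃ n e21 e32 v s ≤ LinearMap.ker B := by
    rw [gzSpan, Submodule.span_le]
    rintro _ ⟨k, hk, i, rfl⟩
    rw [SetLike.mem_coe, LinearMap.mem_ker, hBe (hg k i)]
    fin_cases k
    · exact absurd hk hs
    all_goals simp [Signature.shift3]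
  have hBv : B v = 0 := by
    have : v ∈ gzSpan q a₁ a₂ a₃ n e21 e32 v s := htop ▸ Submodule.mem_top
    exact hker this
  rw [hBe hv', smul_eq_zero_iff_left hv0, mul_eq_zero, sub_eq_zero, sub_eq_zero] at hBv
  rcases hBv with h | h
  · exact C.generic 1 one_pos (by
      rw [pow_one]; exact (mul_left_cancel₀ hδ0 ((mul_one δ).trans h)).symm)
  · exact C.generic 2 two_pos (mul_left_cancel₀ hδ0 ((mul_one δ).trans h)).symm

end IsChevalleyModule
end GelfandZetlin

/-! ### Nonvanishing and independence of the basis vectors -/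

section GelfandZetlin

variable {V : Type*} [AddCommGroup V] [Module ℂ V]
variable {q : ℂ} {n : ℕ} {M : ℂ} {H₁ H₁' H₂ H₂' e12 e21 e23 e32 : Module.End ℂ V} {v : V}
  {a₁ a₂ a₃ : ℂ}

namespace IsChevalleyModule

theorem qRoot_sub_ne_zero (C : IsChevalleyModule q H₁ H₁' H₂ H₂' e12 e21 e23 e32) {i m : ℕ}
    (h : i < m) : qRoot q (m - i) ≠ 0 :=
  qRoot_natCast_sub_ne_zero C.ne_zero C.generic h.ne

theorem gzFun_zero_ne_zero (C : IsChevalleyModule q H₁ H₁' H₂ H₂' e12 e21 e23 e32)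
    (hv : IsHighestWeight q n M H₁ H₂ e12 e23 v) (hv0 : v ≠ 0) {i : ℕ} (hi : i ≤ n) :
    gzFun q a₁ a₂ a₃ n e21 e32 v 0 i ≠ 0 := by
  induction i with
  | zero => simpa [gzFun, nrm_zero] using hv0
  | succ i ih =>
    intro h
    have := C.e12_gzFun_zero_succ (a₁ := a₁) (a₂ := a₂) (a₃ := a₃) hv hi
    rw [h, map_zero, eq_comm, smul_eq_zero_iff_left (ih (by omega))] at this
    exact mul_ne_zero (C.qRoot_succ_ne_zero i) (C.qRoot_sub_ne_zero hi) this

/-- `E₂₃` takes the vector with `i = 0` to a multiple of `v` by a factor containing `[M]`; from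
there `E₁₂` carries nonvanishing along the string, from `i` to `i + 1`. -/
theorem gzFun_one_ne_zero [FiniteDimensional ℂ V]
    (C : IsChevalleyModule q H₁ H₁' H₂ H₂' e12 e21 e23 e32)
    (hv : IsHighestWeight q n M H₁ H₂ e12 e23 v) (hv0 : v ≠ 0) (ha₁ : a₁ ≠ 0)
    (hM : qNum q M ≠ 0) {i : ℕ} (hi : i ≤ n + 1) :
    gzFun q a₁ a₂ a₃ n e21 e32 v 1 i ≠ 0 := by
  induction i with
  | zero =>
    intro h
    have := C.e23_gzFun_one (a₁ := a₁) (a₂ := a₂) (a₃ := a₃) hv (Nat.zero_le (n + 1))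
    rw [h, map_zero, eq_comm, smul_eq_zero_iff_left (C.gzFun_zero_ne_zero hv hv0 (Nat.zero_le n)),
      Nat.cast_zero, sub_zero, div_self (C.qRoot_succ_ne_zero n), mul_one] at this
    exact mul_ne_zero ha₁ hM this
  | succ i ih =>
    intro h
    have := C.e12_gzFun_one_succ (a₁ := a₁) (a₂ := a₂) (a₃ := a₃) hv hi
    rw [h, map_zero, eq_comm, smul_eq_zero_iff_left (ih (by omega))] at this
    have h2 := C.qRoot_sub_ne_zero hi
    push_cast at h2
    exact mul_ne_zero (C.qRoot_succ_ne_zero i) h2 this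

theorem gzFun_two_ne_zero [FiniteDimensional ℂ V]
    (C : IsChevalleyModule q H₁ H₁' H₂ H₂' e12 e21 e23 e32)
    (hv : IsHighestWeight q n M H₁ H₂ e12 e23 v) (hv0 : v ≠ 0) (ha₁ : a₁ ≠ 0) (ha₂ : a₂ ≠ 0)
    (hM : qNum q (M + (n + 1)) ≠ 0) {i : ℕ} (hi : i ≤ n) (hi0 : i ≠ 0) :
    gzFun q a₁ a₂ a₃ n e21 e32 v 2 i ≠ 0 := by
  intro h
  have := C.e23_gzFun_two (a₃ := a₃) hv ha₁ ha₂ hi hi0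
  rw [h, map_zero, eq_comm, smul_eq_zero_iff_left (C.gzFun_zero_ne_zero hv hv0 hi)] at this
  exact mul_ne_zero (mul_ne_zero ha₂ (div_ne_zero (C.qRoot_nat_ne_zero hi0)
    (C.qRoot_nat_ne_zero (by omega)))) hM this

theorem gzFun_three_ne_zero [FiniteDimensional ℂ V]
    (C : IsChevalleyModule q H₁ H₁' H₂ H₂' e12 e21 e23 e32)
    (hv : IsHighestWeight q n M H₁ H₂ e12 e23 v) (hv0 : v ≠ 0) (ha₁ : a₁ ≠ 0) (ha₂ : a₂ ≠ 0)
    (ha₃ : a₃ ≠ 0) (hM : qNum q M ≠ 0) (hM' : qNum q (M + (n + 1)) ≠ 0) {i : ℕ}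
    (hi : i ≤ n + 1) (hi0 : i ≠ 0) : gzFun q a₁ a₂ a₃ n e21 e32 v 3 i ≠ 0 := by
  induction i with
  | zero => exact absurd rfl hi0
  | succ i ih =>
    intro h
    rcases Nat.eq_zero_or_pos i with rfl | hpos
    · have h1 := C.e23_gzFun_three hv ha₁ ha₂ ha₃ hi hi0
      -- For the first vector of `V₃`, apply `E₂₃` and then `E₁₂`. The `V₂` part dies, being of
      -- highest weight for `sl(2)`, and a nonzero multiple of the first vector of `V₁` remains. No
      -- independence of `V₁` and `V₂` is needed.
      have h2 : e12 (gzFun q a₁ a₂ a₃ n e21 e32 v 2 (0 + 1)) = 0 := by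
        rcases Nat.eq_zero_or_pos n with rfl | hn
        · rw [C.gzFun_two_eq_zero hv Nat.one_pos, map_zero]
        · rw [C.e12_gzFun_two_succ hv ha₁ ha₂ hn, gzFun_two_zero, smul_zero]
      have := congrArg e12 h1
      rw [h, map_zero, map_zero, map_smul, map_sub, map_smul, map_smul, h2, smul_zero, sub_zero,
        C.e12_gzFun_one_succ hv hi, eq_comm, smul_eq_zero_iff_right ha₃, smul_smul,
        smul_eq_zero_iff_left (C.gzFun_one_ne_zero hv hv0 ha₁ hM (Nat.zero_le _))] at this
      have hn := C.qRoot_succ_ne_zero n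
      have h0 := C.qRoot_succ_ne_zero 0
      have hq := C.ne_zero
      simp [hn, hM', ha₁, hq] at this h0
      exact h0 this
    · have := C.e12_gzFun_three_succ (a₂ := a₂) hv ha₁ ha₃ hi
      rw [h, map_zero, eq_comm, smul_eq_zero_iff_left (ih (by omega) hpos.ne')] at this
      have h2 := C.qRoot_sub_ne_zero hi
      push_cast at h2
      exact mul_ne_zero (C.qRoot_nat_ne_zero hpos.ne') h2 this

end IsChevalleyModule

/-- The eigenvalue of `E₂₁ E₁₂` on the Gel'fand-Zetlin vectors. -/
def e21e12Eigenvalue (q : ℂ) (n : ℕ) (k : Fin 4) (i : ℕ) : ℂ :=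
  qNum q (i - Signature.shift1 k) * qNum q (n - i + Signature.shift2 k + 1)

namespace IsChevalleyModule

theorem e21_e12_gzFun [FiniteDimensional ℂ V]
    (C : IsChevalleyModule q H₁ H₁' H₂ H₂' e12 e21 e23 e32)
    (hv : IsHighestWeight q n M H₁ H₂ e12 e23 v) (ha₁ : a₁ ≠ 0) (ha₂ : a₂ ≠ 0) (ha₃ : a₃ ≠ 0)
    (k : Fin 4) (i : ℕ) :
    e21 (e12 (gzFun q a₁ a₂ a₃ n e21 e32 v k i)) =
      e21e12Eigenvalue q n k i • gzFun q a₁ a₂ a₃ n e21 e32 v k i := by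
  have e : ∀ i : ℕ, (n : ℂ) - (i + 1 : ℕ) + 1 = n - i := fun i => by push_cast; ring
  have e' : ∀ i : ℕ, (n : ℂ) - (i + 1 : ℕ) + 1 + 1 = n + 1 - i := fun i => by push_cast; ring
  have s : ∀ i : ℕ, ((i + 1 : ℕ) : ℂ) - 1 = i := fun i => by push_cast; ring
  match k, i with
  | 0, 0 => simp [e12_gzFun_zero_zero hv, e21e12Eigenvalue, Signature.shift1, qNum_zero]
  | 1, 0 => simp [C.e12_gzFun_one_zero hv, e21e12Eigenvalue, Signature.shift1, qNum_zero]
  | 2, 0 => simp [gzFun_two_zero]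
  | 3, 0 => simp [gzFun_three_zero]
  | 0, i + 1 =>
    rcases lt_or_ge i n with h | h
    · rw [C.e12_gzFun_zero_succ hv h, map_smul, C.e21_gzFun_zero hv h.le, smul_smul]
      simp only [e21e12Eigenvalue, Signature.shift1, Signature.shift2, Matrix.cons_val,
        Int.cast_zero, add_zero, sub_zero, e, ← qRoot_mul_self]
      congr 1
      push_cast
      ring
    · rw [C.gzFun_zero_eq_zero hv (by omega), map_zero, map_zero, smul_zero]
  | 1, i + 1 =>
    rcases lt_or_ge i (n + 1) with h | h
    · rw [C.e12_gzFun_one_succ hv h, map_smul, C.e21_gzFun_one hv h.le, smul_smul]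
      simp only [e21e12Eigenvalue, Signature.shift1, Signature.shift2, Matrix.cons_val,
        Int.cast_zero, Int.cast_one, sub_zero, e', ← qRoot_mul_self]
      congr 1
      push_cast
      ring
    · rw [C.gzFun_one_eq_zero hv (by omega), map_zero, map_zero, smul_zero]
  | 2, i + 1 =>
    rcases lt_or_ge i n with h | h
    · rcases Nat.eq_zero_or_pos i with rfl | h0
      · rw [C.e12_gzFun_two_succ hv ha₁ ha₂ h, gzFun_two_zero]
        simp [e21e12Eigenvalue, Signature.shift1, qNum_zero]
      rw [C.e12_gzFun_two_succ hv ha₁ ha₂ h, map_smul, C.e21_gzFun_two hv h.le h0.ne', smul_smul]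
      simp only [e21e12Eigenvalue, Signature.shift1, Signature.shift2, Matrix.cons_val,
        Int.cast_zero, Int.cast_one, add_zero, e, s, ← qRoot_mul_self]
      congr 1
      ring
    · rw [C.gzFun_two_eq_zero hv (by omega), map_zero, map_zero, smul_zero]
  | 3, i + 1 =>
    rcases lt_or_ge i (n + 1) with h | h
    · rcases Nat.eq_zero_or_pos i with rfl | h0
      · rw [C.e12_gzFun_three_succ hv ha₁ ha₃ h, gzFun_three_zero]
        simp [e21e12Eigenvalue, Signature.shift1, qNum_zero]
      rw [C.e12_gzFun_three_succ hv ha₁ ha₃ h, map_smul, C.e21_gzFun_three hv h.le h0.ne',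
        smul_smul]
      simp only [e21e12Eigenvalue, Signature.shift1, Signature.shift2, Matrix.cons_val,
        Int.cast_one, e', s, ← qRoot_mul_self]
      congr 1
      ring
    · rw [C.gzFun_three_eq_zero hv (by omega), map_zero, map_zero, smul_zero]

/-- The two eigenvalues differ by `[n+1]`. This separates `V₁` from `V₂`, whose vectors with equal
`i` have the same Cartan weights. -/
theorem e21e12Eigenvalue_ne (C : IsChevalleyModule q H₁ H₁' H₂ H₂' e12 e21 e23 e32) (i : ℕ) :
    e21e12Eigenvalue q n 1 i ≠ e21e12Eigenvalue q n 2 i := by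
  have h := qNum_mul_sub C.ne_zero ((i : ℂ) - 1) 1 (n - i + 1 + 1)
  rw [qNum_one C.ne_zero C.generic, one_mul, show (i : ℂ) - 1 + 1 = i by ring,
    show (n : ℂ) - i + 1 + 1 - 1 = n - i + 1 by ring,
    show (i : ℂ) - 1 + (n - i + 1 + 1) = n + 1 by ring] at h
  simp only [e21e12Eigenvalue, Signature.shift1, Signature.shift2, Matrix.cons_val,
        Int.cast_zero, Int.cast_one, add_zero, sub_zero]
  rw [← sub_ne_zero, mul_comm (qNum q ((i : ℂ) - 1)), h]
  exact C.qNum_succ_ne_zero n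

theorem linearIndependent_gzFun [FiniteDimensional ℂ V]
    (C : IsChevalleyModule q H₁ H₁' H₂ H₂' e12 e21 e23 e32)
    (hv : IsHighestWeight q n M H₁ H₂ e12 e23 v) (ha₁ : a₁ ≠ 0) (ha₂ : a₂ ≠ 0) (ha₃ : a₃ ≠ 0)
    {ι : Type*} (p : ι → Fin 4 × ℕ) (hp : Function.Injective p)
    (hne : ∀ t, gzFun q a₁ a₂ a₃ n e21 e32 v (p t).1 (p t).2 ≠ 0) :
    LinearIndependent ℂ fun t => gzFun q a₁ a₂ a₃ n e21 e32 v (p t).1 (p t).2 := by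
  have hinj := zpow_injective_of_generic C.ne_zero C.generic
  refine linearIndependent_of_joint_eigenvectors ![H₁, H₂, e21 * e12]
    ![fun t => q ^ ((n : ℤ) - 2 * (p t).2 + Signature.shift3 (p t).1),
      fun t => q ^ M * q ^ ((p t).2 : ℤ), fun t => e21e12Eigenvalue q n (p t).1 (p t).2]
    _ (fun a t => ?_) hne (fun s t hst => ?_)
  · fin_cases a
    · exact C.H₁_gzFun hv _ _
    · exact C.H₂_gzFun hv _ _
    · exact C.e21_e12_gzFun hv ha₁ ha₂ ha₃ _ _
  · by_contra! heq
    have h0 := heq 0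
    have h1 := heq 1
    have h2 := heq 2
    simp only [Matrix.cons_val] at h0 h1 h2
    have hM : q ^ M ≠ 0 := by simp [Complex.cpow_eq_zero_iff, C.ne_zero]
    -- The weight of `H₂` gives `i`; then that of `H₁` gives `shift3 k`, which determines `k` except
    -- for confusing `1` with `2`.
    have hi := hinj (mul_left_cancel₀ hM h1)
    have hk := hinj h0
    have hi' : (p s).2 = (p t).2 := by exact_mod_cast hi
    rw [hi'] at hk h2
    have hk' : Signature.shift3 (p s).1 = Signature.shift3 (p t).1 := by omega
    refine hst (hp (Prod.ext ?_ hi'))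
    generalize (p s).1 = k, (p t).1 = l, (p t).2 = i at *
    clear heq h0 h1 hk
    have hE := C.e21e12Eigenvalue_ne (n := n) i
    fin_cases k <;> fin_cases l <;> first
      | rfl
      | exact absurd hk' (by decide)
      | exact absurd h2 hE
      | exact absurd h2.symm hE

end IsChevalleyModule
end GelfandZetlin

/-! ### Patterns, classes of modules and the basis -/

section GelfandZetlin

variable {V : Type*} [AddCommGroup V] [Module ℂ V]
variable {q : ℂ} {Λ : Signature} {S : Finset (Fin 4)}
  {H₁ H₁' H₂ H₂' e12 e21 e23 e32 : Module.End ℂ V} {v : V} {a₁ a₂ a₃ : ℂ}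

namespace Signature

theorem l12_sub_l11 (Λ : Signature) (k : Fin 4) (j : ℤ) : Λ.l12 k - Λ.l11 j = j - shift1 k := by
  simp only [l12, l11]; ring

theorem l11_sub_l22 (Λ : Signature) (k : Fin 4) (j : ℤ) :
    Λ.l11 j - Λ.l22 k = Λ.twoL - j + shift2 k + 1 := by
  simp only [l22, l11, m13]; ring

theorem l11_sub_l23 (Λ : Signature) (j : ℤ) : Λ.l11 j - Λ.l23 = Λ.twoL + 1 - j := by
  simp only [l23, l11, m13]; ring

theorem l13_sub_l11 (Λ : Signature) (j : ℤ) : Λ.l13 - Λ.l11 j = j := by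
  simp only [l13, l11]; ring

theorem l13_add_l33 (Λ : Signature) :
    Λ.l13 + Λ.l33 + 3 = Λ.m23 + Λ.m33 + (Λ.twoL + 1) := by
  simp only [l13, l33, m13]; ring

theorem l23_add_l33 (Λ : Signature) : Λ.l23 + Λ.l33 + 3 = Λ.m23 + Λ.m33 := by
  simp only [l23, l33]; ring

theorem IsPattern.exists_natCast {k : Fin 4} {j : ℤ} (h : Λ.IsPattern k j) :
    ∃ i : ℕ, j = i ∧ shift1 k ≤ i ∧ (i : ℤ) ≤ Λ.twoL + shift2 k := by
  have h1 : 0 ≤ shift1 k := by fin_cases k <;> decide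
  obtain ⟨i, rfl⟩ := Int.eq_ofNat_of_zero_le (show 0 ≤ j by have := h.1; omega)
  exact ⟨i, rfl, by have := h.1; omega, by have := h.2; omega⟩

end Signature

open Signature

/-- The Gel'fand-Zetlin vectors of the subspaces `V_k`, `k ∈ S`. -/
def gzFamily (q a₁ a₂ a₃ : ℂ) (Λ : Signature) (S : Finset (Fin 4)) (e21 e32 : Module.End ℂ V)
    (v : V) (p : Λ.Pattern S) : V :=
  gzFun q a₁ a₂ a₃ Λ.twoL e21 e32 v p.1.1 p.1.2.toNat

theorem gzVec_gzFamily_neg (k : Fin 4) {j : ℤ} (hj : j < 0) :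
    gzVec (gzFamily q a₁ a₂ a₃ Λ S e21 e32 v) k j = 0 := by
  rw [gzVec, dif_neg]
  rintro ⟨-, h⟩
  obtain ⟨i, rfl, -⟩ := h.exists_natCast
  omega

namespace IsChevalleyModule

/-- This realizes the convention that inadmissible vectors are zero, so the string formulas may be
used without regard to their ends. -/
theorem gzFun_eq_zero_of_not_isPattern [FiniteDimensional ℂ V]
    (C : IsChevalleyModule q H₁ H₁' H₂ H₂' e12 e21 e23 e32)
    (hv : IsHighestWeight q Λ.twoL (Λ.m23 + Λ.m33) H₁ H₂ e12 e23 v) {k : Fin 4} {i : ℕ}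
    (h : ¬Λ.IsPattern k i) : gzFun q a₁ a₂ a₃ Λ.twoL e21 e32 v k i = 0 := by
  rw [IsPattern] at h
  match k with
  | 0 =>
    simp only [shift1, shift2, Matrix.cons_val] at h
    exact C.gzFun_zero_eq_zero hv (by omega)
  | 1 =>
    simp only [shift1, shift2, Matrix.cons_val] at h
    exact C.gzFun_one_eq_zero hv (by omega)
  | 2 =>
    simp only [shift1, shift2, Matrix.cons_val] at h
    rcases Nat.eq_zero_or_pos i with rfl | h0
    · exact gzFun_two_zero
    · exact C.gzFun_two_eq_zero hv (by omega)
  | 3 =>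
    simp only [shift1, shift2, Matrix.cons_val] at h
    rcases Nat.eq_zero_or_pos i with rfl | h0
    · exact gzFun_three_zero
    · exact C.gzFun_three_eq_zero hv (by omega)

theorem gzVec_gzFamily [FiniteDimensional ℂ V]
    (C : IsChevalleyModule q H₁ H₁' H₂ H₂' e12 e21 e23 e32)
    (hv : IsHighestWeight q Λ.twoL (Λ.m23 + Λ.m33) H₁ H₂ e12 e23 v)
    (hS : ∀ k ∉ S, ∀ i, gzFun q a₁ a₂ a₃ Λ.twoL e21 e32 v k i = 0) (k : Fin 4) (i : ℕ) :
    gzVec (gzFamily q a₁ a₂ a₃ Λ S e21 e32 v) k i =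
      gzFun q a₁ a₂ a₃ Λ.twoL e21 e32 v k i := by
  rw [gzVec]
  split_ifs with h
  · rfl
  · by_cases hk : k ∈ S
    · exact (C.gzFun_eq_zero_of_not_isPattern hv fun h' => h ⟨hk, h'⟩).symm
    · exact (hS k hk i).symm

theorem chevalleyAction [FiniteDimensional ℂ V]
    (C : IsChevalleyModule q H₁ H₁' H₂ H₂' e12 e21 e23 e32)
    (hv : IsHighestWeight q Λ.twoL (Λ.m23 + Λ.m33) H₁ H₂ e12 e23 v)
    (ha₁ : a₁ ≠ 0) (ha₂ : a₂ ≠ 0) (ha₃ : a₃ ≠ 0)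
    (hS : ∀ k ∉ S, ∀ i, gzFun q a₁ a₂ a₃ Λ.twoL e21 e32 v k i = 0) :
    ChevalleyAction q a₁ a₂ a₃ Λ S (gzFamily q a₁ a₂ a₃ Λ S e21 e32 v) e12 e21 e23 e32 := by
  have hg := C.gzVec_gzFamily hv hS
  constructor
  · intro k _ j hj
    obtain ⟨i, rfl, h1, h2⟩ := hj.exists_natCast
    rw [l12_sub_l11, l11_sub_l22, hg]
    rcases Nat.eq_zero_or_pos i with rfl | hi
    · rw [gzVec_gzFamily_neg k (by simp), smul_zero]
      fin_cases k
      · exact e12_gzFun_zero_zero hv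
      · exact C.e12_gzFun_one_zero hv
      · simp [shift1] at h1
      · simp [shift1] at h1
    obtain ⟨i, rfl⟩ := Nat.exists_eq_succ_of_ne_zero hi.ne'
    rw [show ((i.succ : ℕ) : ℤ) - 1 = i by push_cast; ring, hg]
    match k with
    | 0 =>
      simp only [shift1, shift2, Matrix.cons_val] at h1 h2 ⊢
      rw [C.e12_gzFun_zero_succ hv (by omega)]
      congr 3 <;> push_cast <;> ring
    | 1 =>
      simp only [shift1, shift2, Matrix.cons_val] at h1 h2 ⊢
      rw [C.e12_gzFun_one_succ hv (by omega)]
      congr 3 <;> push_cast <;> ring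
    | 2 =>
      simp only [shift1, shift2, Matrix.cons_val] at h1 h2 ⊢
      rw [C.e12_gzFun_two_succ hv ha₁ ha₂ (by omega)]
      congr 3 <;> push_cast <;> ring
    | 3 =>
      simp only [shift1, shift2, Matrix.cons_val] at h1 h2 ⊢
      rw [C.e12_gzFun_three_succ hv ha₁ ha₃ (by omega)]
      congr 3 <;> push_cast <;> ring
  · intro k _ j hj
    obtain ⟨i, rfl, h1, h2⟩ := hj.exists_natCast
    rw [l12_sub_l11, l11_sub_l22, hg, show ((i : ℕ) : ℤ) + 1 = (i + 1 : ℕ) by push_cast; ring, hg]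
    match k with
    | 0 =>
      simp only [shift1, shift2, Matrix.cons_val] at h1 h2 ⊢
      rw [C.e21_gzFun_zero hv (by omega)]
      congr 3 <;> push_cast <;> ring
    | 1 =>
      simp only [shift1, shift2, Matrix.cons_val] at h1 h2 ⊢
      rw [C.e21_gzFun_one hv (by omega)]
      congr 3 <;> push_cast <;> ring
    | 2 =>
      simp only [shift1, shift2, Matrix.cons_val] at h1 h2 ⊢
      rw [C.e21_gzFun_two hv (by omega) (by omega)]
      congr 3 <;> push_cast <;> ring
    | 3 =>
      simp only [shift1, shift2, Matrix.cons_val] at h1 h2 ⊢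
      rw [C.e21_gzFun_three hv (by omega) (by omega)]
      congr 3 <;> push_cast <;> ring
  all_goals
    intro _ j hj
    obtain ⟨i, rfl, h1, h2⟩ := hj.exists_natCast
    simp only [shift1, shift2, Matrix.cons_val] at h1 h2
    simp only [hg, l11_sub_l23, l13_sub_l11, l13_add_l33, l23_add_l33, Int.cast_natCast]
  · exact C.e23_gzFun_zero hv i
  · exact C.e23_gzFun_one hv (by omega)
  · exact C.e23_gzFun_two hv ha₁ ha₂ (by omega) (by omega)
  · exact C.e23_gzFun_three hv ha₁ ha₂ ha₃ (by omega) (by omega)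
  · exact C.e32_gzFun_zero ha₁ ha₂ (by omega)
  · exact C.e32_gzFun_one ha₃ i
  · exact C.e32_gzFun_two ha₁ ha₂ ha₃ (by omega) (by omega)
  · exact C.e32_gzFun_three i

theorem gzFun_eq_zero_of_gzSpan [FiniteDimensional ℂ V]
    (C : IsChevalleyModule q H₁ H₁' H₂ H₂' e12 e21 e23 e32) {n : ℕ} {M : ℂ}
    (hv : IsHighestWeight q n M H₁ H₂ e12 e23 v) (hv0 : v ≠ 0) {s : Set (Fin 4)} (hs : 0 ∉ s)
    (h : gzSpan q a₁ a₂ a₃ n e21 e32 v s = ⊥ ∨ gzSpan q a₁ a₂ a₃ n e21 e32 v s = ⊤)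
    {k : Fin 4} (hk : k ∈ s) (i : ℕ) : gzFun q a₁ a₂ a₃ n e21 e32 v k i = 0 := by
  have h' := h.resolve_right (C.gzSpan_ne_top hv hv0 hs)
  have := gzFun_mem_gzSpan (q := q) (a₁ := a₁) (a₂ := a₂) (a₃ := a₃) (n := n) (e21 := e21)
    (e32 := e32) (v := v) hk i
  rwa [h', Submodule.mem_bot] at this

/-- The signature and the subspaces of the module generated by a highest weight vector. -/
theorem exists_isClass [FiniteDimensional ℂ V]
    (C : IsChevalleyModule q H₁ H₁' H₂ H₂' e12 e21 e23 e32)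
    (hv : IsHighestWeight q Λ.twoL (Λ.m23 + Λ.m33) H₁ H₂ e12 e23 v) (hv0 : v ≠ 0)
    (ha₁ : a₁ ≠ 0) (ha₂ : a₂ ≠ 0) (ha₃ : a₃ ≠ 0)
    (irr : ∀ s, (∀ x ∈ gzSpan q a₁ a₂ a₃ Λ.twoL e21 e32 v s,
        e12 x ∈ gzSpan q a₁ a₂ a₃ Λ.twoL e21 e32 v s ∧
        e21 x ∈ gzSpan q a₁ a₂ a₃ Λ.twoL e21 e32 v s ∧
        e23 x ∈ gzSpan q a₁ a₂ a₃ Λ.twoL e21 e32 v s ∧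
        e32 x ∈ gzSpan q a₁ a₂ a₃ Λ.twoL e21 e32 v s) →
      gzSpan q a₁ a₂ a₃ Λ.twoL e21 e32 v s = ⊥ ∨ gzSpan q a₁ a₂ a₃ Λ.twoL e21 e32 v s = ⊤) :
    gzSpan q a₁ a₂ a₃ Λ.twoL e21 e32 v Set.univ = ⊤ ∧ ∃ S, IsClass q Λ S ∧
      (∀ k ∉ S, ∀ i, gzFun q a₁ a₂ a₃ Λ.twoL e21 e32 v k i = 0) ∧
      (∀ k ∈ S, ∀ i : ℕ, Λ.IsPattern k i → gzFun q a₁ a₂ a₃ Λ.twoL e21 e32 v k i ≠ 0) := by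
  have irr' : ∀ s : Set (Fin 4), (0 ∈ s → 1 ∈ s ∧ 2 ∈ s) → 3 ∈ s →
      (1 ∈ s → 0 ∈ s ∨ qNum q (Λ.m23 + Λ.m33) = 0) →
      (2 ∈ s → 0 ∈ s ∨ qNum q (Λ.m23 + Λ.m33 + (Λ.twoL + 1)) = 0) →
      (3 ∈ s → (1 ∈ s ∨ qNum q (Λ.m23 + Λ.m33 + (Λ.twoL + 1)) = 0) ∧
        (2 ∈ s ∨ qNum q (Λ.m23 + Λ.m33) = 0)) →
      gzSpan q a₁ a₂ a₃ Λ.twoL e21 e32 v s = ⊥ ∨ gzSpan q a₁ a₂ a₃ Λ.twoL e21 e32 v s = ⊤ :=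
    fun s h0 h3 h1 h2 h4 => irr s fun x hx =>
      ⟨apply_mem_gzSpan (C.e12_gzFun_mem hv ha₁ ha₂ ha₃) hx,
        apply_mem_gzSpan (C.e21_gzFun_mem hv) hx,
        apply_mem_gzSpan (C.e23_gzFun_mem hv ha₁ ha₂ ha₃ h1 h2 h4) hx,
        apply_mem_gzSpan (C.e32_gzFun_mem hv ha₁ ha₂ ha₃ h0 h3) hx⟩
  refine ⟨(irr' Set.univ (by simp) (by simp) (by simp) (by simp) (by simp)).resolve_left ?_, ?_⟩
  · intro h
    have := gzFun_mem_gzSpan (q := q) (a₁ := a₁) (a₂ := a₂) (a₃ := a₃) (n := Λ.twoL) (e21 := e21)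
      (e32 := e32) (v := v) (Set.mem_univ 0) 0
    rw [h, Submodule.mem_bot] at this
    exact C.gzFun_zero_ne_zero hv hv0 (Nat.zero_le _) this
  have n0 : ∀ i : ℕ, Λ.IsPattern 0 i → gzFun q a₁ a₂ a₃ Λ.twoL e21 e32 v 0 i ≠ 0 := by
    intro i hi
    have := hi.2
    simp only [shift2, Matrix.cons_val] at this
    exact C.gzFun_zero_ne_zero hv hv0 (by omega)
  have n1 : qNum q (Λ.m23 + Λ.m33) ≠ 0 →
      ∀ i : ℕ, Λ.IsPattern 1 i → gzFun q a₁ a₂ a₃ Λ.twoL e21 e32 v 1 i ≠ 0 := by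
    intro h i hi
    have := hi.2
    simp only [shift2, Matrix.cons_val] at this
    exact C.gzFun_one_ne_zero hv hv0 ha₁ h (by omega)
  have n2 : qNum q (Λ.m23 + Λ.m33 + (Λ.twoL + 1)) ≠ 0 →
      ∀ i : ℕ, Λ.IsPattern 2 i → gzFun q a₁ a₂ a₃ Λ.twoL e21 e32 v 2 i ≠ 0 := by
    rintro h i ⟨h1, h2⟩
    simp only [shift1, shift2, Matrix.cons_val] at h1 h2
    exact C.gzFun_two_ne_zero hv hv0 ha₁ ha₂ h (by omega) (by omega)
  by_cases hM : qNum q (Λ.m23 + Λ.m33) = 0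
  -- With `[M] = 0` the bracket identity gives `[M+n+1] = [n+1][M+1]`, and `[M+1] = q[M] + q^{-M} =
  -- q^{-M} ≠ 0`.
  · have hM' : qNum q (Λ.m23 + Λ.m33 + (Λ.twoL + 1)) ≠ 0 := by
      have h := qNum_mul_sub C.ne_zero (Λ.m23 + Λ.m33) (Λ.twoL + 1) 1
      rw [hM, mul_zero, sub_zero, qNum_one C.ne_zero C.generic, mul_one] at h
      rw [h]
      refine mul_ne_zero (C.qNum_succ_ne_zero _) fun h1 => ?_
      have h2 := qNum_add_one C.ne_zero C.generic (Λ.m23 + Λ.m33)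
      rw [h1, hM, mul_zero, zero_add, eq_comm, Complex.cpow_eq_zero_iff] at h2
      exact C.ne_zero h2.1
    -- Both arrows leaving `V₁ + V₃` carry the factor `[M] = 0`.
    have hz : ∀ k ∈ ({1, 3} : Set (Fin 4)), ∀ i, gzFun q a₁ a₂ a₃ Λ.twoL e21 e32 v k i = 0 :=
      fun k hk i => C.gzFun_eq_zero_of_gzSpan hv hv0 (by simp)
        (irr' {1, 3} (by simp) (by simp) (by simp [hM]) (by simp) (by simp [hM])) hk i
    refine ⟨{0, 2}, .class2 ?_ ?_, fun k hk => hz k ?_, fun k hk => ?_⟩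
    · rwa [l13_add_l33]
    · rwa [l23_add_l33]
    · revert k; decide
    · simp only [Finset.mem_insert, Finset.mem_singleton] at hk
      rcases hk with rfl | rfl
      exacts [n0, n2 hM']
  by_cases hM' : qNum q (Λ.m23 + Λ.m33 + (Λ.twoL + 1)) = 0
  · have hz : ∀ k ∈ ({2, 3} : Set (Fin 4)), ∀ i, gzFun q a₁ a₂ a₃ Λ.twoL e21 e32 v k i = 0 :=
      fun k hk i => C.gzFun_eq_zero_of_gzSpan hv hv0 (by simp)
        (irr' {2, 3} (by simp) (by simp) (by simp) (by simp [hM']) (by simp [hM'])) hk i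
    refine ⟨{0, 1}, .class1 ?_ ?_, fun k hk => hz k ?_, fun k hk => ?_⟩
    · rwa [l13_add_l33]
    · rwa [l23_add_l33]
    · revert k; decide
    · simp only [Finset.mem_insert, Finset.mem_singleton] at hk
      rcases hk with rfl | rfl
      exacts [n0, n1 hM]
  · refine ⟨{0, 1, 2, 3}, .typical ?_, fun k hk => absurd ?_ hk, fun k _ => ?_⟩
    · rw [l13_add_l33, l23_add_l33]
      exact mul_ne_zero hM' hM
    · clear hk; revert k; decide
    · match k with
      | 0 => exact n0
      | 1 => exact n1 hM
      | 2 => exact n2 hM'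
      | 3 =>
        rintro i ⟨h1, h2⟩
        simp only [shift1, shift2, Matrix.cons_val] at h1 h2
        exact C.gzFun_three_ne_zero hv hv0 ha₁ ha₂ ha₃ hM hM' (by omega) (by omega)

/-- The Gel'fand-Zetlin basis of an irreducible module with a highest weight vector. -/
theorem exists_basis [FiniteDimensional ℂ V]
    (C : IsChevalleyModule q H₁ H₁' H₂ H₂' e12 e21 e23 e32)
    (hv : IsHighestWeight q Λ.twoL (Λ.m23 + Λ.m33) H₁ H₂ e12 e23 v) (hv0 : v ≠ 0)
    (ha₁ : a₁ ≠ 0) (ha₂ : a₂ ≠ 0) (ha₃ : a₃ ≠ 0)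
    (irr : ∀ s, (∀ x ∈ gzSpan q a₁ a₂ a₃ Λ.twoL e21 e32 v s,
        e12 x ∈ gzSpan q a₁ a₂ a₃ Λ.twoL e21 e32 v s ∧
        e21 x ∈ gzSpan q a₁ a₂ a₃ Λ.twoL e21 e32 v s ∧
        e23 x ∈ gzSpan q a₁ a₂ a₃ Λ.twoL e21 e32 v s ∧
        e32 x ∈ gzSpan q a₁ a₂ a₃ Λ.twoL e21 e32 v s) →
      gzSpan q a₁ a₂ a₃ Λ.twoL e21 e32 v s = ⊥ ∨ gzSpan q a₁ a₂ a₃ Λ.twoL e21 e32 v s = ⊤) :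
    ∃ (S : Finset (Fin 4)) (b : Module.Basis (Λ.Pattern S) ℂ V), IsClass q Λ S ∧
      ChevalleyAction q a₁ a₂ a₃ Λ S b e12 e21 e23 e32 ∧
      ∀ k, ∀ i : ℕ, gzVec b k i = gzFun q a₁ a₂ a₃ Λ.twoL e21 e32 v k i := by
  obtain ⟨htop, S, hcl, hz, hne⟩ := C.exists_isClass hv hv0 ha₁ ha₂ ha₃ irr
  have hnat : ∀ t : Λ.Pattern S, ((t.1.2.toNat : ℕ) : ℤ) = t.1.2 := fun t => by
    obtain ⟨i, hi, -⟩ := t.2.2.exists_natCast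
    rw [hi, Int.toNat_natCast]
  have hli : LinearIndependent ℂ (gzFamily q a₁ a₂ a₃ Λ S e21 e32 v) := by
    refine C.linearIndependent_gzFun hv ha₁ ha₂ ha₃
      (fun t : Λ.Pattern S => (t.1.1, t.1.2.toNat)) (fun s t hst => ?_) (fun t => ?_)
    · rw [Prod.mk.injEq] at hst
      exact Subtype.ext (Prod.ext hst.1 (by rw [← hnat s, ← hnat t, hst.2]))
    · exact hne _ t.2.1 _ ((hnat t).symm ▸ t.2.2)
  have hspan : ⊤ ≤ Submodule.span ℂ (Set.range (gzFamily q a₁ a₂ a₃ Λ S e21 e32 v)) := by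
    rw [← htop, gzSpan, Submodule.span_le]
    rintro _ ⟨k, -, i, rfl⟩
    by_cases h : k ∈ S ∧ Λ.IsPattern k i
    · exact Submodule.subset_span ⟨⟨(k, i), h⟩, rfl⟩
    · have h0 : gzFun q a₁ a₂ a₃ Λ.twoL e21 e32 v k i = 0 := by
        by_cases hk : k ∈ S
        · exact C.gzFun_eq_zero_of_not_isPattern hv fun h' => h ⟨hk, h'⟩
        · exact hz k hk i
      rw [h0]
      exact zero_mem _
  refine ⟨S, Module.Basis.mk hli hspan, hcl, ?_, ?_⟩
  · rw [Module.Basis.coe_mk]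
    exact C.chevalleyAction hv ha₁ ha₂ ha₃ hz
  · rw [Module.Basis.coe_mk]
    exact C.gzVec_gzFamily hv hz

end IsChevalleyModule
end GelfandZetlin

/-! ### Existence of a highest weight vector -/

section ExistenceOfHighestWeight

variable {V : Type*} [AddCommGroup V] [Module ℂ V]

/-- If the spectrum were stable under multiplication by `q`, it would contain all `q^i μ`. These are
distinct because `μ ≠ 0` by injectivity, but the spectrum is finite. -/
theorem exists_hasEigenvalue_not_mul [FiniteDimensional ℂ V] [Nontrivial V] {q : ℂ} (hq0 : q ≠ 0)
    (hq : ∀ N : ℕ, 0 < N → q ^ N ≠ 1) {T : Module.End ℂ V} (hT : Function.Injective T) :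
    ∃ μ, T.HasEigenvalue μ ∧ ¬T.HasEigenvalue (q * μ) := by
  by_contra! h
  obtain ⟨μ, hμ⟩ := Module.End.exists_eigenvalue T
  have hμ0 : μ ≠ 0 := by
    rintro rfl
    obtain ⟨x, hx⟩ := hμ.exists_hasEigenvector
    refine hx.2 (hT ?_)
    rw [hx.apply_eq_smul, zero_smul, map_zero]
  have hall : ∀ i : ℕ, T.HasEigenvalue (q ^ i * μ) := by
    intro i
    induction i with
    | zero => simpa using hμ
    | succ i ih => simpa [pow_succ', mul_assoc] using h _ ih
  have hinj : Function.Injective fun i : ℕ => q ^ i * μ := by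
    intro i j hij
    have : q ^ (i : ℤ) = q ^ (j : ℤ) := by simpa using mul_right_cancel₀ hμ0 hij
    exact_mod_cast zpow_injective_of_generic hq0 hq this
  refine Set.infinite_range_of_injective hinj ((Module.End.finite_hasEigenvalue T).subset ?_)
  rintro _ ⟨i, rfl⟩
  exact hall i

theorem exists_common_eigenvector [FiniteDimensional ℂ V] (L : List (Module.End ℂ V))
    (hL : ∀ f ∈ L, ∀ g ∈ L, ∀ x, f (g x) = g (f x)) (p : Submodule ℂ V) (hp : p ≠ ⊥)
    (hpL : ∀ f ∈ L, ∀ x ∈ p, f x ∈ p) :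
    ∃ v ∈ p, v ≠ 0 ∧ ∀ f ∈ L, ∃ κ : ℂ, f v = κ • v := by
  induction L generalizing p with
  | nil =>
    obtain ⟨v, hv, hv0⟩ := p.exists_mem_ne_zero_of_ne_bot hp
    exact ⟨v, hv, hv0, by simp⟩
  | cons f L ih =>
    have : Nontrivial p := Submodule.nontrivial_iff_ne_bot.2 hp
    obtain ⟨μ, hμ⟩ := Module.End.exists_eigenvalue (f.restrict (hpL f (by simp)))
    obtain ⟨x, hx⟩ := hμ.exists_hasEigenvector
    have hfx : f x = μ • (x : V) := congrArg Subtype.val hx.apply_eq_smul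
    obtain ⟨v, hv, hv0, hvL⟩ := ih (fun g hg h hh => hL g (by simp [hg]) h (by simp [hh]))
      (p ⊓ f.eigenspace μ)
      (fun h => hx.2 (Subtype.ext ((Submodule.mem_bot ℂ).1
        (h ▸ ⟨x.2, Module.End.mem_eigenspace_iff.2 hfx⟩))))
      (fun g hg y hy => ⟨hpL g (by simp [hg]) y hy.1, by
        have h1 := Module.End.mem_eigenspace_iff.1 hy.2
        rw [SetLike.mem_coe, Module.End.mem_eigenspace_iff, hL f (by simp) g (by simp [hg]), h1,
          map_smul]⟩)
    refine ⟨v, hv.1, hv0, fun g hg => ?_⟩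
    rcases List.mem_cons.1 hg with rfl | hg
    · exact ⟨μ, Module.End.mem_eigenspace_iff.1 hv.2⟩
    · exact hvL g hg

/-- A joint eigenvector of commuting operators that is annihilated by two raising operators. -/
theorem exists_highest_vector [FiniteDimensional ℂ V] [Nontrivial V] {q : ℂ} (hq0 : q ≠ 0)
    (hq : ∀ N : ℕ, 0 < N → q ^ N ≠ 1) {T A B : Module.End ℂ V} (hT : Function.Injective T)
    (hA : ∀ x, T (A x) = q • A (T x)) (hB : ∀ x, T (B x) = q • B (T x))
    (L : List (Module.End ℂ V)) (hL : ∀ f ∈ L, ∀ g ∈ L, ∀ x, f (g x) = g (f x))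
    (hLT : ∀ f ∈ L, ∀ x, T (f x) = f (T x)) :
    ∃ v, v ≠ 0 ∧ A v = 0 ∧ B v = 0 ∧ ∀ f ∈ L, ∃ κ : ℂ, f v = κ • v := by
  obtain ⟨μ, hμ, hμ'⟩ := exists_hasEigenvalue_not_mul hq0 hq hT
  obtain ⟨v, hv, hv0, hvL⟩ := exists_common_eigenvector L hL (T.eigenspace μ) hμ
    (fun f hf x hx => by
      rw [Module.End.mem_eigenspace_iff] at hx ⊢
      rw [hLT f hf, hx, map_smul])
  have key : ∀ A : Module.End ℂ V, (∀ x, T (A x) = q • A (T x)) → A v = 0 := by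
    intro A hA
    by_contra h0
    refine hμ' (Module.End.hasEigenvalue_of_hasEigenvector (x := A v)
      ⟨Module.End.mem_eigenspace_iff.2 ?_, h0⟩)
    rw [hA, Module.End.mem_eigenspace_iff.1 hv, map_smul, smul_smul]
  exact ⟨v, hv0, key A hA, key B hB, hvL⟩

end ExistenceOfHighestWeight

/-! ## The operators of a representation -/

section Representations

variable {V : Type*} [AddCommGroup V] [Module ℂ V]

theorem apply_of_conj {K K' E : Module.End ℂ V} {c : ℂ} (h : K * E * K' = c • E)
    (hK : K' * K = 1) (x : V) : K (E x) = c • E (K x) := by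
  have h1 := LinearMap.congr_fun h (K x)
  have h2 := LinearMap.congr_fun hK x
  simp only [Module.End.mul_apply, LinearMap.smul_apply, Module.End.one_apply] at h1 h2
  rw [← h1, h2]

theorem inv_apply_of_apply {K K' E : Module.End ℂ V} {c : ℂ} (h : ∀ x, K (E x) = c • E (K x))
    (hc : c ≠ 0) (hK : K' * K = 1) (hK' : K * K' = 1) (x : V) : K' (E x) = c⁻¹ • E (K' x) := by
  have h1 := LinearMap.congr_fun hK (E (K' x))
  have h2 := LinearMap.congr_fun hK' x
  simp only [Module.End.mul_apply, Module.End.one_apply] at h1 h2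
  rw [← h1, h, map_smul, inv_smul_smul₀ hc, h2]

theorem inv_apply_of_eigenvector {K K' : Module.End ℂ V} (hK : K' * K = 1) {v : V} (hv0 : v ≠ 0)
    {κ : ℂ} (hv : K v = κ • v) : κ ≠ 0 ∧ K' v = κ⁻¹ • v := by
  have h := LinearMap.congr_fun hK v
  rw [Module.End.mul_apply, hv, map_smul, Module.End.one_apply] at h
  have hκ : κ ≠ 0 := by
    rintro rfl
    rw [zero_smul] at h
    exact hv0 h.symm
  exact ⟨hκ, by rw [← h, inv_smul_smul₀ hκ, h]⟩

/-- Each relation between images is the image of a relation, so the defining relations in the free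
algebra pass to the operators of a representation. -/
theorem ChevalleyRel.exists_of_map {A B : Type*} [Ring A] [Algebra ℂ A] [Ring B] [Algebra ℂ B]
    (φ : A →ₐ[ℂ] B) {q : ℂ} {H₁ H₁' H₂ H₂' e12 e21 e23 e32 : A} {x y : B}
    (h : ChevalleyRel q (φ H₁) (φ H₁') (φ H₂) (φ H₂') (φ e12) (φ e21) (φ e23) (φ e32) x y) :
    ∃ x' y', ChevalleyRel q H₁ H₁' H₂ H₂' e12 e21 e23 e32 x' y' ∧ φ x' = x ∧ φ y' = y := by
  cases h with
  | e12_e32 => exact ⟨_, _, .e12_e32, by simp, by simp⟩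
  | e21_e23 => exact ⟨_, _, .e21_e23, by simp, by simp⟩
  | e12_e21 => exact ⟨_, _, .e12_e21, by simp, by simp⟩
  | e23_e32 => exact ⟨_, _, .e23_e32, by simp, by simp⟩
  | e23_sq => exact ⟨_, _, .e23_sq, by simp, by simp⟩
  | e32_sq => exact ⟨_, _, .e32_sq, by simp, by simp⟩
  | serre_e => exact ⟨_, _, .serre_e, by simp, by simp⟩
  | serre_f => exact ⟨_, _, .serre_f, by simp, by simp⟩

theorem IsChevalleyModule.of_rel {q : ℂ} (hq0 : q ≠ 0) (hq : ∀ N : ℕ, 0 < N → q ^ N ≠ 1)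
    {H₁ H₁' H₂ H₂' e12 e21 e23 e32 : Module.End ℂ V}
    (hrel : ∀ x y, ChevalleyRel q H₁ H₁' H₂ H₂' e12 e21 e23 e32 x y → x = y)
    (inv₁ : H₁' * H₁ = 1) (inv₂ : H₂' * H₂ = 1)
    (H₁_e21 : ∀ x, H₁ (e21 x) = q ^ (-2 : ℤ) • e21 (H₁ x))
    (H₁_e32 : ∀ x, H₁ (e32 x) = q ^ (1 : ℤ) • e32 (H₁ x))
    (H₂_e21 : ∀ x, H₂ (e21 x) = q ^ (1 : ℤ) • e21 (H₂ x))
    (H₂_e32 : ∀ x, H₂ (e32 x) = q ^ (0 : ℤ) • e32 (H₂ x)) :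
    IsChevalleyModule q H₁ H₁' H₂ H₂' e12 e21 e23 e32 where
  ne_zero := hq0
  generic := hq
  inv₁ := LinearMap.congr_fun inv₁
  inv₂ := LinearMap.congr_fun inv₂
  H₁_e21 := H₁_e21
  H₁_e32 x := by simpa using H₁_e32 x
  H₂_e21 x := by simpa using H₂_e21 x
  H₂_e32 x := by simpa using H₂_e32 x
  e12_e32 := LinearMap.congr_fun (hrel _ _ .e12_e32)
  e23_e21 x := (LinearMap.congr_fun (hrel _ _ .e21_e23) x).symm
  e12_e21 x := by
    have := LinearMap.congr_fun (hrel _ _ .e12_e21) x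
    simp only [Module.End.mul_apply, LinearMap.sub_apply, LinearMap.smul_apply] at this
    rw [← this]
    abel
  e23_e32 x := by
    have := LinearMap.congr_fun (hrel _ _ .e23_e32) x
    simp only [Module.End.mul_apply, LinearMap.sub_apply, LinearMap.add_apply,
      LinearMap.smul_apply] at this
    rw [← this]
    abel
  e32_e32 := LinearMap.congr_fun (hrel _ _ .e32_sq)
  serre x := by
    have := LinearMap.congr_fun (hrel _ _ .serre_f) x
    simp only [Module.End.mul_apply, LinearMap.sub_apply, LinearMap.neg_apply,
      LinearMap.smul_apply, map_neg, map_sub, map_smul] at this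
    -- Expanding `E₂₁E₃₁ = q E₃₁E₂₁` leaves only the symmetric cubic Serre relation.
    simp only [smul_neg, smul_sub, smul_smul, mul_inv_cancel₀ hq0, one_smul] at this
    linear_combination (norm := module) this

end Representations

section Representations

variable {V : Type*} [AddCommGroup V] [Module ℂ V]

theorem apply_gzFun_cpow {q : ℂ} (hq0 : q ≠ 0) {n : ℕ} {a₁ a₂ a₃ : ℂ}
    {K e21 e32 : Module.End ℂ V} {v : V} {m : ℂ} {f x : ℤ}
    (hf : ∀ y, K (e21 y) = q ^ f • e21 (K y)) (hx : ∀ y, K (e32 y) = q ^ x • e32 (K y))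
    (hm : K v = q ^ m • v) (k : Fin 4) (i : ℕ) :
    K (gzFun q a₁ a₂ a₃ n e21 e32 v k i) =
      q ^ (m + f * i + x * Signature.shift3 k) • gzFun q a₁ a₂ a₃ n e21 e32 v k i := by
  rw [apply_gzFun hf hx hm, Complex.cpow_add _ _ hq0, Complex.cpow_add _ _ hq0,
    ← Int.cast_natCast (R := ℂ) i, ← Int.cast_mul, ← Int.cast_mul, Complex.cpow_intCast,
    Complex.cpow_intCast, zpow_mul, zpow_mul, zpow_natCast]

theorem shift1_add_shift2 (k : Fin 4) :
    Signature.shift1 k + Signature.shift2 k = Signature.shift3 k := by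
  fin_cases k <;> rfl

theorem cpow_eq_or_eq_neg {q : ℂ} (hq0 : q ≠ 0) {N : ℂ} {n : ℕ} (h : (q ^ (N - n)) ^ 2 = 1) :
    q ^ N = q ^ n ∨ q ^ N = -q ^ n := by
  have hn : q ^ n ≠ 0 := pow_ne_zero _ hq0
  rw [Complex.cpow_sub _ _ hq0, Complex.cpow_natCast, sq_eq_one_iff, div_eq_iff hn,
    div_eq_iff hn, one_mul, neg_one_mul] at h
  exact h

/-- `-q ^ n` is not an integral power of `q`. -/
theorem neg_pow_ne_zpow {q : ℂ} (hq0 : q ≠ 0) (hq : ∀ N : ℕ, 0 < N → q ^ N ≠ 1) (n : ℕ) (z : ℤ) :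
    -q ^ n ≠ q ^ z := by
  intro h
  have h2 : q ^ (2 * (n : ℤ)) = q ^ (2 * z) := by
    rw [mul_comm, zpow_mul, zpow_natCast, mul_comm, zpow_mul, ← h]
    simp [zpow_ofNat]
  have := zpow_injective_of_generic hq0 hq h2
  obtain rfl : z = n := by omega
  rw [zpow_natCast, neg_eq_iff_add_eq_zero, ← two_mul] at h
  exact mul_ne_zero two_ne_zero (pow_ne_zero n hq0) h

/-- A highest weight vector in a module over `U_q[sl(2/1)]`: its `q^{h₁}`-weight is `± q^n`. -/
theorem IsChevalleyModule.exists_eq_or_eq_neg [FiniteDimensional ℂ V] {q : ℂ}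
    {H₁ H₁' H₂ H₂' e12 e21 e23 e32 : Module.End ℂ V}
    (C : IsChevalleyModule q H₁ H₁' H₂ H₂' e12 e21 e23 e32) {v : V} (hv0 : v ≠ 0)
    (hv : e12 v = 0) {κ : ℂ} (hκ : H₁ v = κ • v) : ∃ n : ℕ, κ = q ^ n ∨ κ = -q ^ n := by
  have hκ0 : κ ≠ 0 := by
    rintro rfl
    have := C.inv₁ v
    rw [hκ, zero_smul, map_zero] at this
    exact hv0 this.symm
  obtain ⟨N, rfl⟩ := exists_cpow_eq C.ne_zero C.generic hκ0
  obtain ⟨n, -, hn⟩ := C.exists_weight hκ hv hv0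
  exact ⟨n, cpow_eq_or_eq_neg C.ne_zero hn⟩

end Representations

/-! ## `U_q[gl(2/1)]` -/

section GeneralLinear

variable {V : Type*} [AddCommGroup V] [Module ℂ V] {q : ℂ}

theorem UqGL.map_rel (ρ : UqGL q →ₐ[ℂ] Module.End ℂ V) {x y : FreeAlgebra ℂ GLGen}
    (h : GLRel q x y) : FreeAlgebra.lift ℂ (fun s => ρ (UqGL.gen q s)) x =
      FreeAlgebra.lift ℂ (fun s => ρ (UqGL.gen q s)) y := by
  have e : FreeAlgebra.lift ℂ (fun s => ρ (UqGL.gen q s)) =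
      ρ.comp (FreeAlgebra.lift ℂ (UqGL.gen q)) := by
    ext s; simp
  rw [e, AlgHom.comp_apply, AlgHom.comp_apply, UqGL.rel q h]

theorem UqGL.forall_mem (ρ : UqGL q →ₐ[ℂ] Module.End ℂ V) {p : Submodule ℂ V}
    (hp : ∀ s, ∀ v ∈ p, ρ (UqGL.gen q s) v ∈ p) (x : UqGL q) : ∀ v ∈ p, ρ x v ∈ p := by
  obtain ⟨y, rfl⟩ : ∃ y, UqGL.mk q y = x := RingQuot.mkAlgHom_surjective ℂ (GLRel q) x
  induction y using FreeAlgebra.induction with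
  | grade0 c =>
    intro v hv
    rw [AlgHom.commutes, AlgHom.commutes, Module.algebraMap_end_apply]
    exact p.smul_mem c hv
  | grade1 s => exact hp s
  | mul a b iha ihb =>
    intro v hv
    rw [map_mul, map_mul, Module.End.mul_apply]
    exact iha _ (ihb v hv)
  | add a b iha ihb =>
    intro v hv
    rw [map_add, map_add, LinearMap.add_apply]
    exact p.add_mem (iha v hv) (ihb v hv)

section Relations

variable (ρ : UqGL q →ₐ[ℂ] Module.End ℂ V)

theorem gl_K_mul_Kinv (i : Fin 3) : ρ (UqGL.gen q (.K i)) * ρ (UqGL.gen q (.Kinv i)) = 1 := by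
  simpa using UqGL.map_rel ρ (.K_Kinv i)

theorem gl_Kinv_mul_K (i : Fin 3) : ρ (UqGL.gen q (.Kinv i)) * ρ (UqGL.gen q (.K i)) = 1 := by
  simpa using UqGL.map_rel ρ (.Kinv_K i)

theorem gl_K_K (i j : Fin 3) (x : V) : ρ (UqGL.gen q (.K i)) (ρ (UqGL.gen q (.K j)) x) =
    ρ (UqGL.gen q (.K j)) (ρ (UqGL.gen q (.K i)) x) := by
  simpa using LinearMap.congr_fun (UqGL.map_rel ρ (.K_K i j)) x

theorem gl_Kinv_K (i j : Fin 3) (x : V) :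
    ρ (UqGL.gen q (.Kinv i)) (ρ (UqGL.gen q (.K j)) x) =
    ρ (UqGL.gen q (.K j)) (ρ (UqGL.gen q (.Kinv i)) x) := by
  simpa using inv_apply_of_apply (c := 1) (fun x => by rw [gl_K_K, one_smul]) one_ne_zero
    (gl_Kinv_mul_K ρ i) (gl_K_mul_Kinv ρ i) x

theorem gl_K_E12 (i : Fin 3) (x : V) : ρ (UqGL.gen q (.K i)) (ρ (UqGL.gen q .E12) x) =
    q ^ glWt12 i • ρ (UqGL.gen q .E12) (ρ (UqGL.gen q (.K i)) x) :=
  apply_of_conj (by simpa using UqGL.map_rel ρ (.K_E12 i)) (gl_Kinv_mul_K ρ i) x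

theorem gl_K_E21 (i : Fin 3) (x : V) : ρ (UqGL.gen q (.K i)) (ρ (UqGL.gen q .E21) x) =
    q ^ (-glWt12 i) • ρ (UqGL.gen q .E21) (ρ (UqGL.gen q (.K i)) x) :=
  apply_of_conj (by simpa using UqGL.map_rel ρ (.K_E21 i)) (gl_Kinv_mul_K ρ i) x

theorem gl_K_E23 (i : Fin 3) (x : V) : ρ (UqGL.gen q (.K i)) (ρ (UqGL.gen q .E23) x) =
    q ^ glWt23 i • ρ (UqGL.gen q .E23) (ρ (UqGL.gen q (.K i)) x) :=
  apply_of_conj (by simpa using UqGL.map_rel ρ (.K_E23 i)) (gl_Kinv_mul_K ρ i) x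

theorem gl_K_E32 (i : Fin 3) (x : V) : ρ (UqGL.gen q (.K i)) (ρ (UqGL.gen q .E32) x) =
    q ^ (-glWt23 i) • ρ (UqGL.gen q .E32) (ρ (UqGL.gen q (.K i)) x) :=
  apply_of_conj (by simpa using UqGL.map_rel ρ (.K_E32 i)) (gl_Kinv_mul_K ρ i) x

/-- An operator `K` and its inverse have opposite weights. -/
theorem gl_Kinv_apply (hq0 : q ≠ 0) {E : Module.End ℂ V} {i : Fin 3} {z : ℤ}
    (h : ∀ x, ρ (UqGL.gen q (.K i)) (E x) = q ^ z • E (ρ (UqGL.gen q (.K i)) x)) (x : V) :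
    ρ (UqGL.gen q (.Kinv i)) (E x) = q ^ (-z) • E (ρ (UqGL.gen q (.Kinv i)) x) := by
  rw [zpow_neg]
  exact inv_apply_of_apply h (zpow_ne_zero _ hq0) (gl_Kinv_mul_K ρ i) (gl_K_mul_Kinv ρ i) x

theorem gl_h₁_apply (hq0 : q ≠ 0) {E : Module.End ℂ V} {w : Fin 3 → ℤ}
    (h : ∀ i x, ρ (UqGL.gen q (.K i)) (E x) = q ^ w i • E (ρ (UqGL.gen q (.K i)) x)) (x : V) :
    ρ (UqGL.gen q (.K 0) * UqGL.gen q (.Kinv 1)) (E x) =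
      q ^ (w 0 - w 1) • E (ρ (UqGL.gen q (.K 0) * UqGL.gen q (.Kinv 1)) x) := by
  rw [map_mul, Module.End.mul_apply, gl_Kinv_apply ρ hq0 (h 1), map_smul, h 0, smul_smul,
    ← zpow_add₀ hq0, Module.End.mul_apply, neg_add_eq_sub]

theorem gl_h₂_apply (hq0 : q ≠ 0) {E : Module.End ℂ V} {w : Fin 3 → ℤ}
    (h : ∀ i x, ρ (UqGL.gen q (.K i)) (E x) = q ^ w i • E (ρ (UqGL.gen q (.K i)) x)) (x : V) :
    ρ (UqGL.gen q (.K 1) * UqGL.gen q (.K 2)) (E x) =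
      q ^ (w 1 + w 2) • E (ρ (UqGL.gen q (.K 1) * UqGL.gen q (.K 2)) x) := by
  rw [map_mul, Module.End.mul_apply, h 2, map_smul, h 1, smul_smul,
    ← zpow_add₀ hq0, Module.End.mul_apply, add_comm]

theorem gl_isChevalleyModule (hq0 : q ≠ 0) (hq : ∀ N : ℕ, 0 < N → q ^ N ≠ 1) :
    IsChevalleyModule q (ρ (UqGL.gen q (.K 0) * UqGL.gen q (.Kinv 1)))
      (ρ (UqGL.gen q (.Kinv 0) * UqGL.gen q (.K 1))) (ρ (UqGL.gen q (.K 1) * UqGL.gen q (.K 2)))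
      (ρ (UqGL.gen q (.Kinv 1) * UqGL.gen q (.Kinv 2))) (ρ (UqGL.gen q .E12))
      (ρ (UqGL.gen q .E21)) (ρ (UqGL.gen q .E23)) (ρ (UqGL.gen q .E32)) := by
  have hK : ∀ i x, ρ (UqGL.gen q (.K i)) (ρ (UqGL.gen q (.Kinv i)) x) = x :=
    fun i => LinearMap.congr_fun (gl_K_mul_Kinv ρ i)
  have hK' : ∀ i x, ρ (UqGL.gen q (.Kinv i)) (ρ (UqGL.gen q (.K i)) x) = x :=
    fun i => LinearMap.congr_fun (gl_Kinv_mul_K ρ i)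
  refine .of_rel hq0 hq (fun x y h => ?_) ?_ ?_
    (gl_h₁_apply ρ hq0 (w := fun i => -glWt12 i) (gl_K_E21 ρ))
    (gl_h₁_apply ρ hq0 (w := fun i => -glWt23 i) (gl_K_E32 ρ))
    (gl_h₂_apply ρ hq0 (w := fun i => -glWt12 i) (gl_K_E21 ρ))
    (gl_h₂_apply ρ hq0 (w := fun i => -glWt23 i) (gl_K_E32 ρ))
  · obtain ⟨σ, hs, hσ⟩ : ∃ σ : FreeAlgebra ℂ GLGen →ₐ[ℂ] Module.End ℂ V,
        (∀ s, ρ (UqGL.gen q s) = σ (gx s)) ∧ ∀ x y, GLRel q x y → σ x = σ y :=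
      ⟨FreeAlgebra.lift ℂ (fun s => ρ (UqGL.gen q s)), fun s => by simp,
        fun _ _ => UqGL.map_rel ρ⟩
    simp only [map_mul, hs] at h
    simp only [← map_mul] at h
    obtain ⟨x', y', h', rfl, rfl⟩ := ChevalleyRel.exists_of_map _ h
    exact hσ _ _ (.chevalley h')
  · ext x
    simp only [map_mul, Module.End.mul_apply, Module.End.one_apply]
    rw [← gl_Kinv_K ρ 1 0, hK, hK']
  · ext x
    simp only [map_mul, Module.End.mul_apply, Module.End.one_apply]
    rw [gl_Kinv_K ρ 2 1, hK', hK']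

end Relations

theorem glTwist_gen (s : GLGen) : glTwist q (UqGL.gen q s) = glSign q s := by
  rw [glTwist, UqGL.gen, UqGL.mk]
  exact (RingQuot.liftAlgHom_mkAlgHom_apply _ _ _ _).trans (FreeAlgebra.lift_ι_apply _ _)

/-- Being an involution, the twist is surjective, so composing with it preserves irreducibility. -/
theorem glTwist_glTwist (x : UqGL q) : glTwist q (glTwist q x) = x := by
  have : (glTwist q).comp (glTwist q) = AlgHom.id ℂ _ := by
    refine RingQuot.ringQuot_ext' ℂ _ _ (FreeAlgebra.hom_ext (funext fun s => ?_))
    change glTwist q (glTwist q (UqGL.gen q s)) = UqGL.gen q s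
    rw [glTwist_gen]
    cases s <;> simp only [glSign] <;> (try split_ifs) <;> simp_all [glTwist_gen, glSign]
  exact DFunLike.congr_fun this x

theorem IsIrreducibleRep.comp_of_surjective {A : Type*} [Ring A] [Algebra ℂ A]
    {ρ : A →ₐ[ℂ] Module.End ℂ V} (h : IsIrreducibleRep ρ) {τ : A →ₐ[ℂ] A}
    (hτ : Function.Surjective τ) : IsIrreducibleRep (ρ.comp τ) := by
  refine ⟨h.1, fun p hp => h.2 p fun x => ?_⟩
  obtain ⟨y, rfl⟩ := hτ x
  exact hp y

/-- The data of a highest weight vector of a representation of `U_q[gl(2/1)]`. -/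
structure IsGLHighest (ρ : UqGL q →ₐ[ℂ] Module.End ℂ V) (κ : Fin 3 → ℂ) (v : V) : Prop where
  ne_zero : v ≠ 0
  e12_apply : ρ (UqGL.gen q .E12) v = 0
  e23_apply : ρ (UqGL.gen q .E23) v = 0
  K_apply : ∀ i, ρ (UqGL.gen q (.K i)) v = κ i • v

theorem exists_isGLHighest [FiniteDimensional ℂ V] [Nontrivial V] (hq0 : q ≠ 0)
    (hq : ∀ N : ℕ, 0 < N → q ^ N ≠ 1) (ρ : UqGL q →ₐ[ℂ] Module.End ℂ V) :
    ∃ κ v, IsGLHighest ρ κ v := by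
  have hinj : ∀ {K K' : Module.End ℂ V}, K' * K = 1 → Function.Injective K := fun h =>
    Function.LeftInverse.injective (LinearMap.congr_fun h)
  obtain ⟨v, hv0, h12, h23, hκ⟩ := exists_highest_vector hq0 hq
    -- `K₁K₃⁻¹` has weight `1` on both `E₁₂` and `E₂₃`.
    (T := ρ (UqGL.gen q (.K 0)) * ρ (UqGL.gen q (.Kinv 2)))
    (A := ρ (UqGL.gen q .E12)) (B := ρ (UqGL.gen q .E23))
    ((hinj (gl_Kinv_mul_K ρ 0)).comp (hinj (gl_K_mul_Kinv ρ 2)))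
    (fun x => by
      rw [Module.End.mul_apply, gl_Kinv_apply ρ hq0 (gl_K_E12 ρ 2), map_smul, gl_K_E12]
      simp [glWt12])
    (fun x => by
      rw [Module.End.mul_apply, gl_Kinv_apply ρ hq0 (gl_K_E23 ρ 2), map_smul, gl_K_E23]
      simp [glWt23])
    (List.ofFn fun i => ρ (UqGL.gen q (.K i)))
    (fun f hf g hg x => by
      rw [List.mem_ofFn] at hf hg
      obtain ⟨i, rfl⟩ := hf
      obtain ⟨j, rfl⟩ := hg
      exact gl_K_K ρ i j x)
    (fun f hf x => by
      rw [List.mem_ofFn] at hf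
      obtain ⟨i, rfl⟩ := hf
      rw [Module.End.mul_apply, gl_Kinv_K ρ, gl_K_K, Module.End.mul_apply])
  choose κ hκ' using fun i : Fin 3 => hκ _ (List.mem_ofFn.2 ⟨i, rfl⟩)
  exact ⟨κ, v, hv0, h12, h23, hκ'⟩

theorem IsGLHighest.kappa_ne_zero {ρ : UqGL q →ₐ[ℂ] Module.End ℂ V} {κ : Fin 3 → ℂ} {v : V}
    (h : IsGLHighest ρ κ v) (i : Fin 3) : κ i ≠ 0 :=
  (inv_apply_of_eigenvector (gl_Kinv_mul_K ρ i) h.ne_zero (h.K_apply i)).1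

theorem IsGLHighest.h₁_apply {ρ : UqGL q →ₐ[ℂ] Module.End ℂ V} {κ : Fin 3 → ℂ} {v : V}
    (h : IsGLHighest ρ κ v) :
    ρ (UqGL.gen q (.K 0) * UqGL.gen q (.Kinv 1)) v = (κ 0 * (κ 1)⁻¹) • v := by
  rw [map_mul, Module.End.mul_apply,
    (inv_apply_of_eigenvector (gl_Kinv_mul_K ρ 1) h.ne_zero (h.K_apply 1)).2, map_smul,
    h.K_apply, smul_smul, mul_comm]

theorem inFamilyGL_of_isGLHighest [FiniteDimensional ℂ V] (hq0 : q ≠ 0)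
    (hq : ∀ N : ℕ, 0 < N → q ^ N ≠ 1) (a₁ a₂ a₃ : Signature → ℂ) (ha₁ : ∀ Λ, a₁ Λ ≠ 0)
    (ha₂ : ∀ Λ, a₂ Λ ≠ 0) (ha₃ : ∀ Λ, a₃ Λ ≠ 0) {ρ : UqGL q →ₐ[ℂ] Module.End ℂ V}
    (hρ : IsIrreducibleRep ρ) {κ : Fin 3 → ℂ} {v : V} (h : IsGLHighest ρ κ v) {n : ℕ}
    (hn : κ 0 * (κ 1)⁻¹ = q ^ n) : InFamilyGL q a₁ a₂ a₃ ρ := by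
  -- Any logarithms of the weights of `K₂`, `K₃` serve as `m₂₃`, `m₃₃`; then `m₁₃ = m₂₃ + n` matches
  -- the weight of `K₁`.
  obtain ⟨m23, hm23⟩ := exists_cpow_eq hq0 hq (h.kappa_ne_zero 1)
  obtain ⟨m33, hm33⟩ := exists_cpow_eq hq0 hq (h.kappa_ne_zero 2)
  have hm13 : q ^ (m23 + n) = κ 0 := by
    rw [Complex.cpow_add _ _ hq0, hm23, Complex.cpow_natCast, ← hn, mul_comm,
      inv_mul_cancel_right₀ (h.kappa_ne_zero 1)]
  set Λ : Signature := ⟨m23, m33, n⟩ with hΛ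
  have C := gl_isChevalleyModule ρ hq0 hq
  have hv : IsHighestWeight q Λ.twoL (Λ.m23 + Λ.m33)
      (ρ (UqGL.gen q (.K 0) * UqGL.gen q (.Kinv 1)))
      (ρ (UqGL.gen q (.K 1) * UqGL.gen q (.K 2)))
      (ρ (UqGL.gen q .E12)) (ρ (UqGL.gen q .E23)) v :=
    { H₁_apply := by rw [h.h₁_apply, hn, Complex.cpow_natCast]
      H₂_apply := by
        rw [map_mul, Module.End.mul_apply, h.K_apply, map_smul, h.K_apply, smul_smul,
          Complex.cpow_add _ _ hq0, hm23, hm33, mul_comm]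
      e12_apply := h.e12_apply
      e23_apply := h.e23_apply }
  obtain ⟨S, b, hcl, hact, hb⟩ := C.exists_basis hv h.ne_zero (ha₁ Λ) (ha₂ Λ) (ha₃ Λ)
    -- Sums of the `V_k` consist of Cartan weight vectors, so invariance needs checking only for the
    -- four Chevalley generators.
    fun s hs => hρ.2 _ fun x => UqGL.forall_mem ρ (fun t y hy => by
      cases t with
      | K i => exact diagonal_mem_gzSpan (gl_K_E21 ρ i) (gl_K_E32 ρ i) (h.K_apply i) hy
      | Kinv i =>
        exact diagonal_mem_gzSpan (gl_Kinv_apply ρ hq0 (gl_K_E21 ρ i))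
          (gl_Kinv_apply ρ hq0 (gl_K_E32 ρ i))
          (inv_apply_of_eigenvector (gl_Kinv_mul_K ρ i) h.ne_zero (h.K_apply i)).2 hy
      | E12 => exact (hs y hy).1
      | E21 => exact (hs y hy).2.1
      | E23 => exact (hs y hy).2.2.1
      | E32 => exact (hs y hy).2.2.2) x
  refine ⟨Λ, S, b, hcl, hact, fun k _ j hj => ?_⟩
  obtain ⟨i, rfl, -⟩ := hj.exists_natCast
  have hs : (Signature.shift3 k : ℂ) = Signature.shift1 k + Signature.shift2 k := by
    rw [← shift1_add_shift2]; push_cast; ring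
  rw [hb]
  refine ⟨?_, ?_, ?_⟩
  · rw [apply_gzFun_cpow hq0 (gl_K_E21 ρ 0) (gl_K_E32 ρ 0) (by rw [h.K_apply, ← hm13])]
    congr 2
    simp [glWt12, glWt23, Signature.wt11, Signature.l11, Signature.m13, hΛ]
    ring
  · rw [apply_gzFun_cpow hq0 (gl_K_E21 ρ 1) (gl_K_E32 ρ 1) (by rw [h.K_apply, ← hm23])]
    congr 2
    simp [glWt12, glWt23, Signature.wt22, Signature.l11, Signature.l12, Signature.l22,
      Signature.m13, hΛ, hs]
    ring
  · rw [apply_gzFun_cpow hq0 (gl_K_E21 ρ 2) (gl_K_E32 ρ 2) (by rw [h.K_apply, ← hm33])]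
    congr 2
    simp [glWt12, glWt23, Signature.wt33, Signature.l31, hΛ]

theorem IsGLHighest.comp_glTwist {ρ : UqGL q →ₐ[ℂ] Module.End ℂ V} {κ : Fin 3 → ℂ} {v : V}
    (h : IsGLHighest ρ κ v) : IsGLHighest (ρ.comp (glTwist q)) ![-κ 0, κ 1, κ 2] v where
  ne_zero := h.ne_zero
  e12_apply := by rw [AlgHom.comp_apply, glTwist_gen]; exact h.e12_apply
  e23_apply := by rw [AlgHom.comp_apply, glTwist_gen]; exact h.e23_apply
  K_apply i := by
    rw [AlgHom.comp_apply, glTwist_gen]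
    fin_cases i <;> simp [glSign, h.K_apply]

theorem inFamilyGL_of_isIrreducibleRep [FiniteDimensional ℂ V] (hq0 : q ≠ 0)
    (hq : ∀ N : ℕ, 0 < N → q ^ N ≠ 1) (a₁ a₂ a₃ : Signature → ℂ) (ha₁ : ∀ Λ, a₁ Λ ≠ 0)
    (ha₂ : ∀ Λ, a₂ Λ ≠ 0) (ha₃ : ∀ Λ, a₃ Λ ≠ 0) (ρ : UqGL q →ₐ[ℂ] Module.End ℂ V)
    (hρ : IsIrreducibleRep ρ) :
    (HasIntegralWeights q (ρ (UqGL.gen q (.K 0) * UqGL.gen q (.Kinv 1))) →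
      InFamilyGL q a₁ a₂ a₃ ρ) ∧
    (InFamilyGL q a₁ a₂ a₃ ρ ∨ InFamilyGL q a₁ a₂ a₃ (ρ.comp (glTwist q))) := by
  have : Nontrivial V := hρ.1
  obtain ⟨κ, v, h⟩ := exists_isGLHighest hq0 hq ρ
  obtain ⟨n, hn | hn⟩ := (gl_isChevalleyModule ρ hq0 hq).exists_eq_or_eq_neg h.ne_zero
    h.e12_apply h.h₁_apply
  · have := inFamilyGL_of_isGLHighest hq0 hq a₁ a₂ a₃ ha₁ ha₂ ha₃ hρ h hn
    exact ⟨fun _ => this, .inl this⟩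
  · refine ⟨fun hint => ?_, .inr ?_⟩
    -- In type 1 the eigenvalue of `q^{h₁}` on the highest weight vector would be both `-q^n` and an
    -- integral power of `q`.
    · obtain ⟨z, hz⟩ := hint _ (Module.End.hasEigenvalue_of_hasEigenvector
        ⟨Module.End.mem_eigenspace_iff.2 h.h₁_apply, h.ne_zero⟩)
      exact absurd (hn.symm.trans hz) (neg_pow_ne_zpow hq0 hq n z)
    · refine inFamilyGL_of_isGLHighest hq0 hq a₁ a₂ a₃ ha₁ ha₂ ha₃
        (hρ.comp_of_surjective fun x => ⟨glTwist q x, glTwist_glTwist x⟩) h.comp_glTwist (n := n) ?_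
      simp [hn]

end GeneralLinear

/-! ## `U_q[sl(2/1)]` -/

section SpecialLinear

variable {V : Type*} [AddCommGroup V] [Module ℂ V] {q : ℂ}

theorem UqSL.map_rel (ρ : UqSL q →ₐ[ℂ] Module.End ℂ V) {x y : FreeAlgebra ℂ SLGen}
    (h : SLRel q x y) : FreeAlgebra.lift ℂ (fun s => ρ (UqSL.gen q s)) x =
      FreeAlgebra.lift ℂ (fun s => ρ (UqSL.gen q s)) y := by
  have e : FreeAlgebra.lift ℂ (fun s => ρ (UqSL.gen q s)) =
      ρ.comp (FreeAlgebra.lift ℂ (UqSL.gen q)) := by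
    ext s; simp
  rw [e, AlgHom.comp_apply, AlgHom.comp_apply, UqSL.rel q h]

theorem UqSL.forall_mem (ρ : UqSL q →ₐ[ℂ] Module.End ℂ V) {p : Submodule ℂ V}
    (hp : ∀ s, ∀ v ∈ p, ρ (UqSL.gen q s) v ∈ p) (x : UqSL q) : ∀ v ∈ p, ρ x v ∈ p := by
  obtain ⟨y, rfl⟩ : ∃ y, UqSL.mk q y = x := RingQuot.mkAlgHom_surjective ℂ (SLRel q) x
  induction y using FreeAlgebra.induction with
  | grade0 c =>
    intro v hv
    rw [AlgHom.commutes, AlgHom.commutes, Module.algebraMap_end_apply]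
    exact p.smul_mem c hv
  | grade1 s => exact hp s
  | mul a b iha ihb =>
    intro v hv
    rw [map_mul, map_mul, Module.End.mul_apply]
    exact iha _ (ihb v hv)
  | add a b iha ihb =>
    intro v hv
    rw [map_add, map_add, LinearMap.add_apply]
    exact p.add_mem (iha v hv) (ihb v hv)

section Relations

variable (ρ : UqSL q →ₐ[ℂ] Module.End ℂ V)

theorem sl_T_mul_Tinv (i : Fin 2) : ρ (UqSL.gen q (.T i)) * ρ (UqSL.gen q (.Tinv i)) = 1 := by
  simpa using UqSL.map_rel ρ (.T_Tinv i)

theorem sl_Tinv_mul_T (i : Fin 2) : ρ (UqSL.gen q (.Tinv i)) * ρ (UqSL.gen q (.T i)) = 1 := by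
  simpa using UqSL.map_rel ρ (.Tinv_T i)

theorem sl_T_T (i j : Fin 2) (x : V) : ρ (UqSL.gen q (.T i)) (ρ (UqSL.gen q (.T j)) x) =
    ρ (UqSL.gen q (.T j)) (ρ (UqSL.gen q (.T i)) x) := by
  simpa using LinearMap.congr_fun (UqSL.map_rel ρ (.T_T i j)) x

theorem sl_Tinv_T (i j : Fin 2) (x : V) :
    ρ (UqSL.gen q (.Tinv i)) (ρ (UqSL.gen q (.T j)) x) =
    ρ (UqSL.gen q (.T j)) (ρ (UqSL.gen q (.Tinv i)) x) := by
  simpa using inv_apply_of_apply (c := 1) (fun x => by rw [sl_T_T, one_smul]) one_ne_zero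
    (sl_Tinv_mul_T ρ i) (sl_T_mul_Tinv ρ i) x

theorem sl_T_E12 (i : Fin 2) (x : V) : ρ (UqSL.gen q (.T i)) (ρ (UqSL.gen q .E12) x) =
    q ^ slWt12 i • ρ (UqSL.gen q .E12) (ρ (UqSL.gen q (.T i)) x) :=
  apply_of_conj (by simpa using UqSL.map_rel ρ (.T_E12 i)) (sl_Tinv_mul_T ρ i) x

theorem sl_T_E21 (i : Fin 2) (x : V) : ρ (UqSL.gen q (.T i)) (ρ (UqSL.gen q .E21) x) =
    q ^ (-slWt12 i) • ρ (UqSL.gen q .E21) (ρ (UqSL.gen q (.T i)) x) :=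
  apply_of_conj (by simpa using UqSL.map_rel ρ (.T_E21 i)) (sl_Tinv_mul_T ρ i) x

theorem sl_T_E23 (i : Fin 2) (x : V) : ρ (UqSL.gen q (.T i)) (ρ (UqSL.gen q .E23) x) =
    q ^ slWt23 i • ρ (UqSL.gen q .E23) (ρ (UqSL.gen q (.T i)) x) :=
  apply_of_conj (by simpa using UqSL.map_rel ρ (.T_E23 i)) (sl_Tinv_mul_T ρ i) x

theorem sl_T_E32 (i : Fin 2) (x : V) : ρ (UqSL.gen q (.T i)) (ρ (UqSL.gen q .E32) x) =
    q ^ (-slWt23 i) • ρ (UqSL.gen q .E32) (ρ (UqSL.gen q (.T i)) x) :=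
  apply_of_conj (by simpa using UqSL.map_rel ρ (.T_E32 i)) (sl_Tinv_mul_T ρ i) x

/-- An operator `q^{h_i}` and its inverse have opposite weights. -/
theorem sl_Tinv_apply (hq0 : q ≠ 0) {E : Module.End ℂ V} {i : Fin 2} {z : ℤ}
    (h : ∀ x, ρ (UqSL.gen q (.T i)) (E x) = q ^ z • E (ρ (UqSL.gen q (.T i)) x)) (x : V) :
    ρ (UqSL.gen q (.Tinv i)) (E x) = q ^ (-z) • E (ρ (UqSL.gen q (.Tinv i)) x) := by
  rw [zpow_neg]
  exact inv_apply_of_apply h (zpow_ne_zero _ hq0) (sl_Tinv_mul_T ρ i) (sl_T_mul_Tinv ρ i) x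

theorem sl_isChevalleyModule (hq0 : q ≠ 0) (hq : ∀ N : ℕ, 0 < N → q ^ N ≠ 1) :
    IsChevalleyModule q (ρ (UqSL.gen q (.T 0))) (ρ (UqSL.gen q (.Tinv 0)))
      (ρ (UqSL.gen q (.T 1))) (ρ (UqSL.gen q (.Tinv 1))) (ρ (UqSL.gen q .E12))
      (ρ (UqSL.gen q .E21)) (ρ (UqSL.gen q .E23)) (ρ (UqSL.gen q .E32)) := by
  refine .of_rel hq0 hq (fun x y h => ?_) (sl_Tinv_mul_T ρ 0) (sl_Tinv_mul_T ρ 1)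
    (sl_T_E21 ρ 0) (sl_T_E32 ρ 0) (sl_T_E21 ρ 1) (sl_T_E32 ρ 1)
  obtain ⟨σ, hs, hσ⟩ : ∃ σ : FreeAlgebra ℂ SLGen →ₐ[ℂ] Module.End ℂ V,
      (∀ s, ρ (UqSL.gen q s) = σ (sx s)) ∧ ∀ x y, SLRel q x y → σ x = σ y :=
    ⟨FreeAlgebra.lift ℂ (fun s => ρ (UqSL.gen q s)), fun s => by simp, fun _ _ => UqSL.map_rel ρ⟩
  simp only [hs] at h
  obtain ⟨x', y', h', rfl, rfl⟩ := ChevalleyRel.exists_of_map _ h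
  exact hσ _ _ (.chevalley h')

end Relations

theorem slTwist_gen (s : SLGen) : slTwist q (UqSL.gen q s) = slSign q s := by
  rw [slTwist, UqSL.gen, UqSL.mk]
  exact (RingQuot.liftAlgHom_mkAlgHom_apply _ _ _ _).trans (FreeAlgebra.lift_ι_apply _ _)

theorem slTwist_slTwist (x : UqSL q) : slTwist q (slTwist q x) = x := by
  have : (slTwist q).comp (slTwist q) = AlgHom.id ℂ _ := by
    refine RingQuot.ringQuot_ext' ℂ _ _ (FreeAlgebra.hom_ext (funext fun s => ?_))
    change slTwist q (slTwist q (UqSL.gen q s)) = UqSL.gen q s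
    rw [slTwist_gen]
    cases s <;> simp only [slSign] <;> (try split_ifs) <;> simp_all [slTwist_gen, slSign]
  exact DFunLike.congr_fun this x

/-- The data of a highest weight vector of a representation of `U_q[sl(2/1)]`. -/
structure IsSLHighest (ρ : UqSL q →ₐ[ℂ] Module.End ℂ V) (κ : Fin 2 → ℂ) (v : V) : Prop where
  ne_zero : v ≠ 0
  e12_apply : ρ (UqSL.gen q .E12) v = 0
  e23_apply : ρ (UqSL.gen q .E23) v = 0
  T_apply : ∀ i, ρ (UqSL.gen q (.T i)) v = κ i • v

theorem exists_isSLHighest [FiniteDimensional ℂ V] [Nontrivial V] (hq0 : q ≠ 0)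
    (hq : ∀ N : ℕ, 0 < N → q ^ N ≠ 1) (ρ : UqSL q →ₐ[ℂ] Module.End ℂ V) :
    ∃ κ v, IsSLHighest ρ κ v := by
  have hinj : ∀ i, Function.Injective (ρ (UqSL.gen q (.Tinv i))) := fun i =>
    Function.LeftInverse.injective (LinearMap.congr_fun (sl_T_mul_Tinv ρ i))
  -- The operator `q^{-h₁-3h₂}` has weight `1` on both raising generators: `-2 + 3` on `E₁₂` and `1
  -- + 0` on `E₂₃`.
  have hT : ∀ {E : Module.End ℂ V} {w : Fin 2 → ℤ},
      (∀ i x, ρ (UqSL.gen q (.T i)) (E x) = q ^ w i • E (ρ (UqSL.gen q (.T i)) x)) →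
      -w 0 - 3 * w 1 = 1 → ∀ x,
      (ρ (UqSL.gen q (.Tinv 0)) * ρ (UqSL.gen q (.Tinv 1)) * ρ (UqSL.gen q (.Tinv 1)) *
        ρ (UqSL.gen q (.Tinv 1))) (E x) =
      q • E ((ρ (UqSL.gen q (.Tinv 0)) * ρ (UqSL.gen q (.Tinv 1)) * ρ (UqSL.gen q (.Tinv 1)) *
        ρ (UqSL.gen q (.Tinv 1))) x) := by
    intro E w h hw x
    simp only [Module.End.mul_apply, sl_Tinv_apply ρ hq0 (h _), map_smul, smul_smul,
      ← zpow_add₀ hq0]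
    rw [show -w 1 + (-w 1 + (-w 1 + -w 0)) = 1 by omega, zpow_one]
  obtain ⟨v, hv0, h12, h23, hκ⟩ := exists_highest_vector hq0 hq
    (((hinj 0).comp ((hinj 1).comp ((hinj 1).comp (hinj 1)))) :
      Function.Injective (ρ (UqSL.gen q (.Tinv 0)) * ρ (UqSL.gen q (.Tinv 1)) *
        ρ (UqSL.gen q (.Tinv 1)) * ρ (UqSL.gen q (.Tinv 1))))
    (hT (sl_T_E12 ρ) (by simp [slWt12])) (hT (sl_T_E23 ρ) (by simp [slWt23]))
    (List.ofFn fun i => ρ (UqSL.gen q (.T i)))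
    (fun f hf g hg x => by
      rw [List.mem_ofFn] at hf hg
      obtain ⟨i, rfl⟩ := hf
      obtain ⟨j, rfl⟩ := hg
      exact sl_T_T ρ i j x)
    (fun f hf x => by
      rw [List.mem_ofFn] at hf
      obtain ⟨i, rfl⟩ := hf
      simp only [Module.End.mul_apply, sl_Tinv_T ρ])
  choose κ hκ' using fun i : Fin 2 => hκ _ (List.mem_ofFn.2 ⟨i, rfl⟩)
  exact ⟨κ, v, hv0, h12, h23, hκ'⟩

theorem inFamilySL_of_isSLHighest [FiniteDimensional ℂ V] (hq0 : q ≠ 0)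
    (hq : ∀ N : ℕ, 0 < N → q ^ N ≠ 1) (a₁ a₂ a₃ : Signature → ℂ) (ha₁ : ∀ Λ, a₁ Λ ≠ 0)
    (ha₂ : ∀ Λ, a₂ Λ ≠ 0) (ha₃ : ∀ Λ, a₃ Λ ≠ 0) {ρ : UqSL q →ₐ[ℂ] Module.End ℂ V}
    (hρ : IsIrreducibleRep ρ) {κ : Fin 2 → ℂ} {v : V} (h : IsSLHighest ρ κ v) {n : ℕ}
    (hn : κ 0 = q ^ n) : InFamilySL q a₁ a₂ a₃ ρ := by
  have hinv := fun i => inv_apply_of_eigenvector (sl_Tinv_mul_T ρ i) h.ne_zero (h.T_apply i)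
  obtain ⟨m23, hm23⟩ := exists_cpow_eq hq0 hq (hinv 1).1
  -- For `sl` only `m₂₃ + m₃₃` is determined by the weights, so `m₃₃ = 0` may be chosen.
  set Λ : Signature := ⟨m23, 0, n⟩ with hΛ
  have C := sl_isChevalleyModule ρ hq0 hq
  have hv : IsHighestWeight q Λ.twoL (Λ.m23 + Λ.m33) (ρ (UqSL.gen q (.T 0)))
      (ρ (UqSL.gen q (.T 1))) (ρ (UqSL.gen q .E12)) (ρ (UqSL.gen q .E23)) v :=
    { H₁_apply := by rw [h.T_apply, hn, Complex.cpow_natCast]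
      H₂_apply := by rw [h.T_apply, add_zero, hm23]
      e12_apply := h.e12_apply
      e23_apply := h.e23_apply }
  obtain ⟨S, b, hcl, hact, hb⟩ := C.exists_basis hv h.ne_zero (ha₁ Λ) (ha₂ Λ) (ha₃ Λ)
    fun s hs => hρ.2 _ fun x => UqSL.forall_mem ρ (fun t y hy => by
      cases t with
      | T i => exact diagonal_mem_gzSpan (sl_T_E21 ρ i) (sl_T_E32 ρ i) (h.T_apply i) hy
      | Tinv i =>
        exact diagonal_mem_gzSpan (sl_Tinv_apply ρ hq0 (sl_T_E21 ρ i))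
          (sl_Tinv_apply ρ hq0 (sl_T_E32 ρ i)) (hinv i).2 hy
      | E12 => exact (hs y hy).1
      | E21 => exact (hs y hy).2.1
      | E23 => exact (hs y hy).2.2.1
      | E32 => exact (hs y hy).2.2.2) x
  refine ⟨Λ, S, b, hcl, hact, fun k _ j hj => ?_⟩
  obtain ⟨i, rfl, -⟩ := hj.exists_natCast
  have hs : (Signature.shift3 k : ℂ) = Signature.shift1 k + Signature.shift2 k := by
    rw [← shift1_add_shift2]; push_cast; ring
  rw [hb]
  refine ⟨?_, ?_⟩
  · rw [apply_gzFun_cpow hq0 (sl_T_E21 ρ 0) (sl_T_E32 ρ 0) hv.H₁_apply]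
    congr 2
    simp [slWt12, slWt23, Signature.wt11, Signature.wt22, Signature.l11, Signature.l12,
      Signature.l22, Signature.m13, hΛ, hs]
    ring
  · rw [apply_gzFun_cpow hq0 (sl_T_E21 ρ 1) (sl_T_E32 ρ 1) hv.H₂_apply]
    congr 2
    simp [slWt12, slWt23, Signature.wt22, Signature.wt33, Signature.l11, Signature.l12,
      Signature.l22, Signature.l31, Signature.m13, hΛ, hs]
    ring

theorem IsSLHighest.comp_slTwist {ρ : UqSL q →ₐ[ℂ] Module.End ℂ V} {κ : Fin 2 → ℂ} {v : V}
    (h : IsSLHighest ρ κ v) : IsSLHighest (ρ.comp (slTwist q)) ![-κ 0, κ 1] v where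
  ne_zero := h.ne_zero
  e12_apply := by rw [AlgHom.comp_apply, slTwist_gen]; exact h.e12_apply
  e23_apply := by rw [AlgHom.comp_apply, slTwist_gen]; exact h.e23_apply
  T_apply i := by
    rw [AlgHom.comp_apply, slTwist_gen]
    fin_cases i <;> simp [slSign, h.T_apply]

theorem inFamilySL_of_isIrreducibleRep [FiniteDimensional ℂ V] (hq0 : q ≠ 0)
    (hq : ∀ N : ℕ, 0 < N → q ^ N ≠ 1) (a₁ a₂ a₃ : Signature → ℂ) (ha₁ : ∀ Λ, a₁ Λ ≠ 0)
    (ha₂ : ∀ Λ, a₂ Λ ≠ 0) (ha₃ : ∀ Λ, a₃ Λ ≠ 0) (ρ : UqSL q →ₐ[ℂ] Module.End ℂ V)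
    (hρ : IsIrreducibleRep ρ) :
    (HasIntegralWeights q (ρ (UqSL.gen q (.T 0))) → InFamilySL q a₁ a₂ a₃ ρ) ∧
    (InFamilySL q a₁ a₂ a₃ ρ ∨ InFamilySL q a₁ a₂ a₃ (ρ.comp (slTwist q))) := by
  have : Nontrivial V := hρ.1
  obtain ⟨κ, v, h⟩ := exists_isSLHighest hq0 hq ρ
  obtain ⟨n, hn | hn⟩ := (sl_isChevalleyModule ρ hq0 hq).exists_eq_or_eq_neg h.ne_zero
    h.e12_apply (h.T_apply 0)
  · have := inFamilySL_of_isSLHighest hq0 hq a₁ a₂ a₃ ha₁ ha₂ ha₃ hρ h hn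
    exact ⟨fun _ => this, .inl this⟩
  · refine ⟨fun hint => ?_, .inr ?_⟩
    · obtain ⟨z, hz⟩ := hint _ (Module.End.hasEigenvalue_of_hasEigenvector
        ⟨Module.End.mem_eigenspace_iff.2 (h.T_apply 0), h.ne_zero⟩)
      exact absurd (hn.symm.trans hz) (neg_pow_ne_zpow hq0 hq n z)
    · refine inFamilySL_of_isSLHighest hq0 hq a₁ a₂ a₃ ha₁ ha₂ ha₃
        (hρ.comp_of_surjective fun x => ⟨slTwist q x, slTwist_slTwist x⟩) h.comp_slTwist (n := n) ?_
      simp [hn]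

end SpecialLinear

end QuantumGL21

end

open QuantumGL21 in
theorem lemma5p9 (q : ℂ) (hq0 : q ≠ 0) (hq : ∀ N : ℕ, 0 < N → q ^ N ≠ 1)
    (a₁ a₂ a₃ : Signature → ℂ) (ha₁ : ∀ Λ, a₁ Λ ≠ 0) (ha₂ : ∀ Λ, a₂ Λ ≠ 0) (ha₃ : ∀ Λ, a₃ Λ ≠ 0)
    {V : Type*} [AddCommGroup V] [Module ℂ V] [FiniteDimensional ℂ V] :
    (∀ ρ : UqGL q →ₐ[ℂ] Module.End ℂ V, IsIrreducibleRep ρ →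
      (HasIntegralWeights q (ρ (UqGL.gen q (.K 0) * UqGL.gen q (.Kinv 1))) →
        InFamilyGL q a₁ a₂ a₃ ρ) ∧
      (InFamilyGL q a₁ a₂ a₃ ρ ∨ InFamilyGL q a₁ a₂ a₃ (ρ.comp (glTwist q)))) ∧
    (∀ ρ : UqSL q →ₐ[ℂ] Module.End ℂ V, IsIrreducibleRep ρ →
      (HasIntegralWeights q (ρ (UqSL.gen q (.T 0))) → InFamilySL q a₁ a₂ a₃ ρ) ∧
      (InFamilySL q a₁ a₂ a₃ ρ ∨ InFamilySL q a₁ a₂ a₃ (ρ.comp (slTwist q)))) :=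
  ⟨fun ρ hρ => inFamilyGL_of_isIrreducibleRep hq0 hq a₁ a₂ a₃ ha₁ ha₂ ha₃ ρ hρ,
    fun ρ hρ => inFamilySL_of_isIrreducibleRep hq0 hq a₁ a₂ a₃ ha₁ ha₂ ha₃ ρ hρ⟩
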